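/- Let $0<T<\infty$. For $t\in[0,T]$ let $V(t)$, $H(t)$ be real separable Hilbert spaces with $V(t)\subset H(t)$ (linear inclusions), the embedding of $V_0:=V(0)$ into $H_0:=H(0)$ being continuous and dense. Let $\phi_t\colon H_0\to H(t)$ be linear homeomorphisms that restrict to linear homeomorphisms $\phi_t\colon V_0\to V(t)$, and write $\phi_{-t}:=\phi_t^{-1}$. Assume that for $X=H$ and for $X=V$: $\phi_0=\mathrm{id}$; $\|\phi_tx\|_{X(t)}\le C_X\|x\|_{X_0}$ and $\|\phi_{-t}x\|_{X_0}\le C_X\|x\|_{X(t)}$ with $C_X$ independent of $t$; and $t\mapsto\|\phi_tx\|_{X(t)}$ is continuous for every $x\in X_0$. The embedding $V(t)\subset H(t)$ is then continuous and dense; identify $h\in H(t)$ with the functional $v\mapsto(h,v)_{H(t)}$ in $V^*(t)$. **Spaces.** $L^2_X$ ($X=V,H$) is the set of (a.e. classes of) functions $u$ with $u(t)\in X(t)$ and $\phi_{-(\cdot)}u(\cdot)\in L^2(0,T;X_0)$, and $L^2_{V^*}$ is the set of functions $f$ with $f(t)\in V^*(t)$ and $\phi_{(\cdot)}^*f(\cdot)\in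 L^2(0,T;V_0^*)$, where $\phi_t^*\colon V^*(t)\to V_0^*$ is the dual of $\phi_t\colon V_0\to V(t)$. Their norms are $\|u\|_{L^2_X}^2=\int_0^T\|u(t)\|_{X(t)}^2\,dt$ and $\|f\|_{L^2_{V^*}}^2=\int_0^T\|f(t)\|_{V^*(t)}^2\,dt$. **Standing assumption (differentiability of the norm).** For all $x\in H_0$ and $t\in[0,T]$ the derivative $\theta(t,x):=\frac{d}{dt}\|\phi_tx\|_{H(t)}^2$ exists classically, $x\mapsto\theta(t,x)$ is continuous, and $|\theta(t,x+y)-\theta(t,x-y)|\le C\|x\|_{H_0}\|y\|_{H_0}$ for all $x,y\in H_0$ with $C$ independent of $t$. Put $\hat\lambda(t;x,y):=\frac{d}{dt}(\phi_tx,\phi_ty)_{H(t)}$ for $x,y\in H_0$, $\lambda(t;v,w):=\hat\lambda(t;\phi_{-t}v,\phi_{-t}w)$ for $v,w\in H(t)$, and $\langle\Lambda(t)v,w\rangle:=\lambda(t;v,w)$. **Weak material derivative.** $g\in L^2_{V^*}$ is the weak material derivative $\dot u=\partial^\bullet u$ of $u\in L^2_V$ if $$\int_0^T\langle g(t),\phi_t\psi(t)\rangle_{V^*(t),V(t)}\,dt=-\int_0^T(u(t),\phi_t\psi'(t))_{H(t)}\,dt-\int_0^T\lambda(t;u(t),\phi_t\psi(t))\,dt\qquad\forall\psi\in\mathcal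 D((0,T);V_0).$$ $W(V,V^*)$ is the set of $u\in L^2_V$ that have a weak material derivative $\dot u\in L^2_{V^*}$, with norm $\|u\|_{W(V,V^*)}^2=\|u\|_{L^2_V}^2+\|\dot u\|_{L^2_{V^*}}^2$. Let $\mathcal W(V_0,V_0^*)$ be the space of $v\in L^2(0,T;V_0)$ whose usual weak derivative $v'$ (with respect to $V_0\subset H_0\subset V_0^*$) lies in $L^2(0,T;V_0^*)$, with norm $\|v\|_{\mathcal W}^2=\|v\|_{L^2(0,T;V_0)}^2+\|v'\|_{L^2(0,T;V_0^*)}^2$. **Standing assumption (evolving space equivalence).** For $v\in L^2_V$: $v\in W(V,V^*)$ if and only if $\phi_{-(\cdot)}v(\cdot)\in\mathcal W(V_0,V_0^*)$; and there are constants $c_1,c_2>0$ with $c_1\|\phi_{-(\cdot)}v\|_{\mathcal W}\le\|v\|_{W(V,V^*)}\le c_2\|\phi_{-(\cdot)}v\|_{\mathcal W}$ for all $v\in W(V,V^*)$. (Every $u\in W(V,V^*)$ then has a unique representative whose pullback $t\mapsto\phi_{-t}u(t)$ is in $C([0,T];H_0)$; $u(0)$ denotes the value of that representative.) **Assumptions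 on $L$.** $L(t)\colon V^*(t)\to V^*(t)$ are linear, and the following holds with positive constants $C_i$ independent of $t$. Put $(Lg)(t)=L(t)g(t)$. For a.e. $t$, $L(t)$ restricts to linear maps $H(t)\to H(t)$ and $V(t)\to V(t)$, the former being symmetric in $H(t)$; $Lh\in L^2_H$ for $h\in L^2_H$; and * (L1) $Lg\in L^2_{V^*}$ and $C_1\|g\|_{L^2_{V^*}}\le\|Lg\|_{L^2_{V^*}}\le C_2\|g\|_{L^2_{V^*}}$ for all $g\in L^2_{V^*}$; * (L2) for a.e. $t$, $\langle L(t)g,v\rangle=\langle g,L(t)v\rangle$ for all $g\in V^*(t)$, $v\in V(t)$; * (L3) for a.e. $t$, $\|L(t)h\|_{H(t)}\le C_3\|h\|_{H(t)}$ for all $h\in H(t)$; * (L4) for a.e. $t$, $(L(t)h,h)_{H(t)}\ge C_4\|h\|_{H(t)}^2$ for all $h\in H(t)$; * (L5) $Lv\in L^2_V$ for all $v\in L^2_V$; * (L6) for $v\in L^2_V$: $v\in W(V,V^*)$ if and only if $Lv\in W(V,V^*)$; * there are linear maps $\dot L(t)\colon V(t)\to V^*(t)$, symmetric for a.e. $t$,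 with $\dot Lv:=\dot L(\cdot)v(\cdot)\in L^2_{V^*}$ for $v\in L^2_V$, such that * (L7) $\partial^\bullet(Lv)=\dot Lv+L\dot v\in L^2_{V^*}$ for all $v\in W(V,V^*)$; * (L8) for a.e. $t$, $\|\dot L(t)v\|_{V^*(t)}\le C_5\|v\|_{H(t)}$ for all $v\in V(t)$. **Assumptions on $A$.** $A(t)\colon V(t)\to V^*(t)$ are linear, $t\mapsto\langle A(t)v(t),w(t)\rangle$ is measurable for all $v,w\in L^2_V$, and there are positive constants $C_1,C_2,C_3$ independent of $t$ such that for a.e. $t$ * (A1) $\langle A(t)v,v\rangle\ge C_1\|v\|_{V(t)}^2-C_2\|v\|_{H(t)}^2$ for all $v\in V(t)$; * (A2) $|\langle A(t)v,w\rangle|\le C_3\|v\|_{V(t)}\|w\|_{V(t)}$ for all $v,w\in V(t)$. **Theorem.** There is a constant $C>0$ such that for every $f\in L^2_{V^*}$ and every $u_0\in H_0$ there is a unique $u\in W(V,V^*)$ with $$L\dot u+Au+\Lambda u=f\ \text{ in }L^2_{V^*},\qquad u(0)=u_0\ \text{ in }H_0,$$ and it satisfies $$\|u\|_{W(V,V^*)}\le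 C\left(\|u_0\|_{H_0}+\|f\|_{L^2_{V^*}}\right).$$ -/

import Mathlib

open MeasureTheory Set
open scoped ContDiff ENNReal

noncomputable section

namespace EvolvingSpace

universe u v

/-- Lebesgue measure on the time interval `[0,T]`. Time-dependent families below are indexed by all
of `ℝ` for convenience; only the indices in `[0,T]` are ever constrained or integrated over. -/
abbrev timeMeasure (T : ℝ) : Measure ℝ := volume.restrict (Icc 0 T)

section Pair

variable {X : ℝ → Type u} [∀ t, NormedAddCommGroup (X t)] [∀ t, InnerProductSpace ℝ (X t)]

/-- Compatibility of a family of spaces `X t` and linear homeomorphisms `φ t : X 0 → X t`. -/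
structure Compatible (T : ℝ) (φ : ∀ t, X 0 ≃L[ℝ] X t) : Prop where
  zero : ∀ x : X 0, φ 0 x = x
  bounded : ∃ C : ℝ, ∀ t ∈ Icc 0 T,
    (∀ x : X 0, ‖φ t x‖ ≤ C * ‖x‖) ∧ (∀ x : X t, ‖(φ t).symm x‖ ≤ C * ‖x‖)
  continuous_norm : ∀ x : X 0, ContinuousOn (fun t => ‖φ t x‖) (Icc 0 T)

/-- `u` is (a representative of) an element of `L²_X`: its pullback is in `L²(0,T;X₀)`. -/
def MemL2 (T : ℝ) (φ : ∀ t, X 0 ≃L[ℝ] X t) (u : ∀ t, X t) : Prop :=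
  MemLp (fun t => (φ t).symm (u t)) 2 (timeMeasure T)

/-- `f` is (a representative of) an element of `L²_{X*}`: its pullback `t ↦ φₜ* f(t)` by the dual
operators is in `L²(0,T;X₀*)`. -/
def MemL2Dual (T : ℝ) (φ : ∀ t, X 0 ≃L[ℝ] X t) (f : ∀ t, StrongDual ℝ (X t)) : Prop :=
  MemLp (fun t => (f t).comp (φ t : X 0 →L[ℝ] X t)) 2 (timeMeasure T)

end Pair

/-- The norm `(∫₀ᵀ ‖u(t)‖²_{E(t)} dt)^{1/2}` of a time-dependent function; with `E = X` it is the norm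
of `L²_X`, with `E = X*` the norm of `L²_{X*}`. -/
def l2Norm (T : ℝ) {E : ℝ → Type u} [∀ t, NormedAddCommGroup (E t)] (u : ∀ t, E t) : ℝ :=
  Real.sqrt (∫ t, ‖u t‖ ^ 2 ∂timeMeasure T)

/-- `(∫₀ᵀ ‖u(t)‖² dt + ∫₀ᵀ ‖g(t)‖² dt)^{1/2}`; when `g` is the (material) derivative of `u` this is
the norm of `u` in the solution space. -/
def wNorm (T : ℝ) {E : ℝ → Type u} [∀ t, NormedAddCommGroup (E t)]
    {F : ℝ → Type v} [∀ t, NormedAddCommGroup (F t)] (u : ∀ t, E t) (g : ∀ t, F t) : ℝ :=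
  Real.sqrt ((∫ t, ‖u t‖ ^ 2 ∂timeMeasure T) + ∫ t, ‖g t‖ ^ 2 ∂timeMeasure T)

/-- `ψ ∈ 𝒟((0,T);E)`. -/
def IsTestFunction (T : ℝ) {E : Type u} [NormedAddCommGroup E] [NormedSpace ℝ E] (ψ : ℝ → E) :
    Prop :=
  ContDiff ℝ ∞ ψ ∧ HasCompactSupport ψ ∧ tsupport ψ ⊆ Ioo 0 T

/-- An evolving pair `V(t) ⊂ H(t)`, `t ∈ [0,T]`, with `V₀ ⊂ H₀` dense, `(H, φ)` compatible and
`(V, φ|_{V₀})` compatible. The inclusion `V(t) ⊂ H(t)` is the injective map `ι t`, and `φV t` is the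
restriction of `φH t` to `V₀`. -/
structure EvolvingPair (T : ℝ) (H : ℝ → Type u) (V : ℝ → Type v)
    [∀ t, NormedAddCommGroup (H t)] [∀ t, InnerProductSpace ℝ (H t)]
    [∀ t, NormedAddCommGroup (V t)] [∀ t, InnerProductSpace ℝ (V t)] where
  φH : ∀ t, H 0 ≃L[ℝ] H t
  φV : ∀ t, V 0 ≃L[ℝ] V t
  ι : ∀ t, V t →L[ℝ] H t
  ι_injective : ∀ t ∈ Icc 0 T, Function.Injective (ι t)
  ι_dense : DenseRange (ι 0)
  compatibleH : Compatible T φH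
  compatibleV : Compatible T φV
  restrict : ∀ t ∈ Icc 0 T, ∀ v : V 0, ι t (φV t v) = φH t (ι 0 v)

namespace EvolvingPair

variable {T : ℝ} {H : ℝ → Type u} {V : ℝ → Type v}
  [∀ t, NormedAddCommGroup (H t)] [∀ t, InnerProductSpace ℝ (H t)]
  [∀ t, NormedAddCommGroup (V t)] [∀ t, InnerProductSpace ℝ (V t)]
  (S : EvolvingPair T H V)

/-- The embedding `H(t) ⊂ V*(t)`, `⟨h, v⟩ = (h, v)_{H(t)}`. -/
def toDual (t : ℝ) (h : H t) : StrongDual ℝ (V t) := (innerSL ℝ h).comp (S.ι t)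

/-- `b̂(t;x,y) = (φₜ x, φₜ y)_{H(t)}` on `H₀ × H₀`. -/
def bHat (t : ℝ) (x y : H 0) : ℝ := inner ℝ (S.φH t x) (S.φH t y)

/-- `θ(t,x) = d/dt ‖φₜ x‖²_{H(t)}` (one-sided at the end points of `[0,T]`). -/
def theta (t : ℝ) (x : H 0) : ℝ := derivWithin (fun s => ‖S.φH s x‖ ^ 2) (Icc 0 T) t

/-- The assumption that the norms of `H(t)` depend differentiably on time. -/
structure DifferentiableNorm : Prop where
  differentiable : ∀ x : H 0, DifferentiableOn ℝ (fun s => ‖S.φH s x‖ ^ 2) (Icc 0 T)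
  continuous : ∀ t ∈ Icc 0 T, Continuous (S.theta t)
  bounded : ∃ C : ℝ, ∀ t ∈ Icc 0 T, ∀ x y : H 0,
    |S.theta t (x + y) - S.theta t (x - y)| ≤ C * ‖x‖ * ‖y‖

/-- `λ̂(t;x,y) = d/dt b̂(t;x,y)` on `H₀ × H₀`. -/
def lambdaHat (t : ℝ) (x y : H 0) : ℝ := derivWithin (fun s => S.bHat s x y) (Icc 0 T) t

/-- `λ(t;x,y) = λ̂(t;φ₋ₜ x, φ₋ₜ y)` on `H(t) × H(t)`; also `⟨Λ(t)x, y⟩ = λ(t;x,y)`. -/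
def lambda (t : ℝ) (x y : H t) : ℝ := S.lambdaHat t ((S.φH t).symm x) ((S.φH t).symm y)

/-- `u ∈ L²_V` has the weak material derivative `g ∈ L²_{V*}`. The test functions are
`η(t) = φₜ ψ(t)` with `ψ ∈ 𝒟((0,T);V₀)`, with strong material derivative `η̇(t) = φₜ ψ'(t)`. -/
def IsMaterialDeriv (u : ∀ t, V t) (g : ∀ t, StrongDual ℝ (V t)) : Prop :=
  MemL2 T S.φV u ∧ MemL2Dual T S.φV g ∧
    ∀ ψ : ℝ → V 0, IsTestFunction T ψ →
      ∫ t, g t (S.φV t (ψ t)) ∂timeMeasure T =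
        - (∫ t, inner ℝ (S.ι t (u t)) (S.ι t (S.φV t (deriv ψ t))) ∂timeMeasure T)
        - ∫ t, S.lambda t (S.ι t (u t)) (S.ι t (S.φV t (ψ t))) ∂timeMeasure T

/-- `u ∈ W(V,V*)`. -/
def MemW (u : ∀ t, V t) : Prop := ∃ g, S.IsMaterialDeriv u g

/-- `u ∈ L²(0,T;V₀)` has the (usual) weak derivative `w ∈ L²(0,T;V₀*)`. -/
def IsWeakDeriv (u : ℝ → V 0) (w : ℝ → StrongDual ℝ (V 0)) : Prop :=
  MemLp u 2 (timeMeasure T) ∧ MemLp w 2 (timeMeasure T) ∧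
    ∀ ζ : ℝ → ℝ, IsTestFunction T ζ → ∀ v : V 0,
      ∫ t, deriv ζ t * inner ℝ (S.ι 0 (u t)) (S.ι 0 v) ∂timeMeasure T =
        - ∫ t, ζ t * w t v ∂timeMeasure T

/-- The pullback `t ↦ φ₋ₜ u(t)`. -/
def pullback (u : ∀ t, V t) : ℝ → V 0 := fun t => (S.φV t).symm (u t)

/-- The evolving space equivalence between `W(V,V*)` and `𝒲(V₀,V₀*)`: pulling back identifies
the two spaces, with equivalent norms. -/
structure SpaceEquivalence : Prop where
  mem_iff : ∀ u : ∀ t, V t, MemL2 T S.φV u →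
    (S.MemW u ↔ ∃ w, S.IsWeakDeriv (S.pullback u) w)
  norm_equiv : ∃ C₁ C₂ : ℝ, 0 < C₁ ∧ 0 < C₂ ∧ ∀ (u : ∀ t, V t) (g : ∀ t, StrongDual ℝ (V t))
    (w : ℝ → StrongDual ℝ (V 0)), S.IsMaterialDeriv u g → S.IsWeakDeriv (S.pullback u) w →
      C₁ * wNorm T (E := fun _ => V 0) (F := fun _ => StrongDual ℝ (V 0)) (S.pullback u) w
          ≤ wNorm T u g ∧
      wNorm T u g
          ≤ C₂ * wNorm T (E := fun _ => V 0) (F := fun _ => StrongDual ℝ (V 0)) (S.pullback u) w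

/-- The assumptions (L1)–(L8) on `L(t) : V*(t) → V*(t)`. `LH t` and `LV t` are the restrictions of
`L t` to `H(t)` and to `V(t)`, and `Ldot t` is the derivative `L̇(t)`. -/
structure LAssumptions (L : ∀ t, StrongDual ℝ (V t) →ₗ[ℝ] StrongDual ℝ (V t))
    (LH : ∀ t, H t →ₗ[ℝ] H t) (LV : ∀ t, V t →ₗ[ℝ] V t)
    (Ldot : ∀ t, V t →ₗ[ℝ] StrongDual ℝ (V t)) : Prop where
  restrictH : ∀ᵐ t ∂timeMeasure T, ∀ h : H t, L t (S.toDual t h) = S.toDual t (LH t h)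
  restrictV : ∀ᵐ t ∂timeMeasure T, ∀ v : V t, LH t (S.ι t v) = S.ι t (LV t v)
  memL2H : ∀ h : ∀ t, H t, MemL2 T S.φH h → MemL2 T S.φH (fun t => LH t (h t))
  symmetric : ∀ᵐ t ∂timeMeasure T, ∀ h k : H t, inner ℝ (LH t h) k = inner ℝ h (LH t k)
  L1_mem : ∀ g : ∀ t, StrongDual ℝ (V t), MemL2Dual T S.φV g →
    MemL2Dual T S.φV (fun t => L t (g t))
  L1_bound : ∃ C₁ C₂ : ℝ, 0 < C₁ ∧ 0 < C₂ ∧ ∀ g : ∀ t, StrongDual ℝ (V t), MemL2Dual T S.φV g →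
    C₁ * l2Norm T g ≤ l2Norm T (fun t => L t (g t)) ∧
      l2Norm T (fun t => L t (g t)) ≤ C₂ * l2Norm T g
  L2 : ∀ᵐ t ∂timeMeasure T, ∀ (g : StrongDual ℝ (V t)) (v : V t), L t g v = g (LV t v)
  L3 : ∃ C₃ : ℝ, 0 < C₃ ∧ ∀ᵐ t ∂timeMeasure T, ∀ h : H t, ‖LH t h‖ ≤ C₃ * ‖h‖
  L4 : ∃ C₄ : ℝ, 0 < C₄ ∧ ∀ᵐ t ∂timeMeasure T, ∀ h : H t, C₄ * ‖h‖ ^ 2 ≤ inner ℝ (LH t h) h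
  L5 : ∀ v : ∀ t, V t, MemL2 T S.φV v → MemL2 T S.φV (fun t => LV t (v t))
  L6 : ∀ v : ∀ t, V t, MemL2 T S.φV v → (S.MemW v ↔ S.MemW (fun t => LV t (v t)))
  Ldot_mem : ∀ v : ∀ t, V t, MemL2 T S.φV v → MemL2Dual T S.φV (fun t => Ldot t (v t))
  Ldot_symmetric : ∀ᵐ t ∂timeMeasure T, ∀ v w : V t, Ldot t v w = Ldot t w v
  L7 : ∀ (v : ∀ t, V t) (g : ∀ t, StrongDual ℝ (V t)), S.IsMaterialDeriv v g →
    S.IsMaterialDeriv (fun t => LV t (v t)) (fun t => Ldot t (v t) + L t (g t))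
  L8 : ∃ C₅ : ℝ, 0 < C₅ ∧ ∀ᵐ t ∂timeMeasure T, ∀ v : V t, ‖Ldot t v‖ ≤ C₅ * ‖S.ι t v‖

/-- The assumptions (A1)–(A2) on `A(t) : V(t) → V*(t)`, with the measurability in time. -/
structure AAssumptions (A : ∀ t, V t →ₗ[ℝ] StrongDual ℝ (V t)) : Prop where
  measurable : ∀ v w : ∀ t, V t, MemL2 T S.φV v → MemL2 T S.φV w →
    AEMeasurable (fun t => A t (v t) (w t)) (timeMeasure T)
  A1 : ∃ C₁ C₂ : ℝ, 0 < C₁ ∧ 0 < C₂ ∧ ∀ᵐ t ∂timeMeasure T, ∀ v : V t,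
    C₁ * ‖v‖ ^ 2 - C₂ * ‖S.ι t v‖ ^ 2 ≤ A t v v
  A2 : ∃ C₃ : ℝ, 0 < C₃ ∧ ∀ᵐ t ∂timeMeasure T, ∀ v w : V t, |A t v w| ≤ C₃ * ‖v‖ * ‖w‖

/-- `u(0) = u₀` in `H₀`, where `u(0)` is the value at `0` of the representative of `u` in `C⁰_H`, i.e.
the one with continuous pullback (recall that `φ₀` is the identity). -/
def HasInitialValue (u : ∀ t, V t) (u₀ : H 0) : Prop :=
  ∃ y : ℝ → H 0, ContinuousOn y (Icc 0 T) ∧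
    (∀ᵐ t ∂timeMeasure T, (S.φH t).symm (S.ι t (u t)) = y t) ∧ y 0 = u₀

/-- `u ∈ W(V,V*)`, with material derivative `u̇ = g`, solves `L u̇ + A u + Λ u = f` in `L²_{V*}` and
`u(0) = u₀` in `H₀`. -/
structure IsSolution (L : ∀ t, StrongDual ℝ (V t) →ₗ[ℝ] StrongDual ℝ (V t))
    (A : ∀ t, V t →ₗ[ℝ] StrongDual ℝ (V t)) (f : ∀ t, StrongDual ℝ (V t)) (u₀ : H 0)
    (u : ∀ t, V t) (g : ∀ t, StrongDual ℝ (V t)) : Prop where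
  deriv : S.IsMaterialDeriv u g
  equation : ∀ᵐ t ∂timeMeasure T, ∀ w : V t,
    L t (g t) w + A t (u t) w + S.lambda t (S.ι t (u t)) (S.ι t w) = f t w
  initial : S.HasInitialValue u u₀

end EvolvingPair

end EvolvingSpace

end

/-! # Well-posedness of a linear parabolic equation on evolving Hilbert spaces

The equation `L u̇ + A u + Λ u = f` is pulled back to the fixed spaces `V(0) ⊂ H(0)`. Write `v`
for the pullback of `u`, `i` for the embedding of `V(0)` in `H(0)`, and `M(t;x,y) = (L(t) φₜ x, φₜ
y)_{H(t)}`. The rule `∂•(L u) = L̇ u + L u̇` applied to functions with constant pullback (whose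
material derivative vanishes) says that `M` is differentiable in time on `V(0)`, with a derivative
`M'` that is bounded by `‖i x‖ ‖y‖`; applied to a general `u` it turns the equation into `(M v)' +
B v - M' v = f̂` in the dual of `V(0)`, where `B` is the pullback of `A + Λ` and `f̂` that of `f`
(`LAssumptions.hasWeakDeriv`, `IsSolution.pullback_eq`). As `M` is symmetric and coercive on
`H(0)` and `B` satisfies a Gårding inequality, this is an implicit parabolic equation in fixed
spaces (`IsParabolic`, `exists_isParabolic`).

The central tool for that equation is the energy identity `d/dt M(v,v) = 2 ⟨(M v)', v⟩ - M'(v,v)`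
(`IsDifferentiableForm.energy_identity`). Since `M` is differentiable only as a form on `V(0)`,
and `v` itself need not have a derivative, mollification is avoided: by the symmetry of `M` the
increment of `M(v,v)` over a time step `h` is an integral of `(M v)'` and `M'` against values of
`v` at the two end points, and its distance from the integral of the right-hand side is `o(h)` in
the mean because translations are continuous in `L²`. An integrable function with increments
`o(h)` in the mean is constant. With `M` the inner product of `H(0)`, the identity also shows that
the elements of the solution space have a representative that is continuous with values in `H(0)`
(`exists_continuousOn_representative`).

The energy identity, the coercivity of `M` and an exponential weight in time give an estimate for
`v` in `L²(0,T;V(0))` (`IsParabolic.exists_energy_estimate`), hence uniqueness and the bound on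
`u`; the bound on `u̇` then follows from the equation and the lower bound for `L`. Existence for
the pulled back problem is Lions' projection theorem, the coercivity of the adjoint problem being
the energy identity for smooth test functions with an exponential weight
(`IsParabolic.exists_weak_solution`). Its solution `v` yields a function `u` such that `L u` has a
material derivative (`LAssumptions.isMaterialDeriv_of_primitive`); hence so has `u`, and comparing
the two expressions for `(M v)'` gives the equation. The initial value is read off from the
essential limit of `M(t)` at `0`, a coercive form (`primitive_initial_eq`,
`eq_zero_of_limit_form`). -/

open Filter Topology

namespace EvolvingSpace

/-! ### Primitives and weak derivatives of vector-valued functions -/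

section Primitive

variable {E : Type*} [NormedAddCommGroup E] [NormedSpace ℝ E]
  {G : Type*} [NormedAddCommGroup G] [NormedSpace ℝ G]
  {K : Type*} [NormedAddCommGroup K] [NormedSpace ℝ K]
  {T : ℝ}

theorem intervalIntegrable_of_timeMeasure {E : Type*} [NormedAddCommGroup E] {F : ℝ → E}
    (hF : Integrable F (timeMeasure T)) {a b : ℝ} (ha : a ∈ Icc 0 T) (hb : b ∈ Icc 0 T) :
    IntervalIntegrable F volume a b := by
  rw [intervalIntegrable_iff]
  refine IntegrableOn.mono_set hF ?_
  exact uIoc_subset_uIcc.trans (uIcc_subset_Icc ha hb)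

theorem integral_timeMeasure (hT : 0 ≤ T) (F : ℝ → E) :
    ∫ t, F t ∂timeMeasure T = ∫ t in (0 : ℝ)..T, F t := by
  rw [intervalIntegral.integral_of_le hT, integral_Icc_eq_integral_Ioc]

theorem continuousOn_primitive_timeMeasure (hT : 0 ≤ T) {F : ℝ → E}
    (hF : Integrable F (timeMeasure T)) (c : E) :
    ContinuousOn (fun t => c + ∫ s in (0 : ℝ)..t, F s) (Icc 0 T) := by
  have := intervalIntegral.continuousOn_primitive_interval' (μ := volume) (f := F) (a := 0)
    (b₁ := 0) (b₂ := T)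
    (intervalIntegrable_of_timeMeasure hF ⟨le_rfl, hT⟩ ⟨hT, le_rfl⟩) left_mem_uIcc
  rw [uIcc_of_le hT] at this
  exact continuousOn_const.add this

theorem integrable_of_continuousOn_timeMeasure {E : Type*} [NormedAddCommGroup E] {F : ℝ → E}
    (hF : ContinuousOn F (Icc 0 T)) : Integrable F (timeMeasure T) :=
  hF.integrableOn_Icc

/-- Fubini's theorem on the triangle `0 < r ≤ s ≤ t`, for a bilinear integrand. -/
theorem integral_bilin_primitive_triangle [CompleteSpace E] [CompleteSpace G] [CompleteSpace K]
    {F : ℝ → E} (hF : Integrable F (timeMeasure T)) {ψ : ℝ → G} (hψ : ContDiff ℝ 1 ψ)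
    (B : E →L[ℝ] G →L[ℝ] K) {t : ℝ} (ht : t ∈ Icc 0 T) :
    ∫ s in (0 : ℝ)..t, B (∫ r in (0 : ℝ)..s, F r) (deriv ψ s) =
      ∫ r in (0 : ℝ)..t, B (F r) (ψ t - ψ r) := by
  have hψ' : Continuous (deriv ψ) := hψ.continuous_deriv le_rfl
  have hd : ∀ x, HasDerivAt ψ (deriv ψ x) x := fun x =>
    (hψ.differentiable one_ne_zero x).hasDerivAt
  set ν := (volume : Measure ℝ).restrict (Ioc 0 t) with hν
  have hFν : Integrable F ν :=
    IntegrableOn.mono_set hF (Ioc_subset_Icc_self.trans (Icc_subset_Icc_right ht.2))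
  have hψν : Integrable (deriv ψ) ν :=
    (hψ'.integrableOn_Icc (a := 0) (b := t)).mono_set Ioc_subset_Icc_self
  let k : ℝ → ℝ → K := fun s r => (Iic s).indicator (fun r => B (F r) (deriv ψ s)) r
  have hk : Integrable (Function.uncurry k) (ν.prod ν) := by
    have h1 : Integrable (fun p : ℝ × ℝ => B (F p.2) (deriv ψ p.1)) (ν.prod ν) := by
      refine Integrable.mono' (g := fun p : ℝ × ℝ => ‖B‖ * (‖deriv ψ p.1‖ * ‖F p.2‖)) ?_ ?_ ?_
      · exact (hψν.norm.mul_prod hFν.norm).const_mul _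
      · exact B.aestronglyMeasurable_comp₂ hFν.aestronglyMeasurable.comp_snd
          hψν.aestronglyMeasurable.comp_fst
      · refine Eventually.of_forall fun p => ((B.le_opNorm₂ _ _).trans (le_of_eq (by ring)))
    have h2 : Function.uncurry k =
        {p : ℝ × ℝ | p.2 ≤ p.1}.indicator (fun p => B (F p.2) (deriv ψ p.1)) := by
      ext p
      simp [k, Function.uncurry, indicator]
    rw [h2]
    exact h1.indicator (measurableSet_le measurable_snd measurable_fst)
  have hswap := integral_integral_swap hk
  have hL : ∀ s ∈ Ioc 0 t, ∫ r, k s r ∂ν = B (∫ r in (0 : ℝ)..s, F r) (deriv ψ s) := by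
    intro s hs
    rw [integral_indicator measurableSet_Iic, hν, Measure.restrict_restrict measurableSet_Iic,
      show Iic s ∩ Ioc 0 t = Ioc 0 s by ext x; simp; grind [hs.2],
      intervalIntegral.integral_of_le hs.1.le]
    have hi : Integrable F (volume.restrict (Ioc 0 s)) :=
      IntegrableOn.mono_set (t := Ioc 0 t) hFν (Ioc_subset_Ioc_right hs.2)
    rw [← ContinuousLinearMap.flip_apply, ← ContinuousLinearMap.integral_comp_comm _ hi]
    rfl
  have hR : ∀ r ∈ Ioc 0 t, ∫ s, k s r ∂ν = B (F r) (ψ t - ψ r) := by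
    intro r hr
    have : (fun s => k s r) = (Ici r).indicator (fun s => B (F r) (deriv ψ s)) := by
      ext s; simp [k, indicator]
    rw [this, integral_indicator measurableSet_Ici, hν, Measure.restrict_restrict measurableSet_Ici,
      show Ici r ∩ Ioc 0 t = Icc r t by ext x; simp; grind [hr.1],
      integral_Icc_eq_integral_Ioc, ← intervalIntegral.integral_of_le hr.2,
      ContinuousLinearMap.intervalIntegral_comp_comm _ (hψ'.intervalIntegrable _ _),
      intervalIntegral.integral_eq_sub_of_hasDerivAt (fun x _ => hd x)
        (hψ'.intervalIntegrable _ _)]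
  rw [intervalIntegral.integral_of_le ht.1, intervalIntegral.integral_of_le ht.1,
    ← setIntegral_congr_fun measurableSet_Ioc hL, ← setIntegral_congr_fun measurableSet_Ioc hR]
  exact hswap

theorem integrable_bilin_timeMeasure {F : ℝ → E} (hF : Integrable F (timeMeasure T)) {ψ : ℝ → G}
    (hψ : Continuous ψ) (B : E →L[ℝ] G →L[ℝ] K) :
    Integrable (fun s => B (F s) (ψ s)) (timeMeasure T) := by
  obtain ⟨C, hC⟩ := isCompact_Icc.exists_bound_of_continuousOn (hψ.continuousOn (s := Icc 0 T))
  refine Integrable.mono' (g := fun s => ‖B‖ * C * ‖F s‖) (hF.norm.const_mul _)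
    (B.aestronglyMeasurable_comp₂ hF.aestronglyMeasurable hψ.aestronglyMeasurable) ?_
  filter_upwards [ae_restrict_mem measurableSet_Icc] with s hs
  refine (B.le_opNorm₂ _ _).trans ?_
  have := hC s hs
  calc ‖B‖ * ‖F s‖ * ‖ψ s‖ ≤ ‖B‖ * ‖F s‖ * C := by gcongr
    _ = _ := by ring

theorem integrable_smul_timeMeasure {ζ : ℝ → ℝ} {F : ℝ → E} (hζ : Continuous ζ)
    (hF : Integrable F (timeMeasure T)) : Integrable (fun t => ζ t • F t) (timeMeasure T) :=
  integrable_bilin_timeMeasure hF hζ (ContinuousLinearMap.lsmul ℝ ℝ : ℝ →L[ℝ] E →L[ℝ] E).flip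

/-- Product rule for a primitive `c + ∫₀ᵗ F` and a `C¹` function `ψ`. -/
theorem bilin_primitive_eq [CompleteSpace E] [CompleteSpace G] [CompleteSpace K]
    (hT : 0 ≤ T) {F : ℝ → E} (hF : Integrable F (timeMeasure T)) {ψ : ℝ → G} (hψ : ContDiff ℝ 1 ψ)
    (B : E →L[ℝ] G →L[ℝ] K) (c : E) {t : ℝ} (ht : t ∈ Icc 0 T) :
    B (c + ∫ s in (0 : ℝ)..t, F s) (ψ t) = B c (ψ 0) +
      ∫ s in (0 : ℝ)..t, (B (F s) (ψ s) + B (c + ∫ r in (0 : ℝ)..s, F r) (deriv ψ s)) := by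
  have h0 : (0 : ℝ) ∈ Icc 0 T := ⟨le_rfl, hT⟩
  have hψ' : Continuous (deriv ψ) := hψ.continuous_deriv le_rfl
  have hd : ∀ x, HasDerivAt ψ (deriv ψ x) x := fun x =>
    (hψ.differentiable one_ne_zero x).hasDerivAt
  have hi := intervalIntegrable_of_timeMeasure hF h0 ht
  have hP : Integrable (fun s => ∫ r in (0 : ℝ)..s, F r) (timeMeasure T) := by
    have := continuousOn_primitive_timeMeasure hT hF 0
    simp only [zero_add] at this
    exact integrable_of_continuousOn_timeMeasure this
  have hi1 := intervalIntegrable_of_timeMeasure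
    (integrable_bilin_timeMeasure hF hψ.continuous B) h0 ht
  have hi2 := intervalIntegrable_of_timeMeasure (integrable_bilin_timeMeasure hP hψ' B) h0 ht
  have hi3 : IntervalIntegrable (fun s => B c (deriv ψ s)) volume 0 t :=
    ((B c).continuous.comp hψ').intervalIntegrable _ _
  have hi4 : IntervalIntegrable (fun r => B (F r) (ψ t)) volume 0 t :=
    intervalIntegrable_of_timeMeasure
      (integrable_bilin_timeMeasure hF (ψ := fun _ => ψ t) continuous_const B) h0 ht
  have e1 : ∫ s in (0 : ℝ)..t, B c (deriv ψ s) = B c (ψ t) - B c (ψ 0) := by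
    rw [ContinuousLinearMap.intervalIntegral_comp_comm _ (hψ'.intervalIntegrable _ _),
      intervalIntegral.integral_eq_sub_of_hasDerivAt (fun x _ => hd x)
        (hψ'.intervalIntegrable _ _), map_sub]
  have e2 := integral_bilin_primitive_triangle hF hψ B ht
  have e3 : ∫ r in (0 : ℝ)..t, B (F r) (ψ t) = B (∫ r in (0 : ℝ)..t, F r) (ψ t) := by
    rw [← ContinuousLinearMap.flip_apply, ← ContinuousLinearMap.intervalIntegral_comp_comm _ hi]
    rfl
  simp only [map_sub] at e2
  rw [intervalIntegral.integral_sub hi4 hi1, e3] at e2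
  simp only [map_add, add_apply]
  rw [intervalIntegral.integral_add hi1 (hi3.add hi2), intervalIntegral.integral_add hi3 hi2,
    e1, e2]
  abel

/-- `F` is the weak derivative of `m` on `(0,T)`; both functions are integrable. -/
structure HasWeakDeriv (T : ℝ) (m F : ℝ → E) : Prop where
  integrable : Integrable m (timeMeasure T)
  integrable_deriv : Integrable F (timeMeasure T)
  integral_eq : ∀ ζ : ℝ → ℝ, IsTestFunction T ζ →
    ∫ t, deriv ζ t • m t ∂timeMeasure T = - ∫ t, ζ t • F t ∂timeMeasure T

theorem IsTestFunction.eq_zero {ψ : ℝ → E} (hψ : IsTestFunction T ψ) {t : ℝ} (ht : t ∉ Ioo 0 T) :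
    ψ t = 0 := by
  by_contra h
  exact ht (hψ.2.2 (subset_tsupport _ h))

theorem IsTestFunction.contDiff_one {ψ : ℝ → E} (hψ : IsTestFunction T ψ) : ContDiff ℝ 1 ψ :=
  hψ.1.of_le (by exact_mod_cast le_top)

theorem IsTestFunction.smul_const {ζ : ℝ → ℝ} (hζ : IsTestFunction T ζ) (w : E) :
    IsTestFunction T (fun t => ζ t • w) :=
  ⟨hζ.1.smul contDiff_const, hζ.2.1.smul_right, (tsupport_smul_subset_left ζ _).trans hζ.2.2⟩

theorem hasWeakDeriv_of_primitive [CompleteSpace E] (hT : 0 ≤ T) {m F : ℝ → E}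
    (hF : Integrable F (timeMeasure T)) {c : E}
    (hm : ∀ᵐ t ∂timeMeasure T, m t = c + ∫ s in (0 : ℝ)..t, F s) : HasWeakDeriv T m F := by
  have hP : Integrable (fun t => c + ∫ s in (0 : ℝ)..t, F s) (timeMeasure T) :=
    integrable_of_continuousOn_timeMeasure (continuousOn_primitive_timeMeasure hT hF c)
  refine ⟨hP.congr (hm.mono fun t h => h.symm), hF, fun ζ hζ => ?_⟩
  let B : E →L[ℝ] ℝ →L[ℝ] E := (ContinuousLinearMap.lsmul ℝ ℝ : ℝ →L[ℝ] E →L[ℝ] E).flip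
  have h := bilin_primitive_eq hT hF hζ.contDiff_one B c (t := T) ⟨hT, le_rfl⟩
  have hψ' : Continuous (deriv ζ) := hζ.contDiff_one.continuous_deriv le_rfl
  rw [hζ.eq_zero (by simp), hζ.eq_zero (by simp), map_zero, map_zero, zero_add,
    ← integral_timeMeasure hT, integral_add
      (integrable_bilin_timeMeasure hF hζ.contDiff_one.continuous B)
      (integrable_bilin_timeMeasure hP hψ' B)] at h
  have e : ∫ t, deriv ζ t • m t ∂timeMeasure T =
      ∫ t, B (c + ∫ s in (0 : ℝ)..t, F s) (deriv ζ t) ∂timeMeasure T := by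
    refine integral_congr_ae (hm.mono fun t h => ?_)
    simp [B, h]
  rw [e, eq_neg_iff_add_eq_zero, add_comm]
  exact h.symm

/-- An integrable function is zero if its integral against every test function is. -/
theorem ae_eq_zero_of_integral_testFunction [CompleteSpace E] {g : ℝ → E}
    (hg : Integrable g (timeMeasure T))
    (h : ∀ ζ : ℝ → ℝ, IsTestFunction T ζ → ∫ t, ζ t • g t ∂timeMeasure T = 0) :
    ∀ᵐ t ∂timeMeasure T, g t = 0 := by
  have h1 : ∀ᵐ t, t ∈ Ioo 0 T → g t = 0 := by
    refine isOpen_Ioo.ae_eq_zero_of_integral_contDiff_smul_eq_zero ?_ fun ζ h1 h2 h3 => ?_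
    · exact (IntegrableOn.mono_set hg Ioo_subset_Icc_self).locallyIntegrableOn
    · rw [← h ζ ⟨h1, h2, h3⟩]
      refine (setIntegral_eq_integral_of_forall_compl_eq_zero fun t ht => ?_).symm
      rw [IsTestFunction.eq_zero ⟨h1, h2, h3⟩ (fun h => ht (Ioo_subset_Icc_self h)), zero_smul]
  have h2 : timeMeasure T = volume.restrict (Ioo 0 T) :=
    (Measure.restrict_congr_set Ioo_ae_eq_Icc).symm
  rw [h2]
  exact (ae_restrict_iff' measurableSet_Ioo).2 h1

theorem HasWeakDeriv.ae_eq [CompleteSpace E] {m F F' : ℝ → E} (h : HasWeakDeriv T m F)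
    (h' : HasWeakDeriv T m F') :
    ∀ᵐ t ∂timeMeasure T, F t = F' t := by
  have key : ∀ᵐ t ∂timeMeasure T, F t - F' t = 0 := by
    refine ae_eq_zero_of_integral_testFunction (h.integrable_deriv.sub h'.integrable_deriv)
      fun ζ hζ => ?_
    simp only [smul_sub]
    rw [integral_sub (integrable_smul_timeMeasure hζ.1.continuous h.integrable_deriv)
      (integrable_smul_timeMeasure hζ.1.continuous h'.integrable_deriv), sub_eq_zero, ← neg_inj,
      ← h.integral_eq ζ hζ, ← h'.integral_eq ζ hζ]
  exact key.mono fun t ht => sub_eq_zero.1 ht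

/-- A test function with vanishing integral is the derivative of a test function. -/
theorem IsTestFunction.exists_deriv_eq {η : ℝ → ℝ} (hη : IsTestFunction T η) (hT : 0 < T)
    (h0 : ∫ t in (0 : ℝ)..T, η t = 0) : ∃ ζ, IsTestFunction T ζ ∧ deriv ζ = η := by
  have hc : Continuous η := hη.1.continuous
  let ζ : ℝ → ℝ := fun t => ∫ s in (0 : ℝ)..t, η s
  have hd : ∀ t, HasDerivAt ζ (η t) t := fun t =>
    intervalIntegral.integral_hasDerivAt_right (hc.intervalIntegrable _ _)
      (hc.stronglyMeasurableAtFilter _ _) hc.continuousAt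
  have hde : deriv ζ = η := funext fun t => (hd t).deriv
  obtain ⟨a, b, ha, hb, hab⟩ : ∃ a b, 0 < a ∧ b < T ∧ tsupport η ⊆ Icc a b := by
    rcases (tsupport η).eq_empty_or_nonempty with he | hne
    · exact ⟨T, 0, hT, hT, by simp [he]⟩
    · obtain ⟨x, hx, hx'⟩ := hη.2.1.isCompact.exists_isLeast hne
      obtain ⟨y, hy, hy'⟩ := hη.2.1.isCompact.exists_isGreatest hne
      exact ⟨x, y, (hη.2.2 hx).1, (hη.2.2 hy).2, fun z hz => ⟨hx' hz, hy' hz⟩⟩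
  have hz : ∀ t, t ∉ Icc a b → η t = 0 := fun t ht =>
    by_contra fun h => ht (hab (subset_tsupport _ h))
  have hs : Function.support ζ ⊆ Icc a b := by
    intro t ht
    by_contra h
    apply ht
    rcases lt_or_ge t a with h1 | h1
    · refine intervalIntegral.integral_zero_ae (Eventually.of_forall fun s hs => hz s ?_)
      intro h'
      have := hs.2
      have : max 0 t < a := max_lt ha h1
      linarith [h'.1]
    · have h2 : b < t := by by_contra h2; exact h ⟨h1, not_lt.1 h2⟩
      have h3 : ∫ s in t..T, η s = 0 :=
        intervalIntegral.integral_zero_ae (Eventually.of_forall fun s hs => hz s fun h' => by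
          have := hs.1
          have : b < min t T := lt_min h2 hb
          linarith [h'.2])
      have := intervalIntegral.integral_add_adjacent_intervals
        (hc.intervalIntegrable (μ := volume) 0 t) (hc.intervalIntegrable t T)
      simp only [ζ]
      linarith
  have hts : tsupport ζ ⊆ Icc a b := closure_minimal hs isClosed_Icc
  refine ⟨ζ, ⟨?_, HasCompactSupport.of_support_subset_isCompact isCompact_Icc hs,
    hts.trans fun t ht => ⟨ha.trans_le ht.1, ht.2.trans_lt hb⟩⟩, hde⟩
  rw [contDiff_infty_iff_deriv]
  exact ⟨fun t => (hd t).differentiableAt, hde ▸ hη.1⟩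

theorem exists_testFunction_integral_eq_one (hT : 0 < T) :
    ∃ ρ : ℝ → ℝ, IsTestFunction T ρ ∧ ∫ t in (0 : ℝ)..T, ρ t = 1 := by
  let φ : ContDiffBump (T / 2) := ⟨T / 8, T / 4, by positivity, by linarith⟩
  have hs : tsupport (φ.normed volume) ⊆ Ioo 0 T := by
    rw [φ.tsupport_normed_eq, Real.closedBall_eq_Icc]
    intro t ht
    have h1 : φ.rOut = T / 4 := rfl
    rw [h1] at ht
    exact ⟨by linarith [ht.1], by linarith [ht.2]⟩
  refine ⟨φ.normed volume, ⟨φ.contDiff_normed, φ.hasCompactSupport_normed, hs⟩, ?_⟩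
  rw [intervalIntegral.integral_of_le hT.le, setIntegral_eq_integral_of_forall_compl_eq_zero,
    φ.integral_normed]
  intro t ht
  by_contra h
  exact ht (Ioo_subset_Ioc_self (hs (subset_tsupport _ h)))

/-- The lemma of du Bois-Reymond: a function with an integrable weak derivative is a primitive. -/
theorem HasWeakDeriv.exists_primitive [CompleteSpace E] (hT : 0 < T) {m F : ℝ → E}
    (h : HasWeakDeriv T m F) :
    ∃ c, ∀ᵐ t ∂timeMeasure T, m t = c + ∫ s in (0 : ℝ)..t, F s := by
  let D : ℝ → E := fun t => m t - ∫ s in (0 : ℝ)..t, F s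
  have hP := hasWeakDeriv_of_primitive (m := fun t => ∫ s in (0 : ℝ)..t, F s) hT.le
    h.integrable_deriv (c := 0) (Eventually.of_forall fun t => (zero_add _).symm)
  have hDi : Integrable D (timeMeasure T) := h.integrable.sub hP.integrable
  have hD : ∀ ζ : ℝ → ℝ, IsTestFunction T ζ → ∫ t, deriv ζ t • D t ∂timeMeasure T = 0 := by
    intro ζ hζ
    have hζ' := hζ.contDiff_one.continuous_deriv le_rfl
    simp only [D, smul_sub]
    rw [integral_sub (integrable_smul_timeMeasure hζ' h.integrable)
      (integrable_smul_timeMeasure hζ' hP.integrable), h.integral_eq ζ hζ,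
      hP.integral_eq ζ hζ, sub_self]
  obtain ⟨ρ, hρ, hρ1⟩ := exists_testFunction_integral_eq_one hT
  set c : E := ∫ t, ρ t • D t ∂timeMeasure T with hcdef
  refine ⟨c, ?_⟩
  have key : ∀ᵐ t ∂timeMeasure T, D t - c = 0 := by
    refine ae_eq_zero_of_integral_testFunction (hDi.sub (integrable_const c)) fun χ hχ => ?_
    set k : ℝ := ∫ t in (0 : ℝ)..T, χ t with hk
    have hη : IsTestFunction T (fun t => χ t - k * ρ t) := by
      refine ⟨hχ.1.sub (contDiff_const.mul hρ.1), hχ.2.1.sub hρ.2.1.mul_left,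
        (tsupport_sub _ _).trans (union_subset hχ.2.2 ?_)⟩
      exact (tsupport_mul_subset_right (f := fun _ => k) (g := ρ)).trans hρ.2.2
    obtain ⟨ζ, hζ, hζ'⟩ := hη.exists_deriv_eq hT (by
      rw [intervalIntegral.integral_sub (hχ.1.continuous.intervalIntegrable _ _)
        ((hρ.1.continuous.intervalIntegrable _ _).const_mul k),
        intervalIntegral.integral_const_mul, hρ1, mul_one, sub_self])
    have h1 := hD ζ hζ
    rw [hζ'] at h1
    simp only [sub_smul, mul_smul] at h1
    rw [integral_sub (integrable_smul_timeMeasure hχ.1.continuous hDi)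
      (Integrable.fun_smul k (integrable_smul_timeMeasure hρ.1.continuous hDi)), integral_smul,
      ← hcdef] at h1
    simp only [smul_sub]
    rw [integral_sub (integrable_smul_timeMeasure hχ.1.continuous hDi)
      (integrable_smul_timeMeasure hχ.1.continuous (integrable_const c)), integral_smul_const,
      integral_timeMeasure hT.le χ, ← hk]
    exact h1
  filter_upwards [key] with t ht
  rw [← sub_eq_zero.1 ht]
  simp [D]

/-- Functionals may be tested one vector at a time for being a primitive. -/
theorem exists_primitive_of_apply (hT : 0 < T) {m F : ℝ → StrongDual ℝ E}
    (hm : Integrable m (timeMeasure T)) (hF : Integrable F (timeMeasure T))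
    (h : ∀ w : E, ∃ c : ℝ, ∀ᵐ t ∂timeMeasure T, m t w = c + ∫ s in (0 : ℝ)..t, F s w) :
    ∃ c, ∀ᵐ t ∂timeMeasure T, m t = c + ∫ s in (0 : ℝ)..t, F s := by
  refine HasWeakDeriv.exists_primitive hT ⟨hm, hF, fun ζ hζ => ?_⟩
  ext w
  obtain ⟨c, hc⟩ := h w
  have h1 := (hasWeakDeriv_of_primitive hT.le (hF.apply_continuousLinearMap w) hc).integral_eq ζ hζ
  rw [neg_apply,
    ContinuousLinearMap.integral_apply
      (integrable_smul_timeMeasure (hζ.contDiff_one.continuous_deriv le_rfl) hm),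
    ContinuousLinearMap.integral_apply (integrable_smul_timeMeasure hζ.1.continuous hF)]
  exact h1

/-- The filter `𝓝 t₀ ⊓ ae` of essential limits at `t₀ ∈ [0,T]`, that is, of limits that disregard
null sets of times, is nontrivial. -/
theorem neBot_nhds_inf_ae_timeMeasure (hT : 0 < T) {t₀ : ℝ} (ht : t₀ ∈ Icc 0 T) :
    (𝓝 t₀ ⊓ ae (timeMeasure T)).NeBot := by
  rw [Filter.inf_neBot_iff]
  intro s hs s' hs'
  obtain ⟨ε, hε, hb⟩ := Metric.mem_nhds_iff.1 hs
  by_contra hne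
  have h1 : timeMeasure T (Metric.ball t₀ ε) = 0 :=
    measure_mono_null (fun x hx hx' => hne ⟨x, hb hx, hx'⟩) (mem_ae_iff.1 hs')
  rw [Measure.restrict_apply Metric.isOpen_ball.measurableSet, Real.ball_eq_Ioo] at h1
  have h2 : Ioo (max (t₀ - ε) 0) (min (t₀ + ε) T) ⊆ Ioo (t₀ - ε) (t₀ + ε) ∩ Icc 0 T :=
    fun x hx => ⟨⟨(le_max_left _ _).trans_lt hx.1, hx.2.trans_le (min_le_left _ _)⟩,
      (le_max_right _ _).trans hx.1.le, hx.2.le.trans (min_le_right _ _)⟩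
  have h3 := measure_mono_null h2 h1
  rw [Real.volume_Ioo, ENNReal.ofReal_eq_zero, sub_nonpos] at h3
  have h4 : max (t₀ - ε) 0 < min (t₀ + ε) T :=
    max_lt (lt_min (by linarith) (by linarith [ht.2])) (lt_min (by linarith [ht.1]) hT)
  exact absurd h3 (not_le.2 h4)

theorem tendsto_of_continuousOn_timeMeasure {X : Type*} [TopologicalSpace X] {g : ℝ → X}
    (hg : ContinuousOn g (Icc 0 T)) {t₀ : ℝ} (ht : t₀ ∈ Icc 0 T) :
    Tendsto g (𝓝 t₀ ⊓ ae (timeMeasure T)) (𝓝 (g t₀)) := by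
  refine (hg t₀ ht).tendsto.mono_left ?_
  rw [nhdsWithin]
  exact inf_le_inf_left _ (le_principal_iff.2 (ae_restrict_mem measurableSet_Icc))

theorem eventually_nhds_inf_ae {p : ℝ → Prop} {t₀ : ℝ} (h : ∀ᵐ t ∂timeMeasure T, p t) :
    ∀ᶠ t in 𝓝 t₀ ⊓ ae (timeMeasure T), p t :=
  Filter.Eventually.filter_mono inf_le_right h

end Primitive

/-! ### Measurability of time-dependent functionals and bilinear forms -/

section Measurability

universe u

variable {α : Type*} [MeasurableSpace α] {μ : Measure α}

theorem aestronglyMeasurable_dual_apply {X : Type*} [NormedAddCommGroup X]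
    [NormedSpace ℝ X] {F : α → StrongDual ℝ X} {p : α → X}
    (hF : AEStronglyMeasurable F μ) (hp : AEStronglyMeasurable p μ) :
    AEStronglyMeasurable (fun t => F t (p t)) μ :=
  (ContinuousLinearMap.id ℝ (StrongDual ℝ X)).aestronglyMeasurable_comp₂ hF hp

theorem integrable_dual_apply {X : Type*} [NormedAddCommGroup X]
    [NormedSpace ℝ X] {F : α → StrongDual ℝ X} {p : α → X}
    (hF : MemLp F 2 μ) (hp : MemLp p 2 μ) : Integrable (fun t => F t (p t)) μ := by
  refine Integrable.mono' (MemLp.integrable_mul hF.norm hp.norm)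
    (aestronglyMeasurable_dual_apply hF.1 hp.1) (Eventually.of_forall fun t => ?_)
  exact (F t).le_opNorm (p t)

variable
  {X : Type*} [NormedAddCommGroup X] [InnerProductSpace ℝ X] [CompleteSpace X]
  [TopologicalSpace.SeparableSpace X]
  {Y : Type*} [NormedAddCommGroup Y] [InnerProductSpace ℝ Y] [CompleteSpace Y]
  [TopologicalSpace.SeparableSpace Y]

theorem exists_countable_hilbertBasis (X : Type u) [NormedAddCommGroup X] [InnerProductSpace ℝ X]
    [CompleteSpace X] [TopologicalSpace.SeparableSpace X] :
    ∃ (ι : Type u) (_ : Countable ι), Nonempty (HilbertBasis ι ℝ X) := by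
  obtain ⟨w, b, -⟩ := exists_hilbertBasis ℝ X
  refine ⟨w, ?_, ⟨b⟩⟩
  have hdist : ∀ i j, i ≠ j → 1 ≤ dist (b i) (b j) := by
    intro i j hij
    have h1 : ‖b i - b j‖ ^ 2 = 2 := by
      rw [norm_sub_sq_real, b.orthonormal.1 i, b.orthonormal.1 j, b.orthonormal.2 hij]
      norm_num
    rw [dist_eq_norm]
    nlinarith [norm_nonneg (b i - b j)]
  refine Pairwise.countable_of_isOpen_disjoint (s := fun i => Metric.ball (b i) (1 / 2))
    (fun i j hij => ?_) (fun _ => Metric.isOpen_ball)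
    (fun i => ⟨b i, Metric.mem_ball_self (by norm_num)⟩)
  refine Metric.ball_disjoint_ball ?_
  have := hdist i j hij
  linarith

/-- Pettis' theorem for vectors of a separable Hilbert space. -/
theorem aestronglyMeasurable_of_inner {g : α → X}
    (h : ∀ w : X, AEMeasurable (fun t => inner ℝ w (g t)) μ) : AEStronglyMeasurable g μ := by
  obtain ⟨ι, _, ⟨b⟩⟩ := exists_countable_hilbertBasis X
  refine aestronglyMeasurable_of_tendsto_ae (u := (atTop : Filter (Finset ι)))
    (f := fun s t => ∑ i ∈ s, inner ℝ (b i) (g t) • b i) (fun s => ?_)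
    (Eventually.of_forall fun t => ?_)
  · exact Finset.aestronglyMeasurable_fun_sum _ fun i _ =>
      (h (b i)).aestronglyMeasurable.smul_const _
  · have := b.hasSum_repr (g t)
    simp only [b.repr_apply_apply] at this
    exact this

/-- Pettis' theorem for functionals on a separable Hilbert space. -/
theorem aestronglyMeasurable_of_apply {F : α → StrongDual ℝ X}
    (h : ∀ w : X, AEMeasurable (fun t => F t w) μ) : AEStronglyMeasurable F μ := by
  have h1 : AEStronglyMeasurable (fun t => (InnerProductSpace.toDual ℝ X).symm (F t)) μ := by
    refine aestronglyMeasurable_of_inner fun w => ?_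
    refine (h w).congr (Eventually.of_forall fun t => ?_)
    change F t w = inner ℝ w _
    rw [real_inner_comm, InnerProductSpace.toDual_symm_apply]
  have h2 := (InnerProductSpace.toDual ℝ X).continuous.comp_aestronglyMeasurable h1
  simpa using h2

/-- A time-dependent bilinear form that is measurable in time for fixed arguments maps measurable
functions to measurable functionals. -/
theorem aestronglyMeasurable_form {B : α → X →L[ℝ] Y →L[ℝ] ℝ}
    (h : ∀ x y, AEMeasurable (fun t => B t x y) μ) {p : α → X} (hp : AEStronglyMeasurable p μ) :
    AEStronglyMeasurable (fun t => B t (p t)) μ := by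
  obtain ⟨ι, _, ⟨b⟩⟩ := exists_countable_hilbertBasis X
  have hB : ∀ x, AEStronglyMeasurable (fun t => B t x) μ := fun x =>
    aestronglyMeasurable_of_apply fun y => h x y
  refine aestronglyMeasurable_of_tendsto_ae (u := (atTop : Filter (Finset ι)))
    (f := fun s t => ∑ i ∈ s, inner ℝ (b i) (p t) • B t (b i)) (fun s => ?_)
    (Eventually.of_forall fun t => ?_)
  · exact Finset.aestronglyMeasurable_fun_sum _ fun i _ =>
      (aestronglyMeasurable_const.inner hp).fun_smul (hB (b i))
  · have := (b.hasSum_repr (p t)).mapL (B t)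
    simp only [b.repr_apply_apply, map_smul] at this
    exact this

theorem memLp_form {B : α → X →L[ℝ] Y →L[ℝ] ℝ} {K : ℝ}
    (h : ∀ x y, AEMeasurable (fun t => B t x y) μ) (hK : ∀ t, ‖B t‖ ≤ K)
    {p : α → X} (hp : MemLp p 2 μ) : MemLp (fun t => B t (p t)) 2 μ := by
  refine MemLp.of_le_mul (c := K) hp (aestronglyMeasurable_form h hp.1)
    (Eventually.of_forall fun t => ((B t).le_opNorm _).trans ?_)
  exact mul_le_mul_of_nonneg_right (hK t) (norm_nonneg _)

/-- A time-dependent real function of two variables that is almost always bilinear and uniformly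
bounded is almost always equal to a uniformly bounded family of continuous bilinear forms. -/
theorem exists_form_of_ae {X Y : Type*} [NormedAddCommGroup X] [NormedSpace ℝ X]
    [NormedAddCommGroup Y] [NormedSpace ℝ Y] {a : α → X → Y → ℝ} {K : ℝ} (hK : 0 ≤ K)
    (h : ∀ᵐ t ∂μ, (∀ x x' y, a t (x + x') y = a t x y + a t x' y) ∧
      (∀ (c : ℝ) x y, a t (c • x) y = c * a t x y) ∧
      (∀ x y y', a t x (y + y') = a t x y + a t x y') ∧
      (∀ (c : ℝ) x y, a t x (c • y) = c * a t x y) ∧ ∀ x y, |a t x y| ≤ K * ‖x‖ * ‖y‖) :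
    ∃ B : α → X →L[ℝ] Y →L[ℝ] ℝ, (∀ t, ‖B t‖ ≤ K) ∧ ∀ᵐ t ∂μ, ∀ x y, B t x y = a t x y := by
  have key : ∀ t, ∃ B : X →L[ℝ] Y →L[ℝ] ℝ, ‖B‖ ≤ K ∧
      (((∀ x x' y, a t (x + x') y = a t x y + a t x' y) ∧
      (∀ (c : ℝ) x y, a t (c • x) y = c * a t x y) ∧
      (∀ x y y', a t x (y + y') = a t x y + a t x y') ∧
      (∀ (c : ℝ) x y, a t x (c • y) = c * a t x y) ∧ ∀ x y, |a t x y| ≤ K * ‖x‖ * ‖y‖) →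
      ∀ x y, B x y = a t x y) := by
    intro t
    by_cases ht : (∀ x x' y, a t (x + x') y = a t x y + a t x' y) ∧
      (∀ (c : ℝ) x y, a t (c • x) y = c * a t x y) ∧
      (∀ x y y', a t x (y + y') = a t x y + a t x y') ∧
      (∀ (c : ℝ) x y, a t x (c • y) = c * a t x y) ∧ ∀ x y, |a t x y| ≤ K * ‖x‖ * ‖y‖
    · obtain ⟨h1, h2, h3, h4, h5⟩ := ht
      exact ⟨(LinearMap.mk₂ ℝ (a t) h1 h2 h3 h4).mkContinuous₂ K h5,
        LinearMap.mkContinuous₂_norm_le _ hK _, fun _ x y => rfl⟩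
    · exact ⟨0, (norm_zero (E := X →L[ℝ] Y →L[ℝ] ℝ)).trans_le hK, fun h => absurd h ht⟩
  choose B hB1 hB2 using key
  exact ⟨B, hB1, h.mono fun t ht => hB2 t ht⟩

theorem aemeasurable_form_apply {B : α → X →L[ℝ] Y →L[ℝ] ℝ}
    (h : ∀ x y, AEMeasurable (fun t => B t x y) μ) {p : α → X} {q : α → Y}
    (hp : AEStronglyMeasurable p μ) (hq : AEStronglyMeasurable q μ) :
    AEMeasurable (fun t => B t (p t) (q t)) μ :=
  (aestronglyMeasurable_dual_apply (aestronglyMeasurable_form h hp) hq).aemeasurable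

end Measurability

/-! ### Translations in `L²` and functions with negligible increments -/

section Translation

variable {E : Type*} [NormedAddCommGroup E]

/-- Translations act continuously on `L²(ℝ)`. -/
theorem tendsto_eLpNorm_translate_sub {u : ℝ → E} (hu : MemLp u 2 volume) :
    Tendsto (fun σ : ℝ => eLpNorm (fun t => u (t + σ) - u t) 2 volume) (𝓝 0) (𝓝 0) := by
  let g : ℝ → C(ℝ, ℝ) := fun σ => ⟨fun t => t + σ, by fun_prop⟩
  have hg : Continuous g := by
    let k : C(ℝ × ℝ, ℝ) := ⟨fun p => p.2 + p.1, by fun_prop⟩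
    exact k.curry.continuous
  have hgm : ∀ σ, MeasurePreserving (g σ) volume volume := fun σ =>
    measurePreserving_add_right volume σ
  have h1 := Continuous.compMeasurePreservingLp (p := 2)
    (continuous_const (y := hu.toLp u)) hg hgm (by norm_num)
  have h2 := (h1.sub (continuous_const (y := hu.toLp u))).tendsto 0
  have h3 := (continuous_norm.tendsto _).comp h2
  have key : ∀ σ, ENNReal.ofReal ‖Lp.compMeasurePreserving (g σ) (hgm σ) (hu.toLp u) - hu.toLp u‖ =
      eLpNorm (fun t => u (t + σ) - u t) 2 volume := by
    intro σ
    rw [Lp.toLp_compMeasurePreserving hu (hgm σ), ← MemLp.toLp_sub, Lp.norm_toLp,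
      ENNReal.ofReal_toReal ((hu.comp_measurePreserving (hgm σ)).sub hu).2.ne]
    rfl
  have h4 := (ENNReal.continuous_ofReal.tendsto _).comp h3
  have h5 := h4.congr key
  have h6 := key 0
  simp only [add_zero, sub_self, eLpNorm_zero'] at h6
  rwa [Pi.sub_apply, h6] at h5

theorem lintegral_enorm_mul_le {α : Type*} [MeasurableSpace α] {μ : Measure α} {q : α → ℝ}
    {u : α → E} (hq : AEStronglyMeasurable q μ) (hu : AEStronglyMeasurable u μ) :
    ∫⁻ t, ‖q t‖ₑ * ‖u t‖ₑ ∂μ ≤ eLpNorm q 2 μ * eLpNorm u 2 μ := by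
  have h := ENNReal.lintegral_mul_le_Lp_mul_Lq μ Real.HolderConjugate.two_two hq.enorm hu.enorm
  rw [eLpNorm_eq_lintegral_rpow_enorm_toReal (by norm_num) (by norm_num),
    eLpNorm_eq_lintegral_rpow_enorm_toReal (by norm_num) (by norm_num)]
  simpa using! h

/-- The error terms that occur when `v` is frozen at the end points of a time step of length `h` are
`o(h)` in the mean. -/
theorem lintegral_translate_le {u : ℝ → E} (hum : StronglyMeasurable u) (hu : MemLp u 2 volume)
    {q : ℝ → ℝ} (hqm : StronglyMeasurable q) (hq : MemLp q 2 volume) {ε : ℝ} (hε : 0 < ε) :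
    ∃ δ > 0, ∀ h ∈ Ioo 0 δ, ∫⁻ t, ∫⁻ σ in Ioc 0 h, (‖q (t + σ)‖ₑ * ‖u (t + σ) - u t‖ₑ +
      (‖q (t + σ)‖ₑ + ‖q t‖ₑ) * ‖u (t + h) - u (t + σ)‖ₑ) ≤ ENNReal.ofReal (ε * h) := by
  set Q := eLpNorm q 2 volume with hQ
  have hQt : Q ≠ ⊤ := hq.2.ne
  set ε' : ℝ := ε / (3 * Q.toReal + 1) with hε'
  have hε'0 : 0 < ε' := by positivity
  have hQε : 3 * Q * ENNReal.ofReal ε' ≤ ENNReal.ofReal ε := by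
    have : 3 * Q * ENNReal.ofReal ε' = ENNReal.ofReal (3 * Q.toReal * ε') := by
      rw [ENNReal.ofReal_mul (by positivity), ENNReal.ofReal_mul (by norm_num),
        ENNReal.ofReal_toReal hQt, ENNReal.ofReal_ofNat]
    rw [this]
    apply ENNReal.ofReal_le_ofReal
    rw [hε', mul_div_assoc', div_le_iff₀ (by positivity)]
    nlinarith [ENNReal.toReal_nonneg (a := Q)]
  have h1 := (tendsto_order.1 (tendsto_eLpNorm_translate_sub hu)).2 (ENNReal.ofReal ε')
    (ENNReal.ofReal_pos.2 hε'0)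
  obtain ⟨δ, hδ, hω⟩ := Metric.eventually_nhds_iff.1 h1
  refine ⟨δ, hδ, fun h hh => ?_⟩
  have hm : Measurable (Function.uncurry fun t σ : ℝ => ‖q (t + σ)‖ₑ * ‖u (t + σ) - u t‖ₑ +
      (‖q (t + σ)‖ₑ + ‖q t‖ₑ) * ‖u (t + h) - u (t + σ)‖ₑ) := by
    have a1 : StronglyMeasurable (fun p : ℝ × ℝ => q (p.1 + p.2)) :=
      hqm.comp_measurable (measurable_fst.add measurable_snd)
    have a2 : StronglyMeasurable (fun p : ℝ × ℝ => u (p.1 + p.2)) :=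
      hum.comp_measurable (measurable_fst.add measurable_snd)
    have a3 : StronglyMeasurable (fun p : ℝ × ℝ => q p.1) := hqm.comp_measurable measurable_fst
    have a4 : StronglyMeasurable (fun p : ℝ × ℝ => u p.1) := hum.comp_measurable measurable_fst
    have a5 : StronglyMeasurable (fun p : ℝ × ℝ => u (p.1 + h)) :=
      hum.comp_measurable (measurable_fst.add_const h)
    exact (a1.enorm.mul (a2.sub a4).enorm).add ((a1.enorm.add a3.enorm).mul (a5.sub a2).enorm)
  rw [lintegral_lintegral_swap hm.aemeasurable]
  have htr : ∀ s : ℝ, StronglyMeasurable (fun t => u (t + s)) := fun s =>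
    hum.comp_measurable (measurable_id.add_const s)
  have htq : ∀ s : ℝ, StronglyMeasurable (fun t => q (t + s)) := fun s =>
    hqm.comp_measurable (measurable_id.add_const s)
  have hqn : ∀ s : ℝ, eLpNorm (fun t => q (t + s)) 2 volume = Q := fun s =>
    eLpNorm_comp_measurePreserving hqm.aestronglyMeasurable (measurePreserving_add_right volume s)
  have hbound : ∀ σ ∈ Ioc 0 h, ∫⁻ t, (‖q (t + σ)‖ₑ * ‖u (t + σ) - u t‖ₑ +
      (‖q (t + σ)‖ₑ + ‖q t‖ₑ) * ‖u (t + h) - u (t + σ)‖ₑ) ≤ ENNReal.ofReal ε := by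
    intro σ hσ
    have b1 : eLpNorm (fun t => u (t + σ) - u t) 2 volume ≤ ENNReal.ofReal ε' :=
      (hω (by rw [Real.dist_eq, sub_zero, abs_of_pos hσ.1]; exact hσ.2.trans_lt hh.2)).le
    have b2 : eLpNorm (fun t => u (t + h) - u (t + σ)) 2 volume ≤ ENNReal.ofReal ε' := by
      have h3 := eLpNorm_comp_measurePreserving (p := 2)
        ((htr (h - σ)).sub hum).aestronglyMeasurable (measurePreserving_add_right volume σ)
      have h4 : ((fun t => u (t + (h - σ))) - u) ∘ (fun t => t + σ) =
          fun t => u (t + h) - u (t + σ) := by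
        ext t
        simp only [Function.comp, Pi.sub_apply]
        congr 2
        ring
      rw [h4] at h3
      rw [h3]
      refine (hω ?_).le
      rw [Real.dist_eq, sub_zero, abs_of_nonneg (by linarith [hσ.2])]
      linarith [hσ.1, hh.2]
    have c1 := lintegral_enorm_mul_le (μ := volume) (htq σ).aestronglyMeasurable
      ((htr σ).sub hum).aestronglyMeasurable
    have c2 := lintegral_enorm_mul_le (μ := volume) (htq σ).aestronglyMeasurable
      ((htr h).sub (htr σ)).aestronglyMeasurable
    have c3 := lintegral_enorm_mul_le (μ := volume) hqm.aestronglyMeasurable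
      ((htr h).sub (htr σ)).aestronglyMeasurable
    rw [hqn] at c1 c2
    have d1 : Measurable fun t => ‖q (t + σ)‖ₑ * ‖u (t + σ) - u t‖ₑ :=
      (htq σ).enorm.mul ((htr σ).sub hum).enorm
    have d2 : Measurable fun t => ‖q (t + σ)‖ₑ * ‖u (t + h) - u (t + σ)‖ₑ :=
      (htq σ).enorm.mul ((htr h).sub (htr σ)).enorm
    calc _ = (∫⁻ t, ‖q (t + σ)‖ₑ * ‖u (t + σ) - u t‖ₑ) +
          ((∫⁻ t, ‖q (t + σ)‖ₑ * ‖u (t + h) - u (t + σ)‖ₑ) +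
            ∫⁻ t, ‖q t‖ₑ * ‖u (t + h) - u (t + σ)‖ₑ) := by
          simp only [add_mul]
          rw [lintegral_add_left d1, lintegral_add_left d2]
      _ ≤ Q * ENNReal.ofReal ε' + (Q * ENNReal.ofReal ε' + Q * ENNReal.ofReal ε') :=
          add_le_add (c1.trans (by gcongr; exact b1))
            (add_le_add (c2.trans (by gcongr; exact b2)) (c3.trans (by gcongr; exact b2)))
      _ = 3 * Q * ENNReal.ofReal ε' := by ring
      _ ≤ _ := hQε
  calc _ ≤ ∫⁻ _ in Ioc 0 h, ENNReal.ofReal ε := setLIntegral_mono measurable_const hbound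
    _ = ENNReal.ofReal (ε * h) := by
      rw [setLIntegral_const, Real.volume_Ioc, sub_zero, ENNReal.ofReal_mul hε.le]

/-- An integrable function whose increments over time steps `h` are `o(h)` in the mean is constant,
because it is the derivative of its primitive almost everywhere. -/
theorem ae_const_of_lintegral_increment_le {T : ℝ} (hT : 0 < T) {D : ℝ → ℝ}
    (hD : Integrable D (timeMeasure T))
    (h : ∀ ε > 0, ∃ δ > 0, ∀ h ∈ Ioo 0 δ,
      ∫⁻ t in Icc 0 (T - h), ‖D (t + h) - D t‖ₑ ≤ ENNReal.ofReal (ε * h)) :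
    ∃ c, ∀ᵐ t ∂timeMeasure T, D t = c := by
  have h0 : (0 : ℝ) ∈ Icc 0 T := ⟨le_rfl, hT.le⟩
  have hii : ∀ {a b}, a ∈ Icc 0 T → b ∈ Icc 0 T → IntervalIntegrable D volume a b :=
    fun ha hb => intervalIntegrable_of_timeMeasure hD ha hb
  set P : ℝ → ℝ := fun x => ∫ t in (0 : ℝ)..x, D t with hP
  have hder : ∀ᵐ x, x ∈ Ioo 0 T → HasDerivAt P (D x) x := by
    have := (hii h0 ⟨hT.le, le_rfl⟩).ae_hasDerivAt_integral
    filter_upwards [this] with x hx hx'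
    rw [uIcc_of_le hT.le] at hx
    exact hx (Ioo_subset_Icc_self hx') 0 h0
  -- difference quotients of `P` at `a` and `b` differ by a mean of increments of `D` over `[a,b]`
  have key : ∀ a ∈ Ioo 0 T, ∀ b ∈ Ioo 0 T, a ≤ b → HasDerivAt P (D a) a → HasDerivAt P (D b) b →
      D b = D a := by
    intro a ha b hb hab hPa hPb
    have hslope : ∀ {x}, HasDerivAt P (D x) x →
        Tendsto (fun h => h⁻¹ * (P (x + h) - P x)) (𝓝[>] 0) (𝓝 (D x)) := fun hx =>
      (hasDerivAt_iff_tendsto_slope_zero.1 hx).mono_left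
        (nhdsWithin_mono _ fun y hy => (ne_of_gt hy))
    have hlim := (hslope hPb).sub (hslope hPa)
    rw [← sub_eq_zero, ← abs_eq_zero]
    refine le_antisymm (le_of_forall_pos_le_add fun ε hε => ?_) (abs_nonneg _)
    rw [zero_add]
    refine le_of_tendsto hlim.abs ?_
    obtain ⟨δ, hδ, hbound⟩ := h ε hε
    filter_upwards [Ioo_mem_nhdsGT (show 0 < min δ (T - b) from lt_min hδ (by linarith [hb.2]))]
      with k hk
    have hk1 : k < δ := hk.2.trans_le (min_le_left _ _)
    have hk2 : k < T - b := hk.2.trans_le (min_le_right _ _)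
    have ma : a ∈ Icc 0 T := Ioo_subset_Icc_self ha
    have mb : b ∈ Icc 0 T := Ioo_subset_Icc_self hb
    have mak : a + k ∈ Icc 0 T := ⟨by linarith [ha.1, hk.1], by linarith⟩
    have mbk : b + k ∈ Icc 0 T := ⟨by linarith [hb.1, hk.1], by linarith⟩
    have e1 : P (b + k) - P (a + k) = ∫ t in a..b, D (t + k) := by
      rw [intervalIntegral.integral_comp_add_right (fun t => D t)]
      exact intervalIntegral.integral_interval_sub_left (hii h0 mbk) (hii h0 mak)
    have e2 : P b - P a = ∫ t in a..b, D t :=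
      intervalIntegral.integral_interval_sub_left (hii h0 mb) (hii h0 ma)
    have i1 : IntervalIntegrable (fun t => D (t + k)) volume a b := by
      simpa using (hii mak mbk).comp_add_right k
    have e3 : P (b + k) - P b - (P (a + k) - P a) = ∫ t in a..b, (D (t + k) - D t) := by
      rw [intervalIntegral.integral_sub i1 (hii ma mb), ← e1, ← e2]
      ring
    have e4 : ‖∫ t in a..b, (D (t + k) - D t)‖ₑ ≤ ENNReal.ofReal (ε * k) := by
      rw [intervalIntegral.integral_of_le hab]
      refine (enorm_integral_le_lintegral_enorm _).trans
        (le_trans (lintegral_mono_set ?_) (hbound k ⟨hk.1, hk1⟩))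
      exact fun t ht => ⟨ha.1.le.trans ht.1.le, by linarith [ht.2]⟩
    have e5 : |∫ t in a..b, (D (t + k) - D t)| ≤ ε * k := by
      rw [← ofReal_norm, ENNReal.ofReal_le_ofReal_iff (by nlinarith [hk.1])] at e4
      exact e4
    rw [← mul_sub, e3, abs_mul, abs_of_pos (inv_pos.2 hk.1), inv_mul_le_iff₀ hk.1]
    linarith
  have hae : ∀ᵐ t ∂timeMeasure T, t ∈ Ioo 0 T ∧ HasDerivAt P (D t) t := by
    have : timeMeasure T = volume.restrict (Ioo 0 T) :=
      (Measure.restrict_congr_set Ioo_ae_eq_Icc).symm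
    rw [this]
    filter_upwards [ae_restrict_mem measurableSet_Ioo, ae_restrict_of_ae hder] with t h1 h2
    exact ⟨h1, h2 h1⟩
  have hne : (ae (timeMeasure T)).NeBot := by
    rw [ae_neBot, ← Measure.measure_univ_ne_zero, Measure.restrict_apply_univ, Real.volume_Icc]
    simpa using hT
  obtain ⟨a, ha1, ha2⟩ := hae.exists
  refine ⟨D a, hae.mono fun t ht => ?_⟩
  rcases le_total a t with h' | h'
  · exact key a ha1 t ht.1 h' ha2 ht.2
  · exact (key t ht.1 a ha1 h' ht.2 ha2).symm

end Translation

/-! ### Differentiable bilinear forms and the energy identity -/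

section Energy

variable {T : ℝ}
  {V : Type*} [NormedAddCommGroup V] [InnerProductSpace ℝ V] [CompleteSpace V]
  [TopologicalSpace.SeparableSpace V]
  {H : Type*} [NormedAddCommGroup H] [InnerProductSpace ℝ H] [CompleteSpace H]
  [TopologicalSpace.SeparableSpace H]
  {i : V →L[ℝ] H} {M : ℝ → H →L[ℝ] H →L[ℝ] ℝ} {M' : ℝ → V →L[ℝ] V →L[ℝ] ℝ} {K : ℝ}

/-- The symmetric bilinear forms `M(t)` on `H` are, along the embedding `i : V → H`, primitives of
the bilinear forms `M'(t)` on `V`. The forms are bounded by `K`, at all times for convenience, but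
the primitive is only required to agree with `M(t)` at almost all times `t ∈ [0,T]`. -/
structure IsDifferentiableForm (T : ℝ) (i : V →L[ℝ] H) (M : ℝ → H →L[ℝ] H →L[ℝ] ℝ)
    (M' : ℝ → V →L[ℝ] V →L[ℝ] ℝ) (K : ℝ) : Prop where
  measurable : ∀ x y, AEMeasurable (fun t => M t x y) (timeMeasure T)
  norm_le : ∀ t, ‖M t‖ ≤ K
  symm : ∀ᵐ t ∂timeMeasure T, ∀ x y, M t x y = M t y x
  measurable_deriv : ∀ x y, AEMeasurable (fun t => M' t x y) (timeMeasure T)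
  norm_deriv_le : ∀ t, ‖M' t‖ ≤ K
  primitive : ∀ x, ∃ c : StrongDual ℝ V, ∀ᵐ t ∂timeMeasure T,
    (M t (i x)).comp i = c + ∫ s in (0 : ℝ)..t, M' s x

/-- Extension by zero, with a strongly measurable version. -/
theorem exists_stronglyMeasurable_extension {E : Type*} [NormedAddCommGroup E] {f : ℝ → E}
    (hf : MemLp f 2 (timeMeasure T)) : ∃ u : ℝ → E, StronglyMeasurable u ∧ MemLp u 2 volume ∧
      ∀ᵐ t, t ∈ Icc 0 T → u t = f t := by
  have hI : MemLp ((Icc 0 T).indicator f) 2 volume := by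
    rwa [memLp_indicator_iff_restrict measurableSet_Icc]
  refine ⟨hI.1.mk _, hI.1.stronglyMeasurable_mk, hI.ae_eq hI.1.ae_eq_mk, ?_⟩
  filter_upwards [hI.1.ae_eq_mk] with t h1 ht
  rw [← h1, indicator_of_mem ht]

theorem timeMeasure_ne_zero (hT : 0 < T) : timeMeasure T ≠ 0 := by
  rw [← Measure.measure_univ_ne_zero, Measure.restrict_apply_univ, Real.volume_Icc]
  simpa using hT

theorem ae_neBot_timeMeasure (hT : 0 < T) : (ae (timeMeasure T)).NeBot :=
  ae_neBot.2 (timeMeasure_ne_zero hT)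

theorem abs_form_le {X Y : Type*} [NormedAddCommGroup X] [NormedSpace ℝ X] [NormedAddCommGroup Y]
    [NormedSpace ℝ Y] {B : X →L[ℝ] Y →L[ℝ] ℝ} {K : ℝ} (hB : ‖B‖ ≤ K) (x : X) (y : Y) :
    |B x y| ≤ K * ‖x‖ * ‖y‖ :=
  (B.le_opNorm₂ x y).trans (by gcongr)

namespace IsDifferentiableForm

theorem integrable_deriv_apply {H : Type*} [NormedAddCommGroup H] [InnerProductSpace ℝ H]
    {i : V →L[ℝ] H} {M : ℝ → H →L[ℝ] H →L[ℝ] ℝ} (h : IsDifferentiableForm T i M M' K)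
    (x : V) : Integrable (fun t => M' t x) (timeMeasure T) :=
  (memLp_form h.measurable_deriv h.norm_deriv_le (memLp_const x)).integrable (by norm_num)

/-- The exceptional null set of times can be chosen independently of the vectors. -/
theorem exists_forall_primitive {H : Type*} [NormedAddCommGroup H] [InnerProductSpace ℝ H]
    {i : V →L[ℝ] H} {M : ℝ → H →L[ℝ] H →L[ℝ] ℝ} (h : IsDifferentiableForm T i M M' K)
    (hT : 0 < T) : ∃ c : V → StrongDual ℝ V, ∀ᵐ t ∂timeMeasure T, ∀ x,
      (M t (i x)).comp i = c x + ∫ s in (0 : ℝ)..t, M' s x := by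
  have h0 : (0 : ℝ) ∈ Icc 0 T := ⟨le_rfl, hT.le⟩
  have hint : ∀ x, ∀ t ∈ Icc 0 T, IntervalIntegrable (fun s => M' s x) volume 0 t := fun x t ht =>
    intervalIntegrable_of_timeMeasure (h.integrable_deriv_apply x) h0 ht
  have hcont : ∀ t ∈ Icc 0 T, Continuous fun x : V => ∫ s in (0 : ℝ)..t, M' s x := by
    intro t ht
    have : LipschitzWith (K.toNNReal * t.toNNReal) fun x : V => ∫ s in (0 : ℝ)..t, M' s x := by
      refine LipschitzWith.of_dist_le_mul fun x y => ?_
      rw [dist_eq_norm, ← intervalIntegral.integral_sub (hint x t ht) (hint y t ht), dist_eq_norm]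
      have := intervalIntegral.norm_integral_le_of_norm_le_const
        (f := fun s => M' s x - M' s y) (a := 0) (b := t) (C := K * ‖x - y‖) fun s _ => by
          rw [← map_sub]
          exact (M' s).le_of_opNorm_le (h.norm_deriv_le s) _
      refine this.trans (le_of_eq ?_)
      have hK : 0 ≤ K := (norm_nonneg (M 0)).trans (h.norm_le 0)
      rw [sub_zero, abs_of_nonneg ht.1, NNReal.coe_mul, Real.coe_toNNReal _ hK,
        Real.coe_toNNReal _ ht.1]
      ring
    exact this.continuous
  have hMc : ∀ t, Continuous fun x : V => (M t (i x)).comp i := fun t =>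
    ((ContinuousLinearMap.compL ℝ V H ℝ).flip i).continuous.comp
      ((M t).continuous.comp i.continuous)
  choose c hc using h.primitive
  have hall : ∀ᵐ t ∂timeMeasure T, t ∈ Icc 0 T ∧ ∀ n : ℕ,
      (M t (i (TopologicalSpace.denseSeq V n))).comp i = c (TopologicalSpace.denseSeq V n) +
        ∫ s in (0 : ℝ)..t, M' s (TopologicalSpace.denseSeq V n) :=
    (ae_restrict_mem measurableSet_Icc).and (ae_all_iff.2 fun n => hc _)
  have := ae_neBot_timeMeasure hT
  obtain ⟨t₁, ht₁, h₁⟩ := hall.exists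
  refine ⟨fun x => (M t₁ (i x)).comp i - ∫ s in (0 : ℝ)..t₁, M' s x, ?_⟩
  filter_upwards [hall] with t ht
  refine fun x => congrFun (Continuous.ext_on (TopologicalSpace.denseRange_denseSeq V)
    (hMc t) (((hMc t₁).sub (hcont t₁ ht₁)).add (hcont t ht.1)) ?_) x
  rintro _ ⟨n, rfl⟩
  simp only [Pi.add_apply, Pi.sub_apply]
  rw [ht.2 n, h₁ n]
  abel

/-- The energy identity: if `F` is the derivative of `t ↦ M(t)v(t)` in the dual of `V`, then
`M(v,v)` is a primitive of `2⟨F,v⟩ - M'(v,v)`. The increments over a time step are computed exactly,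
and the error is controlled by the continuity of translations of `v` in `L²(0,T;V)`. -/
theorem energy_identity (h : IsDifferentiableForm T i M M' K) (hT : 0 < T) {v : ℝ → V}
    (hv : MemLp v 2 (timeMeasure T))
    {F : ℝ → StrongDual ℝ V} (hF : MemLp F 2 (timeMeasure T))
    (hm : ∃ c, ∀ᵐ t ∂timeMeasure T, (M t (i (v t))).comp i = c + ∫ s in (0 : ℝ)..t, F s) :
    ∃ e, ∀ᵐ t ∂timeMeasure T, M t (i (v t)) (i (v t)) =
      e + ∫ s in (0 : ℝ)..t, (2 * F s (v s) - M' s (v s) (v s)) := by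
  have hK : 0 ≤ K := (norm_nonneg (M 0)).trans (h.norm_le 0)
  have h0 : (0 : ℝ) ∈ Icc 0 T := ⟨le_rfl, hT.le⟩
  obtain ⟨c, hc⟩ := hm
  obtain ⟨d, hd⟩ := h.exists_forall_primitive hT
  set G : ℝ → ℝ := fun s => 2 * F s (v s) - M' s (v s) (v s) with hG
  have hFi : Integrable F (timeMeasure T) := hF.integrable (by norm_num)
  have hGi : Integrable G (timeMeasure T) :=
    ((integrable_dual_apply hF hv).const_mul 2).sub
      (integrable_dual_apply (memLp_form h.measurable_deriv h.norm_deriv_le hv) hv)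
  have hiv : MemLp (fun t => i (v t)) 2 (timeMeasure T) := i.comp_memLp' hv
  have hEi : Integrable (fun t => M t (i (v t)) (i (v t))) (timeMeasure T) :=
    integrable_dual_apply (memLp_form h.measurable h.norm_le hiv) hiv
  have hPG : Integrable (fun t => ∫ s in (0 : ℝ)..t, G s) (timeMeasure T) := by
    have := continuousOn_primitive_timeMeasure hT.le hGi 0
    simp only [zero_add] at this
    exact integrable_of_continuousOn_timeMeasure this
  set D : ℝ → ℝ := fun t => M t (i (v t)) (i (v t)) - ∫ s in (0 : ℝ)..t, G s with hD
  suffices ∃ e, ∀ᵐ t ∂timeMeasure T, D t = e by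
    obtain ⟨e, he⟩ := this
    exact ⟨e, he.mono fun t ht => by rw [← ht, hD]; ring⟩
  have hDi : Integrable D (timeMeasure T) := hEi.sub hPG
  refine ae_const_of_lintegral_increment_le hT hDi fun ε hε => ?_
  -- versions on `ℝ` for which translation and Tonelli's theorem need no care
  obtain ⟨u, hum, huL, hu⟩ := exists_stronglyMeasurable_extension hv
  obtain ⟨Fu, hFum, hFuL, hFu⟩ := exists_stronglyMeasurable_extension hF
  set q : ℝ → ℝ := fun t => ‖Fu t‖ + K * ‖u t‖ with hq
  have hqm : StronglyMeasurable q := hFum.norm.add (hum.norm.const_mul K)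
  have hqL : MemLp q 2 volume := hFuL.norm.add (huL.norm.const_mul K)
  have hgood : ∀ᵐ t, t ∈ Icc 0 T → (u t = v t ∧ Fu t = F t) ∧
      (M t (i (v t))).comp i = (c + ∫ s in (0 : ℝ)..t, F s) ∧
      (∀ x, (M t (i x)).comp i = d x + ∫ s in (0 : ℝ)..t, M' s x) ∧
      ∀ x y, M t x y = M t y x := by
    filter_upwards [hu, hFu, (ae_restrict_iff' measurableSet_Icc).1 hc,
      (ae_restrict_iff' measurableSet_Icc).1 hd, (ae_restrict_iff' measurableSet_Icc).1 h.symm]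
      with t h1 h2 h3 h4 h5 ht
    exact ⟨⟨h1 ht, h2 ht⟩, h3 ht, h4 ht, h5 ht⟩
  obtain ⟨δ, hδ, hbound⟩ := lintegral_translate_le hum huL hqm hqL hε
  refine ⟨δ, hδ, fun k hk => le_trans ?_ (hbound k hk)⟩
  refine le_trans ?_ (setLIntegral_le_lintegral (Icc 0 (T - k)) _)
  refine lintegral_mono_ae ?_
  have hshift : ∀ᵐ t, t + k ∈ Icc 0 T → (u (t + k) = v (t + k) ∧ Fu (t + k) = F (t + k)) ∧
      (M (t + k) (i (v (t + k)))).comp i = (c + ∫ s in (0 : ℝ)..(t + k), F s) ∧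
      (∀ x, (M (t + k) (i x)).comp i = d x + ∫ s in (0 : ℝ)..(t + k), M' s x) ∧
      ∀ x y, M (t + k) x y = M (t + k) y x :=
    (measurePreserving_add_right volume k).quasiMeasurePreserving.ae hgood
  filter_upwards [ae_restrict_mem measurableSet_Icc, ae_restrict_of_ae hgood,
    ae_restrict_of_ae hshift] with t ht h1 h2
  have ht1 : t ∈ Icc 0 T := ⟨ht.1, by linarith [ht.2, hk.1]⟩
  have ht2 : t + k ∈ Icc 0 T := ⟨by linarith [ht.1, hk.1], by linarith [ht.2]⟩
  obtain ⟨⟨hu1, -⟩, hc1, hd1, hs1⟩ := h1 ht1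
  obtain ⟨⟨hu2, -⟩, hc2, hd2, -⟩ := h2 ht2
  -- `x` and `y` are the values at the two end points of the step, `z` is the one at the time `s`
  set x := v (t + k) with hx
  set y := v t with hy
  have hFt : IntervalIntegrable F volume t (t + k) := intervalIntegrable_of_timeMeasure hFi ht1 ht2
  have hM't : IntervalIntegrable (fun s => M' s x) volume t (t + k) :=
    intervalIntegrable_of_timeMeasure (h.integrable_deriv_apply x) ht1 ht2
  have hGt : IntervalIntegrable G volume t (t + k) := intervalIntegrable_of_timeMeasure hGi ht1 ht2
  have e1 : (M (t + k) (i x)).comp i - (M t (i y)).comp i = ∫ s in t..(t + k), F s := by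
    rw [hc1, hc2, ← intervalIntegral.integral_interval_sub_left
      (intervalIntegrable_of_timeMeasure hFi h0 ht2) (intervalIntegrable_of_timeMeasure hFi h0 ht1)]
    abel
  have e2 : (M (t + k) (i x)).comp i - (M t (i x)).comp i = ∫ s in t..(t + k), M' s x := by
    rw [hd1, hd2, ← intervalIntegral.integral_interval_sub_left
      (intervalIntegrable_of_timeMeasure (h.integrable_deriv_apply x) h0 ht2)
      (intervalIntegrable_of_timeMeasure (h.integrable_deriv_apply x) h0 ht1)]
    abel
  have e3 : (∫ s in t..(t + k), F s) (x + y) = ∫ s in t..(t + k), F s (x + y) :=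
    (ContinuousLinearMap.intervalIntegral_comp_comm
      (ContinuousLinearMap.apply ℝ ℝ (x + y)) hFt).symm
  have e4 : (∫ s in t..(t + k), M' s x) y = ∫ s in t..(t + k), M' s x y :=
    (ContinuousLinearMap.intervalIntegral_comp_comm (ContinuousLinearMap.apply ℝ ℝ y) hM't).symm
  have i3 : IntervalIntegrable (fun s => F s (x + y)) volume t (t + k) :=
    intervalIntegrable_of_timeMeasure (hFi.apply_continuousLinearMap _) ht1 ht2
  have i4 : IntervalIntegrable (fun s => M' s x y) volume t (t + k) :=
    intervalIntegrable_of_timeMeasure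
      ((h.integrable_deriv_apply x).apply_continuousLinearMap _) ht1 ht2
  -- symmetry of `M t` makes the mixed terms `M t x y` cancel
  have e5 : M (t + k) (i x) (i x) - M t (i y) (i y) =
      ∫ s in t..(t + k), (F s (x + y) - M' s x y) := by
    rw [intervalIntegral.integral_sub i3 i4, ← e3, ← e4, ← e1, ← e2]
    have := hs1 (i x) (i y)
    simp only [sub_apply, ContinuousLinearMap.comp_apply, map_add]
    linarith
  have e6 : D (t + k) - D t = ∫ σ in (0 : ℝ)..k,
      (F (t + σ) (x + y) - M' (t + σ) x y - G (t + σ)) := by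
    rw [intervalIntegral.integral_comp_add_left (fun s => F s (x + y) - M' s x y - G s) t, add_zero,
      intervalIntegral.integral_sub (i3.sub i4) hGt, ← e5,
      ← intervalIntegral.integral_interval_sub_left
        (intervalIntegrable_of_timeMeasure hGi h0 ht2)
        (intervalIntegrable_of_timeMeasure hGi h0 ht1)]
    simp only [hD]
    ring
  rw [e6, intervalIntegral.integral_of_le hk.1.le]
  refine (enorm_integral_le_lintegral_enorm _).trans (lintegral_mono_ae ?_)
  have hσ : ∀ᵐ σ, t + σ ∈ Icc 0 T → u (t + σ) = v (t + σ) ∧ Fu (t + σ) = F (t + σ) :=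
    ((measurePreserving_add_left volume t).quasiMeasurePreserving.ae hgood).mono
      fun σ h hσ => (h hσ).1
  filter_upwards [ae_restrict_mem measurableSet_Ioc, ae_restrict_of_ae hσ] with σ hσ1 hσ2
  obtain ⟨hus, hFs⟩ := hσ2 ⟨by linarith [ht.1, hσ1.1], by linarith [ht.2, hσ1.2]⟩
  rw [hu1, hu2, hus]
  set s := t + σ
  set z := v s
  have hqt : K * ‖y‖ ≤ q t := by
    simp only [hq, hu1]; exact le_add_of_nonneg_left (norm_nonneg _)
  have hqs1 : ‖F s‖ ≤ q s := by
    simp only [hq, hFs]; exact le_add_of_nonneg_right (by positivity)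
  have hqs2 : q s = ‖F s‖ + K * ‖z‖ := by simp only [hq, hFs, hus]
  have hq0 : ∀ t, 0 ≤ q t := fun t => by positivity
  have hid : F s (x + y) - M' s x y - G s =
      F s (y - z) - M' s z (y - z) + (F s (x - z) - M' s (x - z) y) := by
    simp only [hG, map_sub, map_add, sub_apply]
    ring
  have n1 : |F s (y - z)| ≤ ‖F s‖ * ‖y - z‖ := (F s).le_opNorm _
  have n2 := abs_form_le (h.norm_deriv_le s) z (y - z)
  have n3 : |F s (x - z)| ≤ ‖F s‖ * ‖x - z‖ := (F s).le_opNorm _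
  have n4 := abs_form_le (h.norm_deriv_le s) (x - z) y
  have hreal : |F s (x + y) - M' s x y - G s| ≤
      q s * ‖z - y‖ + (q s + q t) * ‖x - z‖ := by
    rw [hid, hqs2, norm_sub_rev z y]
    refine (abs_add_le _ _).trans (add_le_add ((abs_sub _ _).trans ?_) ((abs_sub _ _).trans ?_))
    · linarith
    · have a1 : K * ‖x - z‖ * ‖y‖ ≤ q t * ‖x - z‖ := by
        calc K * ‖x - z‖ * ‖y‖ = K * ‖y‖ * ‖x - z‖ := by ring
          _ ≤ _ := by gcongr
      have a2 : 0 ≤ K * ‖z‖ * ‖x - z‖ := by positivity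
      linarith
  rw [← ofReal_norm, Real.norm_eq_abs]
  refine (ENNReal.ofReal_le_ofReal hreal).trans (le_of_eq ?_)
  rw [ENNReal.ofReal_add (by have := hq0 s; positivity)
      (by have := hq0 s; have := hq0 t; positivity),
    ENNReal.ofReal_mul (hq0 s), ENNReal.ofReal_mul (add_nonneg (hq0 s) (hq0 t)),
    ENNReal.ofReal_add (hq0 s) (hq0 t), Real.enorm_of_nonneg (hq0 s),
    Real.enorm_of_nonneg (hq0 t), ofReal_norm, ofReal_norm]

end IsDifferentiableForm

end Energy

/-! ### Continuity in time with values in the pivot space -/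

section Continuity

variable {T : ℝ}
  {V : Type*} [NormedAddCommGroup V] [InnerProductSpace ℝ V] [CompleteSpace V]
  [TopologicalSpace.SeparableSpace V]
  {H : Type*} [NormedAddCommGroup H] [InnerProductSpace ℝ H] [CompleteSpace H]
  [TopologicalSpace.SeparableSpace H]
  {i : V →L[ℝ] H}

/-- The inner product as a continuous bilinear form. -/
noncomputable def innerForm (H : Type*) [NormedAddCommGroup H] [InnerProductSpace ℝ H] :
    H →L[ℝ] H →L[ℝ] ℝ :=
  (LinearMap.mk₂ ℝ (fun x y : H => inner ℝ x y) (fun x y z => inner_add_left x y z)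
    (fun c x y => real_inner_smul_left x y c) (fun x y z => inner_add_right x y z)
    (fun c x y => real_inner_smul_right x y c)).mkContinuous₂ 1 fun x y => by
      rw [one_mul]; exact norm_inner_le_norm x y

theorem innerForm_apply {H : Type*} [NormedAddCommGroup H] [InnerProductSpace ℝ H] (x y : H) :
    innerForm H x y = inner ℝ x y := rfl

theorem norm_innerForm_le (H : Type*) [NormedAddCommGroup H] [InnerProductSpace ℝ H] :
    ‖innerForm H‖ ≤ 1 := LinearMap.mkContinuous₂_norm_le _ zero_le_one _

/-- The inner product of `H`, constant in time, as a differentiable form. -/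
theorem isDifferentiableForm_inner {V : Type*} [NormedAddCommGroup V] [InnerProductSpace ℝ V]
    {H : Type*} [NormedAddCommGroup H] [InnerProductSpace ℝ H] (T : ℝ) (i : V →L[ℝ] H) :
    IsDifferentiableForm T i (fun _ => innerForm H) (fun _ => 0) 1 where
  measurable _ _ := aemeasurable_const
  norm_le _ := norm_innerForm_le H
  symm := Eventually.of_forall fun _ x y => real_inner_comm y x
  measurable_deriv _ _ := aemeasurable_const
  norm_deriv_le _ := (norm_zero (E := V →L[ℝ] V →L[ℝ] ℝ)).trans_le zero_le_one
  primitive x := ⟨(innerForm H (i x)).comp i, Eventually.of_forall fun t => by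
    simp only [zero_apply, intervalIntegral.integral_zero, add_zero]⟩

/-- `∫ₐᵇ ‖F‖` is controlled by the square root of the length of the interval. -/
theorem norm_integral_le_sqrt_mul {E : Type*} [NormedAddCommGroup E] [NormedSpace ℝ E] {F : ℝ → E}
    (hF : MemLp F 2 (timeMeasure T)) {a b : ℝ} (ha : a ∈ Icc 0 T) (hb : b ∈ Icc 0 T) :
    ‖∫ s in a..b, F s‖ ≤ Real.sqrt |b - a| * (eLpNorm F 2 (timeMeasure T)).toReal := by
  rw [intervalIntegral.norm_integral_eq_norm_integral_uIoc]
  refine (norm_integral_le_lintegral_norm _).trans ?_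
  have h1 : (volume.restrict (uIoc a b)) ≤ timeMeasure T :=
    Measure.restrict_mono (uIoc_subset_uIcc.trans (uIcc_subset_Icc ha hb)) le_rfl
  have hFm : AEStronglyMeasurable F (volume.restrict (uIoc a b)) := hF.1.mono_measure h1
  have h2 := lintegral_enorm_mul_le (q := fun _ : ℝ => (1 : ℝ)) aestronglyMeasurable_const hFm
  have h3 : eLpNorm (fun _ : ℝ => (1 : ℝ)) 2 (volume.restrict (uIoc a b)) =
      ENNReal.ofReal (Real.sqrt |b - a|) := by
    rw [eLpNorm_const' _ (by norm_num) (by norm_num), Measure.restrict_apply_univ,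
      Real.volume_uIoc, Real.sqrt_eq_rpow, ENNReal.ofReal_rpow_of_nonneg (abs_nonneg _)
        (by norm_num)]
    simp
  have h4 : eLpNorm F 2 (volume.restrict (uIoc a b)) ≤ eLpNorm F 2 (timeMeasure T) :=
    eLpNorm_mono_measure _ h1
  have h5 : ∫⁻ s in uIoc a b, ENNReal.ofReal ‖F s‖ ≤
      ENNReal.ofReal (Real.sqrt |b - a|) * eLpNorm F 2 (timeMeasure T) := by
    rw [h3] at h2
    simp only [enorm_one, one_mul] at h2
    simp only [ofReal_norm]
    exact h2.trans (by gcongr)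
  refine (ENNReal.toReal_mono (ENNReal.mul_ne_top ENNReal.ofReal_ne_top hF.2.ne) h5).trans ?_
  rw [ENNReal.toReal_mul, ENNReal.toReal_ofReal (Real.sqrt_nonneg _)]

/-- Near every time `t₀` there are times `s` at which `v` is small compared to `|s - t₀|^{-1/2}`,
because `1/|s - t₀|` is not integrable. -/
theorem exists_near_mul_norm_sq_lt {E : Type*} [NormedAddCommGroup E] (hT : 0 < T) {v : ℝ → E}
    (hv : MemLp v 2 (timeMeasure T)) {p : ℝ → Prop} (hp : ∀ᵐ t ∂timeMeasure T, p t) {t₀ : ℝ}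
    (ht₀ : t₀ ∈ Icc 0 T) {ε : ℝ} (hε : 0 < ε) :
    ∃ s ∈ Icc 0 T, p s ∧ |s - t₀| < ε ∧ |s - t₀| * ‖v s‖ ^ 2 < ε := by
  obtain ⟨b, hb, hbt, hbε⟩ : ∃ b ∈ Icc 0 T, b ≠ t₀ ∧ |b - t₀| < ε := by
    rcases ht₀.2.lt_or_eq with h | h
    · refine ⟨min (t₀ + ε / 2) T, ⟨le_min (by linarith [ht₀.1]) hT.le, min_le_right _ _⟩,
        (lt_min (by linarith) h).ne', ?_⟩
      rw [abs_of_nonneg (by linarith [lt_min (show t₀ < t₀ + ε / 2 by linarith) h])]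
      linarith [min_le_left (t₀ + ε / 2) T]
    · refine ⟨max (T - ε / 2) 0, ⟨le_max_right _ _, max_le (by linarith) hT.le⟩,
        (max_lt (by linarith) (by linarith)).ne, ?_⟩
      rw [abs_of_nonpos (by linarith [max_lt (show T - ε / 2 < T by linarith) hT])]
      linarith [le_max_left (T - ε / 2) 0]
  by_contra hcon
  push Not at hcon
  have hsub : uIoc t₀ b ⊆ Icc 0 T := uIoc_subset_uIcc.trans (uIcc_subset_Icc ht₀ hb)
  have hnot : ¬ IntervalIntegrable (fun s => (s - t₀)⁻¹) volume t₀ b := by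
    rw [intervalIntegrable_sub_inv_iff]
    simp [hbt.symm]
  apply hnot
  rw [intervalIntegrable_iff]
  have hint : IntegrableOn (fun s => ε⁻¹ * ‖v s‖ ^ 2) (uIoc t₀ b) volume :=
    IntegrableOn.mono_set (t := Icc 0 T) ((hv.integrable_norm_pow (by norm_num)).const_mul _) hsub
  refine Integrable.mono' hint (by fun_prop) ?_
  have hp' : ∀ᵐ t ∂(volume.restrict (uIoc t₀ b)), p t :=
    ae_restrict_of_ae_restrict_of_subset hsub hp
  filter_upwards [ae_restrict_mem measurableSet_uIoc, hp'] with s hs hps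
  rw [norm_inv, Real.norm_eq_abs]
  by_cases hz : |s - t₀| = 0
  · rw [hz, inv_zero]; positivity
  · have h1 : |s - t₀| < ε := by
      refine lt_of_le_of_lt ?_ hbε
      have := uIoc_subset_uIcc hs
      rw [abs_sub_comm s, abs_sub_comm b]
      have := abs_sub_left_of_mem_uIcc this
      rwa [abs_sub_comm s, abs_sub_comm b] at this
    have h2 := hcon s (hsub hs) hps h1
    have h3 : 0 < |s - t₀| := lt_of_le_of_ne (abs_nonneg _) (Ne.symm hz)
    rw [inv_le_iff_one_le_mul₀ h3, mul_assoc, ← div_eq_inv_mul, le_div_iff₀ hε]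
    linarith

/-- A function in `L²(0,T;V)` with weak derivative in `L²(0,T;V*)` has a representative that is
continuous with values in `H`. Both the inner products with elements of `V` and the squared norm are
primitives; at every time `t₀` the two are compatible because of good approximating times. -/
theorem exists_continuousOn_representative (hT : 0 < T) (hi : DenseRange i) {v : ℝ → V}
    (hv : MemLp v 2 (timeMeasure T)) {F : ℝ → StrongDual ℝ V} (hF : MemLp F 2 (timeMeasure T))
    (hm : ∃ c, ∀ᵐ t ∂timeMeasure T,
      (innerForm H (i (v t))).comp i = c + ∫ s in (0 : ℝ)..t, F s) :
    ∃ y : ℝ → H, ContinuousOn y (Icc 0 T) ∧ ∀ᵐ t ∂timeMeasure T, i (v t) = y t := by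
  have h0 : (0 : ℝ) ∈ Icc 0 T := ⟨le_rfl, hT.le⟩
  obtain ⟨e₀, he⟩ := (isDifferentiableForm_inner T i).energy_identity hT hv hF hm
  obtain ⟨c, hc⟩ := hm
  have hFi : Integrable F (timeMeasure T) := hF.integrable (by norm_num)
  set k : ℝ → StrongDual ℝ V := fun t => c + ∫ s in (0 : ℝ)..t, F s with hk
  set e : ℝ → ℝ := fun t => e₀ + ∫ s in (0 : ℝ)..t, (2 * F s (v s) -
    (0 : V →L[ℝ] V →L[ℝ] ℝ) (v s) (v s)) with hedef
  have hkc : ContinuousOn k (Icc 0 T) := continuousOn_primitive_timeMeasure hT.le hFi c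
  have hec : ContinuousOn e (Icc 0 T) := by
    refine continuousOn_primitive_timeMeasure hT.le (Integrable.sub ?_ ?_) e₀
    · exact (integrable_dual_apply hF hv).const_mul 2
    · simp
  have hgood : ∀ᵐ t ∂timeMeasure T, (∀ w, inner ℝ (i (v t)) (i w) = k t w) ∧
      ‖i (v t)‖ ^ 2 = e t := by
    filter_upwards [hc, he] with t h1 h2
    refine ⟨fun w => ?_, ?_⟩
    · change _ = (c + ∫ s in (0 : ℝ)..t, F s) w
      rw [← h1]; rfl
    · change _ = e₀ + ∫ s in (0 : ℝ)..t, (2 * F s (v s) - (0 : V →L[ℝ] V →L[ℝ] ℝ) (v s) (v s))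
      rw [← h2, innerForm_apply, real_inner_self_eq_norm_sq]
  have hkw : ∀ w, ContinuousOn (fun t => k t w) (Icc 0 T) := fun w =>
    hkc.clm_apply continuousOn_const
  have hex : ∀ t ∈ Icc 0 T, ∃ y : H, (∀ w, inner ℝ y (i w) = k t w) ∧ ‖y‖ ^ 2 = e t := by
    intro t ht
    have := neBot_nhds_inf_ae_timeMeasure hT ht
    have he0 : 0 ≤ e t := by
      refine ge_of_tendsto (tendsto_of_continuousOn_timeMeasure hec ht) ?_
      filter_upwards [eventually_nhds_inf_ae hgood] with s hs
      rw [← hs.2]; positivity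
    have hkb : ∀ w, ‖(k t : V →ₗ[ℝ] ℝ) w‖ ≤ Real.sqrt (e t) * ‖(i : V →ₗ[ℝ] H) w‖ := by
      intro w
      have h1 := (tendsto_of_continuousOn_timeMeasure (hkw w) ht).norm
      have h2 := ((tendsto_of_continuousOn_timeMeasure hec ht).sqrt).mul_const ‖i w‖
      refine le_of_tendsto_of_tendsto h1 h2 ?_
      filter_upwards [eventually_nhds_inf_ae hgood] with s hs
      rw [← hs.2, Real.sqrt_sq (norm_nonneg _), ← hs.1]
      exact norm_inner_le_norm _ _
    set y : H := (InnerProductSpace.toDual ℝ H).symm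
      ((k t : V →ₗ[ℝ] ℝ).extendOfNorm (i : V →ₗ[ℝ] H)) with hy
    have hyw : ∀ w, inner ℝ y (i w) = k t w := fun w => by
      rw [hy, InnerProductSpace.toDual_symm_apply]
      exact LinearMap.extendOfNorm_eq (e := (i : V →ₗ[ℝ] H)) hi ⟨_, hkb⟩ w
    have hyn : ‖y‖ ^ 2 ≤ e t := by
      have : ‖y‖ ≤ Real.sqrt (e t) := by
        rw [hy, LinearIsometryEquiv.norm_map]
        exact ContinuousLinearMap.opNorm_le_bound _ (Real.sqrt_nonneg _)
          (LinearMap.norm_extendOfNorm_apply_le (e := (i : V →ₗ[ℝ] H)) hi _ hkb)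
      calc ‖y‖ ^ 2 ≤ Real.sqrt (e t) ^ 2 := by gcongr
        _ = e t := Real.sq_sqrt he0
    refine ⟨y, hyw, le_antisymm hyn ?_⟩
    -- `⟨k(t), v(s)⟩ ≤ ‖y‖ √e(s)`, and the left-hand side is close to `e(s)` at suitable times `s`
    have hFn := ENNReal.toReal_nonneg (a := eLpNorm F 2 (timeMeasure T))
    set R := (eLpNorm F 2 (timeMeasure T)).toReal with hR
    have hseq : ∀ n : ℕ, ∃ s ∈ Icc 0 T, ((∀ w, inner ℝ (i (v s)) (i w) = k s w) ∧
        ‖i (v s)‖ ^ 2 = e s) ∧ |s - t| < 1 / ((n : ℝ) + 1) ∧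
        |s - t| * ‖v s‖ ^ 2 < 1 / ((n : ℝ) + 1) := fun n =>
      exists_near_mul_norm_sq_lt hT hv hgood ht (by positivity)
    choose s hsm hsg hs1 hs2 using hseq
    have hlim : Tendsto (fun n : ℕ => 1 / ((n : ℝ) + 1)) atTop (𝓝 0) :=
      tendsto_one_div_add_atTop_nhds_zero_nat
    have hst : Tendsto s atTop (𝓝[Icc 0 T] t) := by
      refine tendsto_nhdsWithin_iff.2 ⟨?_, Eventually.of_forall hsm⟩
      rw [tendsto_iff_dist_tendsto_zero]
      exact squeeze_zero (fun _ => dist_nonneg) (fun n => (hs1 n).le) hlim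
    have hes : Tendsto (fun n => e (s n)) atTop (𝓝 (e t)) := (hec t ht).tendsto.comp hst
    have hle : ∀ n, e (s n) - Real.sqrt (1 / ((n : ℝ) + 1)) * R ≤ ‖y‖ * Real.sqrt (e (s n)) := by
      intro n
      have a1 : k (s n) (v (s n)) = e (s n) := by
        rw [← (hsg n).1, real_inner_self_eq_norm_sq, (hsg n).2]
      have a2 : k t (v (s n)) ≤ ‖y‖ * Real.sqrt (e (s n)) := by
        rw [← hyw, ← (hsg n).2, Real.sqrt_sq (norm_nonneg _)]
        exact real_inner_le_norm _ _
      have a3 : k (s n) - k t = ∫ r in t..(s n), F r := by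
        rw [hk, ← intervalIntegral.integral_interval_sub_left
          (intervalIntegrable_of_timeMeasure hFi h0 (hsm n))
          (intervalIntegrable_of_timeMeasure hFi h0 ht)]
        simp only [add_sub_add_left_eq_sub]
      have a4 : (k (s n) - k t) (v (s n)) ≤ Real.sqrt (1 / ((n : ℝ) + 1)) * R := by
        refine (le_abs_self _).trans (((k (s n) - k t).le_opNorm _).trans ?_)
        rw [a3]
        calc _ ≤ Real.sqrt |s n - t| * R * ‖v (s n)‖ := by
              gcongr; exact norm_integral_le_sqrt_mul hF ht (hsm n)
          _ = Real.sqrt (|s n - t| * ‖v (s n)‖ ^ 2) * R := by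
              rw [Real.sqrt_mul (abs_nonneg _), Real.sqrt_sq (norm_nonneg _)]; ring
          _ ≤ _ := by gcongr; exact (hs2 n).le
      rw [sub_apply, a1] at a4
      linarith
    have hl1 : Tendsto (fun n => e (s n) - Real.sqrt (1 / ((n : ℝ) + 1)) * R) atTop
        (𝓝 (e t - Real.sqrt 0 * R)) := hes.sub (hlim.sqrt.mul_const R)
    have hl2 : Tendsto (fun n => ‖y‖ * Real.sqrt (e (s n))) atTop (𝓝 (‖y‖ * Real.sqrt (e t))) :=
      hes.sqrt.const_mul _
    have hfin := le_of_tendsto_of_tendsto' hl1 hl2 hle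
    rw [Real.sqrt_zero, zero_mul, sub_zero] at hfin
    rcases he0.eq_or_lt with hz | hpos
    · rw [← hz]; positivity
    · have hsq := Real.sq_sqrt he0
      have hsp := Real.sqrt_pos.2 hpos
      have : Real.sqrt (e t) ≤ ‖y‖ := by
        by_contra hlt
        push Not at hlt
        nlinarith
      rw [← hsq]
      gcongr
  choose! y hyw hyn using hex
  refine ⟨y, fun t₀ ht₀ => ?_, ?_⟩
  · -- compare with a fixed element of the dense range of `i`
    rw [ContinuousWithinAt, Metric.tendsto_nhds]
    intro ε hε
    obtain ⟨w, hw⟩ := hi.exists_dist_lt (y t₀) (half_pos hε)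
    have hexp : ∀ t ∈ Icc 0 T, ‖y t - i w‖ ^ 2 = e t - 2 * k t w + ‖i w‖ ^ 2 := fun t ht => by
      rw [norm_sub_sq_real, hyn t ht, hyw t ht]
    have hcont : Tendsto (fun t => e t - 2 * k t w + ‖i w‖ ^ 2) (𝓝[Icc 0 T] t₀)
        (𝓝 (‖y t₀ - i w‖ ^ 2)) := by
      rw [hexp t₀ ht₀]
      exact (((hec t₀ ht₀).tendsto).sub (((hkw w) t₀ ht₀).tendsto.const_mul 2)).add_const _
    have hlt : ‖y t₀ - i w‖ ^ 2 < (ε / 2) ^ 2 := by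
      rw [dist_eq_norm] at hw
      gcongr
    filter_upwards [(tendsto_order.1 hcont).2 _ hlt, self_mem_nhdsWithin] with t h1 ht
    rw [← hexp t ht] at h1
    have h2 : ‖y t - i w‖ < ε / 2 := lt_of_pow_lt_pow_left₀ 2 (by positivity) h1
    calc dist (y t) (y t₀) ≤ dist (y t) (i w) + dist (y t₀) (i w) := dist_triangle_right _ _ _
      _ < ε / 2 + ε / 2 := add_lt_add (by rwa [dist_eq_norm]) hw
      _ = ε := add_halves ε
  · filter_upwards [hgood, ae_restrict_mem measurableSet_Icc] with t h1 ht
    exact hi.eq_of_inner_left ℝ fun w => by rw [h1.1, hyw t ht]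

end Continuity

/-! ### The abstract parabolic problem in fixed spaces -/

section Limit

variable {X : Type*} [NormedAddCommGroup X] [NormedSpace ℝ X]

/-- Uniformly bounded functionals that converge on a dense set converge everywhere. -/
theorem exists_tendsto_of_denseRange {α β : Type*} {l : Filter α} [l.NeBot]
    {L : α → StrongDual ℝ X} {K : ℝ} (hL : ∀ t, ‖L t‖ ≤ K) {i : β → X} (hi : DenseRange i)
    (h : ∀ b, ∃ c, Tendsto (fun t => L t (i b)) l (𝓝 c)) (x : X) :
    ∃ c, Tendsto (fun t => L t x) l (𝓝 c) := by
  rw [← cauchy_map_iff_exists_tendsto, Metric.cauchy_iff]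
  refine ⟨inferInstance, fun ε hε => ?_⟩
  have hK : 0 ≤ K := by
    obtain ⟨t⟩ := nonempty_of_neBot l
    exact (norm_nonneg _).trans (hL t)
  obtain ⟨b, hb⟩ := hi.exists_dist_lt x (show 0 < ε / (4 * (K + 1)) by positivity)
  obtain ⟨c, hc⟩ := h b
  have hcl : ∀ t, |L t x - L t (i b)| ≤ ε / 4 := by
    intro t
    rw [← map_sub]
    refine ((L t).le_of_opNorm_le (hL t) _).trans ?_
    rw [dist_eq_norm, lt_div_iff₀ (by positivity)] at hb
    nlinarith [norm_nonneg (x - i b)]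
  refine ⟨(fun t => L t x) '' {t | |L t (i b) - c| < ε / 4}, ?_, ?_⟩
  · exact image_mem_map ((Metric.tendsto_nhds.1 hc) (ε / 4) (by positivity))
  · rintro _ ⟨s, hs, rfl⟩ _ ⟨t, ht, rfl⟩
    have h1 := hcl s
    have h2 := hcl t
    simp only [mem_ofPred_eq] at hs ht
    rw [Real.dist_eq]
    rw [abs_le] at h1 h2
    rw [abs_lt] at hs ht ⊢
    constructor <;> linarith [h1.1, h1.2, h2.1, h2.2, hs.1, hs.2, ht.1, ht.2]

end Limit

section Lions

/-- Lions' projection theorem: a linear functional that is bounded in terms of `S χ` is represented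
by some `v`, without any completeness of the space of the `χ`. -/
theorem exists_inner_eq_of_abs_le {F Φ : Type*} [NormedAddCommGroup F] [InnerProductSpace ℝ F]
    [CompleteSpace F] [AddCommGroup Φ] [Module ℝ Φ] (S : Φ →ₗ[ℝ] F) (ℓ : Φ →ₗ[ℝ] ℝ) {C : ℝ}
    (h : ∀ χ, |ℓ χ| ≤ C * ‖S χ‖) : ∃ v : F, ∀ χ, inner ℝ v (S χ) = ℓ χ := by
  obtain ⟨g, hg, -⟩ := exists_extension_norm_eq (LinearMap.range S) (ℓ.compLeftInverse S)
  refine ⟨(InnerProductSpace.toDual ℝ F).symm g, fun χ => ?_⟩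
  rw [InnerProductSpace.toDual_symm_apply]
  exact (hg ⟨S χ, χ, rfl⟩).trans (LinearMap.compLeftInverse_apply_of_bdd ℓ S ⟨C, h⟩ χ (S χ) rfl)

end Lions

section InitialForm

variable {T : ℝ}
  {V : Type*} [NormedAddCommGroup V] [InnerProductSpace ℝ V]
  {H : Type*} [NormedAddCommGroup H] [InnerProductSpace ℝ H]
  {i : V →L[ℝ] H} {M : ℝ → H →L[ℝ] H →L[ℝ] ℝ} {M' A : ℝ → V →L[ℝ] V →L[ℝ] ℝ} {K c α β : ℝ}

/-- The initial form `M(0)`, as an essential limit: pointwise values of `M` carry no information. -/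
theorem IsDifferentiableForm.exists_limit [CompleteSpace V] [TopologicalSpace.SeparableSpace V]
    (h : IsDifferentiableForm T i M M' K) (hT : 0 < T)
    (hi : DenseRange i) : ∃ M₀ : H →L[ℝ] H →L[ℝ] ℝ, ∀ x y,
      Tendsto (fun t => M t x y) (𝓝 0 ⊓ ae (timeMeasure T)) (𝓝 (M₀ x y)) := by
  have h0 : (0 : ℝ) ∈ Icc 0 T := ⟨le_rfl, hT.le⟩
  have := neBot_nhds_inf_ae_timeMeasure hT h0
  set l := 𝓝 (0 : ℝ) ⊓ ae (timeMeasure T) with hl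
  have h1 : ∀ a y, ∃ m, Tendsto (fun t => M t (i a) y) l (𝓝 m) := by
    intro a
    refine exists_tendsto_of_denseRange (L := fun t => M t (i a)) (K := K * ‖i a‖)
      (fun t => (M t).le_of_opNorm_le (h.norm_le t) _) hi fun b => ?_
    obtain ⟨d, hd⟩ := h.primitive a
    have hc := tendsto_of_continuousOn_timeMeasure
      ((continuousOn_primitive_timeMeasure hT.le (h.integrable_deriv_apply a) d).clm_apply
        (continuousOn_const (c := b))) h0
    exact ⟨_, hc.congr' ((eventually_nhds_inf_ae hd).mono fun t ht => by rw [← ht]; rfl)⟩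
  have h2 : ∀ x y, ∃ m, Tendsto (fun t => M t x y) l (𝓝 m) := fun x y =>
    exists_tendsto_of_denseRange (L := fun t => (M t).flip y) (K := K * ‖y‖)
      (fun t => (M t).flip.le_of_opNorm_le (((M t).opNorm_flip).trans_le (h.norm_le t)) _) hi
      (fun a => h1 a y) x
  choose m hm using h2
  have hK : 0 ≤ K := (norm_nonneg (M 0)).trans (h.norm_le 0)
  refine ⟨(LinearMap.mk₂ ℝ m (fun x x' y => ?_) (fun r x y => ?_) (fun x y y' => ?_)
    (fun r x y => ?_)).mkContinuous₂ K fun x y => ?_, fun x y => hm x y⟩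
  · refine tendsto_nhds_unique (hm _ _) (((hm x y).add (hm x' y)).congr fun t => ?_)
    rw [map_add, add_apply]
  · refine tendsto_nhds_unique (hm _ _) (((hm x y).const_mul r).congr fun t => ?_)
    rw [map_smul, smul_apply, smul_eq_mul]
  · refine tendsto_nhds_unique (hm _ _) (((hm x y).add (hm x y')).congr fun t => ?_)
    rw [map_add]
  · refine tendsto_nhds_unique (hm _ _) (((hm x y).const_mul r).congr fun t => ?_)
    rw [map_smul, smul_eq_mul]
  · exact le_of_tendsto (hm x y).norm (Eventually.of_forall fun t => abs_form_le (h.norm_le t) x y)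

theorem limit_form_coercive (hT : 0 < T) {M₀ : H →L[ℝ] H →L[ℝ] ℝ}
    (hM₀ : ∀ x y, Tendsto (fun t => M t x y) (𝓝 0 ⊓ ae (timeMeasure T)) (𝓝 (M₀ x y)))
    (hc : ∀ᵐ t ∂timeMeasure T, ∀ x, c * ‖x‖ ^ 2 ≤ M t x x) (x : H) : c * ‖x‖ ^ 2 ≤ M₀ x x := by
  have := neBot_nhds_inf_ae_timeMeasure hT (t₀ := 0) ⟨le_rfl, hT.le⟩
  exact ge_of_tendsto (hM₀ x x) ((eventually_nhds_inf_ae hc).mono fun t ht => ht x)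

/-- A primitive of `t ↦ M(t)v(t)` in the dual of `V` has the initial value `M(0)v(0)`. -/
theorem primitive_initial_eq (h : IsDifferentiableForm T i M M' K) (hT : 0 < T)
    {M₀ : H →L[ℝ] H →L[ℝ] ℝ}
    (hM₀ : ∀ x y, Tendsto (fun t => M t x y) (𝓝 0 ⊓ ae (timeMeasure T)) (𝓝 (M₀ x y)))
    {v : ℝ → V} {F : ℝ → StrongDual ℝ V} (hF : Integrable F (timeMeasure T)) {d : StrongDual ℝ V}
    (hd : ∀ᵐ t ∂timeMeasure T, (M t (i (v t))).comp i = d + ∫ s in (0 : ℝ)..t, F s) {y₀ : H}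
    (hy : Tendsto (fun t => i (v t)) (𝓝 0 ⊓ ae (timeMeasure T)) (𝓝 y₀)) (w : V) :
    d w = M₀ y₀ (i w) := by
  have h0 : (0 : ℝ) ∈ Icc 0 T := ⟨le_rfl, hT.le⟩
  have := neBot_nhds_inf_ae_timeMeasure hT h0
  have h1 := tendsto_of_continuousOn_timeMeasure
    ((continuousOn_primitive_timeMeasure hT.le hF d).clm_apply (continuousOn_const (c := w))) h0
  rw [intervalIntegral.integral_same, add_zero] at h1
  have h2 : Tendsto (fun t => M t (i (v t)) (i w)) (𝓝 0 ⊓ ae (timeMeasure T)) (𝓝 (d w)) :=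
    h1.congr' ((eventually_nhds_inf_ae hd).mono fun t ht => by rw [← ht]; rfl)
  have h3 : Tendsto (fun t => M t (i (v t) - y₀) (i w)) (𝓝 0 ⊓ ae (timeMeasure T)) (𝓝 0) := by
    refine squeeze_zero_norm (fun t => abs_form_le (h.norm_le t) _ _) ?_
    have := ((tendsto_sub_nhds_zero_iff.2 hy).norm.const_mul K).mul_const ‖i w‖
    simpa using this
  refine tendsto_nhds_unique h2 ?_
  have h4 := h3.add (hM₀ y₀ (i w))
  rw [zero_add] at h4
  refine h4.congr fun t => ?_
  rw [map_sub, sub_apply, sub_add_cancel]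

/-- The initial form has no kernel, even when tested with the dense range of `i` only. -/
theorem eq_zero_of_limit_form {M₀ : H →L[ℝ] H →L[ℝ] ℝ} (hi : DenseRange i) (hc0 : 0 < c)
    (hc : ∀ x, c * ‖x‖ ^ 2 ≤ M₀ x x) {z : H} (hz : ∀ w, M₀ z (i w) = 0) : z = 0 := by
  have h1 : ∀ y, M₀ z y = 0 := by
    have : (fun y => M₀ z y) = fun _ => (0 : ℝ) :=
      hi.equalizer (M₀ z).continuous continuous_const (funext hz)
    exact congrFun this
  have h2 := hc z
  rw [h1] at h2
  have h3 : ‖z‖ ^ 2 ≤ 0 := by nlinarith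
  exact norm_eq_zero.1 (pow_eq_zero_iff (n := 2) (by norm_num) |>.1
    (le_antisymm h3 (by positivity)))

end InitialForm

section Parabolic

variable {T : ℝ}
  {V : Type*} [NormedAddCommGroup V] [InnerProductSpace ℝ V] [CompleteSpace V]
  [TopologicalSpace.SeparableSpace V]
  {H : Type*} [NormedAddCommGroup H] [InnerProductSpace ℝ H] [CompleteSpace H]
  [TopologicalSpace.SeparableSpace H]
  {i : V →L[ℝ] H} {M : ℝ → H →L[ℝ] H →L[ℝ] ℝ} {M' A : ℝ → V →L[ℝ] V →L[ℝ] ℝ} {K c α β : ℝ}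

/-- The data of the abstract parabolic problem `(M v)' + A v - M' v = f`: a coercive differentiable
form `M` whose derivative `M'` is of lower order, and forms `A(t)` satisfying a Gårding
inequality. -/
structure IsParabolic (T : ℝ) (i : V →L[ℝ] H) (M : ℝ → H →L[ℝ] H →L[ℝ] ℝ)
    (M' A : ℝ → V →L[ℝ] V →L[ℝ] ℝ) (K c α β : ℝ) : Prop extends
    IsDifferentiableForm T i M M' K where
  pos_c : 0 < c
  pos_α : 0 < α
  nonneg_β : 0 ≤ β
  coercive : ∀ᵐ t ∂timeMeasure T, ∀ x, c * ‖x‖ ^ 2 ≤ M t x x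
  abs_deriv_le : ∀ᵐ t ∂timeMeasure T, ∀ x y, |M' t x y| ≤ K * ‖i x‖ * ‖y‖
  measurable_op : ∀ x y, AEMeasurable (fun t => A t x y) (timeMeasure T)
  norm_op_le : ∀ t, ‖A t‖ ≤ K
  garding : ∀ᵐ t ∂timeMeasure T, ∀ x, α * ‖x‖ ^ 2 - β * ‖i x‖ ^ 2 ≤ A t x x

/-- The energy estimate: the energy identity with the weight `exp (-γt)`, where `γ` is chosen so
large that the coercivity of `M` absorbs the lower order terms. -/
theorem IsParabolic.exists_energy_estimate (h : IsParabolic T i M M' A K c α β) (hT : 0 < T) :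
    ∃ C, 0 < C ∧ ∀ (f : ℝ → StrongDual ℝ V) (v : ℝ → V) (d : StrongDual ℝ V) (y₀ : H),
      MemLp f 2 (timeMeasure T) → MemLp v 2 (timeMeasure T) →
      (∀ᵐ t ∂timeMeasure T, (M t (i (v t))).comp i =
        d + ∫ s in (0 : ℝ)..t, (f s - A s (v s) + M' s (v s))) →
      Tendsto (fun t => i (v t)) (𝓝 0 ⊓ ae (timeMeasure T)) (𝓝 y₀) →
      ∫ t, ‖v t‖ ^ 2 ∂timeMeasure T ≤ C * (‖y₀‖ ^ 2 + ∫ t, ‖f t‖ ^ 2 ∂timeMeasure T) := by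
  have hK : 0 ≤ K := (norm_nonneg (M 0)).trans (h.norm_le 0)
  have hα := h.pos_α
  have hβ := h.nonneg_β
  have hc := h.pos_c
  -- `2β` stems from the Gårding inequality, the other term from Young's inequality for `M'(v,v)`
  set γ : ℝ := (2 * β + K ^ 2 / (2 * α)) / c with hγ
  have hγ0 : 0 ≤ γ := by positivity
  refine ⟨Real.exp (γ * T) / α * (K + 2 / α + 1), by positivity, fun f v d y₀ hf hv hd hy => ?_⟩
  have h0 : (0 : ℝ) ∈ Icc 0 T := ⟨le_rfl, hT.le⟩
  have h1T : T ∈ Icc 0 T := ⟨hT.le, le_rfl⟩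
  have hAv := memLp_form h.measurable_op h.norm_op_le hv
  have hM'v := memLp_form h.measurable_deriv h.norm_deriv_le hv
  have hF : MemLp (fun s => f s - A s (v s) + M' s (v s)) 2 (timeMeasure T) :=
    (hf.sub hAv).add hM'v
  obtain ⟨e, he⟩ := h.energy_identity hT hv hF ⟨d, hd⟩
  set G : ℝ → ℝ := fun s => 2 * (f s - A s (v s) + M' s (v s)) (v s) - M' s (v s) (v s) with hG
  set E : ℝ → ℝ := fun t => e + ∫ s in (0 : ℝ)..t, G s with hE
  have hGi : Integrable G (timeMeasure T) :=
    ((integrable_dual_apply hF hv).const_mul 2).sub (integrable_dual_apply hM'v hv)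
  have hEc : ContinuousOn E (Icc 0 T) := continuousOn_primitive_timeMeasure hT.le hGi e
  have hEM : ∀ᵐ t ∂timeMeasure T, M t (i (v t)) (i (v t)) = E t := he
  have hE0 : e ≤ K * ‖y₀‖ ^ 2 := by
    have := neBot_nhds_inf_ae_timeMeasure hT h0
    have h1 := tendsto_of_continuousOn_timeMeasure hEc h0
    simp only [hE, intervalIntegral.integral_same, add_zero] at h1
    refine le_of_tendsto_of_tendsto h1 ((hy.norm.pow 2).const_mul K) ?_
    filter_upwards [eventually_nhds_inf_ae hEM] with t ht
    change E t ≤ _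
    rw [← ht]
    refine (le_abs_self _).trans ((abs_form_le (h.norm_le t) _ _).trans (le_of_eq (by ring)))
  have hET : 0 ≤ E T := by
    have := neBot_nhds_inf_ae_timeMeasure hT h1T
    refine ge_of_tendsto (tendsto_of_continuousOn_timeMeasure hEc h1T) ?_
    filter_upwards [eventually_nhds_inf_ae hEM, eventually_nhds_inf_ae h.coercive] with t ht h2
    rw [← ht]
    exact le_trans (by positivity) (h2 _)
  have hGle : ∀ᵐ t ∂timeMeasure T,
      G t - γ * E t ≤ - α * ‖v t‖ ^ 2 + 2 / α * ‖f t‖ ^ 2 := by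
    filter_upwards [hEM, h.coercive, h.abs_deriv_le, h.garding] with t h1 h2 h3 h4
    have g1 := h4 (v t)
    have g2 := (abs_le.1 (h3 (v t) (v t))).2
    have g3 : f t (v t) ≤ ‖f t‖ * ‖v t‖ := (le_abs_self _).trans ((f t).le_opNorm _)
    have g4 : (2 * β + K ^ 2 / (2 * α)) * ‖i (v t)‖ ^ 2 ≤ γ * E t := by
      rw [← h1, hγ, div_mul_eq_mul_div, le_div_iff₀ hc]
      have := mul_le_mul_of_nonneg_left (h2 (i (v t)))
        (show 0 ≤ 2 * β + K ^ 2 / (2 * α) by positivity)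
      linarith
    have g5 : 2 * (‖f t‖ * ‖v t‖) ≤ α / 2 * ‖v t‖ ^ 2 + 2 / α * ‖f t‖ ^ 2 := by
      have : 0 ≤ (α * ‖v t‖ - 2 * ‖f t‖) ^ 2 / (2 * α) := by positivity
      have e1 : (α * ‖v t‖ - 2 * ‖f t‖) ^ 2 / (2 * α) =
          α / 2 * ‖v t‖ ^ 2 + 2 / α * ‖f t‖ ^ 2 - 2 * (‖f t‖ * ‖v t‖) := by
        field_simp; ring
      linarith
    have g6 : K * ‖i (v t)‖ * ‖v t‖ ≤ α / 2 * ‖v t‖ ^ 2 + K ^ 2 / (2 * α) * ‖i (v t)‖ ^ 2 := by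
      have : 0 ≤ (α * ‖v t‖ - K * ‖i (v t)‖) ^ 2 / (2 * α) := by positivity
      have e1 : (α * ‖v t‖ - K * ‖i (v t)‖) ^ 2 / (2 * α) =
          α / 2 * ‖v t‖ ^ 2 + K ^ 2 / (2 * α) * ‖i (v t)‖ ^ 2 - K * ‖i (v t)‖ * ‖v t‖ := by
        field_simp; ring
      linarith
    simp only [hG, add_apply, sub_apply]
    linarith
  -- multiply by `exp (-γ t)` and integrate over `[0,T]`
  let ψ : ℝ → ℝ := fun t => Real.exp (-(γ * t))
  have hψ : ContDiff ℝ 1 ψ := by fun_prop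
  have hψd : ∀ t, deriv ψ t = -γ * ψ t := fun t => by
    have h1 : HasDerivAt ψ (Real.exp (-(γ * t)) * (-(γ * 1))) t :=
      ((hasDerivAt_id t).const_mul γ).fun_neg.exp
    rw [h1.deriv]; simp only [ψ]; ring
  have hp := bilin_primitive_eq hT.le hGi hψ (ContinuousLinearMap.mul ℝ ℝ) e h1T
  rw [← integral_timeMeasure hT.le (fun s => (ContinuousLinearMap.mul ℝ ℝ) (G s) (ψ s) +
    (ContinuousLinearMap.mul ℝ ℝ) (e + ∫ r in (0 : ℝ)..s, G r) (deriv ψ s))] at hp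
  have hi1 := hv.integrable_norm_pow (p := 2) (by norm_num)
  have hi2 := hf.integrable_norm_pow (p := 2) (by norm_num)
  have hle : ∫ t, ((ContinuousLinearMap.mul ℝ ℝ) (G t) (ψ t) +
      (ContinuousLinearMap.mul ℝ ℝ) (e + ∫ r in (0 : ℝ)..t, G r) (deriv ψ t)) ∂timeMeasure T ≤
      ∫ t, (-(α * Real.exp (-(γ * T))) * ‖v t‖ ^ 2 + 2 / α * ‖f t‖ ^ 2) ∂timeMeasure T := by
    refine integral_mono_ae ?_ ((hi1.const_mul _).add (hi2.const_mul _)) ?_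
    · exact (integrable_bilin_timeMeasure hGi hψ.continuous _).add (integrable_bilin_timeMeasure
        (integrable_of_continuousOn_timeMeasure hEc) (hψ.continuous_deriv le_rfl) _)
    · filter_upwards [hGle, ae_restrict_mem measurableSet_Icc] with t ht ht'
      simp only [ContinuousLinearMap.mul_apply', hψd]
      change G t * ψ t + E t * (-γ * ψ t) ≤ _
      have p1 : ψ t ≤ 1 := Real.exp_le_one_iff.2 (by have := mul_nonneg hγ0 ht'.1; linarith)
      have p2 : Real.exp (-(γ * T)) ≤ ψ t :=
        Real.exp_le_exp.2 (by have := mul_le_mul_of_nonneg_left ht'.2 hγ0; linarith)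
      have p0 : 0 < ψ t := Real.exp_pos _
      calc G t * ψ t + E t * (-γ * ψ t) = (G t - γ * E t) * ψ t := by ring
        _ ≤ (- α * ‖v t‖ ^ 2 + 2 / α * ‖f t‖ ^ 2) * ψ t := by gcongr
        _ = - (α * ψ t * ‖v t‖ ^ 2) + 2 / α * ‖f t‖ ^ 2 * ψ t := by ring
        _ ≤ - (α * Real.exp (-(γ * T)) * ‖v t‖ ^ 2) + 2 / α * ‖f t‖ ^ 2 * 1 := by gcongr
        _ = _ := by ring
  rw [integral_add (hi1.const_mul _) (hi2.const_mul _), integral_const_mul, integral_const_mul]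
    at hle
  have hETψ : 0 ≤ (ContinuousLinearMap.mul ℝ ℝ) (e + ∫ s in (0 : ℝ)..T, G s) (ψ T) :=
    mul_nonneg hET (Real.exp_pos _).le
  have hψ0 : ψ 0 = 1 := by simp [ψ]
  simp only [hψ0, ContinuousLinearMap.mul_apply', mul_one] at hp hETψ hle
  set I := ∫ t, ‖v t‖ ^ 2 ∂timeMeasure T
  set J := ∫ t, ‖f t‖ ^ 2 ∂timeMeasure T
  have hJ : 0 ≤ J := integral_nonneg fun t => by positivity
  have hfin : α * Real.exp (-(γ * T)) * I ≤ K * ‖y₀‖ ^ 2 + 2 / α * J := by linarith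
  rw [Real.exp_neg] at hfin
  have hexp := Real.exp_pos (γ * T)
  calc I = Real.exp (γ * T) / α * (α * (Real.exp (γ * T))⁻¹ * I) := by field_simp
    _ ≤ Real.exp (γ * T) / α * (K * ‖y₀‖ ^ 2 + 2 / α * J) := by gcongr
    _ ≤ Real.exp (γ * T) / α * ((K + 2 / α + 1) * (‖y₀‖ ^ 2 + J)) := by
      gcongr
      have q1 : 0 ≤ (2 / α + 1) * ‖y₀‖ ^ 2 := by positivity
      have q2 : 0 ≤ (K + 1) * J := by positivity
      nlinarith
    _ = _ := by ring

end Parabolic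

/-! ### Existence for the abstract parabolic problem by Lions' projection theorem -/

section Existence

theorem intervalIntegral_congr_timeMeasure {E : Type*} [NormedAddCommGroup E] [NormedSpace ℝ E]
    {T : ℝ} {g g' : ℝ → E} (h : ∀ᵐ t ∂timeMeasure T, g t = g' t) {t : ℝ} (ht : t ∈ Icc 0 T) :
    ∫ s in (0 : ℝ)..t, g s = ∫ s in (0 : ℝ)..t, g' s := by
  rw [intervalIntegral.integral_of_le ht.1, intervalIntegral.integral_of_le ht.1]
  exact integral_congr_ae (ae_restrict_of_ae_restrict_of_subset
    (Ioc_subset_Icc_self.trans (Icc_subset_Icc_right ht.2)) h)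

theorem memLp_of_continuous_timeMeasure {E : Type*} [NormedAddCommGroup E] {T : ℝ} {χ : ℝ → E}
    (hχ : Continuous χ) : MemLp χ 2 (timeMeasure T) := by
  obtain ⟨C, hC⟩ := isCompact_Icc.exists_bound_of_continuousOn (hχ.continuousOn (s := Icc 0 T))
  refine MemLp.of_bound ?_ C ((ae_restrict_mem measurableSet_Icc).mono hC)
  exact (integrable_of_continuousOn_timeMeasure hχ.continuousOn).aestronglyMeasurable

variable {T : ℝ}
  {V : Type*} [NormedAddCommGroup V] [InnerProductSpace ℝ V]
  {H : Type*} [NormedAddCommGroup H] [InnerProductSpace ℝ H]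
  {i : V →L[ℝ] H} {M : ℝ → H →L[ℝ] H →L[ℝ] ℝ} {M' A : ℝ → V →L[ℝ] V →L[ℝ] ℝ} {K c α β : ℝ}

/-- The `C¹` functions with values in `V` that vanish at the final time `T`. -/
def finalTestSpace (T : ℝ) (V : Type*) [NormedAddCommGroup V] [InnerProductSpace ℝ V] :
    Submodule ℝ (ℝ → V) where
  carrier := {χ | ContDiff ℝ 1 χ ∧ χ T = 0}
  add_mem' := fun h h' => ⟨h.1.add h'.1, by simp [h.2, h'.2]⟩
  zero_mem' := ⟨contDiff_const, rfl⟩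
  smul_mem' := fun r _ h => ⟨contDiff_const.smul h.1, by simp [h.2]⟩

/-- The functional `v ↦ -M(v,χ') + A(v,χ) - M'(v,χ)` on `V` at time `t`; its time integral is the
weak form of the operator `v ↦ (M v)' + A v - M' v`, tested with `χ`. -/
noncomputable def testFunctional (i : V →L[ℝ] H) (M : ℝ → H →L[ℝ] H →L[ℝ] ℝ)
    (M' A : ℝ → V →L[ℝ] V →L[ℝ] ℝ) (χ : ℝ → V) (t : ℝ) : StrongDual ℝ V :=
  (A t).flip (χ t) - (M' t).flip (χ t) - ((M t).flip (i (deriv χ t))).comp i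

theorem testFunctional_apply (χ : ℝ → V) (t : ℝ) (v : V) :
    testFunctional i M M' A χ t v =
      A t v (χ t) - M' t v (χ t) - M t (i v) (i (deriv χ t)) := rfl

theorem memLp_add_apply {E : Type*} [NormedAddCommGroup E] {f g : ℝ → E}
    (hf : MemLp f 2 (timeMeasure T)) (hg : MemLp g 2 (timeMeasure T)) :
    MemLp (fun t => f t + g t) 2 (timeMeasure T) :=
  hf.add hg

theorem memLp_form_comp [CompleteSpace H] [TopologicalSpace.SeparableSpace H]
    {B : ℝ → H →L[ℝ] H →L[ℝ] ℝ}
    (hB : ∀ x y, AEMeasurable (fun t => B t x y) (timeMeasure T)) (hK : ∀ t, ‖B t‖ ≤ K)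
    {p : ℝ → H} (hp : MemLp p 2 (timeMeasure T)) (i : V →L[ℝ] H) :
    MemLp (fun t => (B t (p t)).comp i) 2 (timeMeasure T) :=
  ((ContinuousLinearMap.compL ℝ V H ℝ).flip i).comp_memLp' (memLp_form hB hK hp)

theorem abs_integral_dual_le {F : ℝ → StrongDual ℝ V} {p : ℝ → V}
    (hF : MemLp F 2 (timeMeasure T)) (hp : MemLp p 2 (timeMeasure T)) :
    |∫ t, F t (p t) ∂timeMeasure T| ≤
      (eLpNorm F 2 (timeMeasure T)).toReal * (eLpNorm p 2 (timeMeasure T)).toReal := by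
  have h1 : ‖∫ t, F t (p t) ∂timeMeasure T‖ₑ ≤
      eLpNorm F 2 (timeMeasure T) * eLpNorm p 2 (timeMeasure T) := by
    refine (enorm_integral_le_lintegral_enorm _).trans ?_
    have h2 := lintegral_enorm_mul_le (q := fun t => ‖F t‖) hF.1.norm hp.1
    rw [eLpNorm_norm] at h2
    refine le_trans (lintegral_mono fun t => ?_) h2
    rw [enorm_norm]
    exact (F t).le_opENorm _
  have h3 := ENNReal.toReal_mono (ENNReal.mul_ne_top hF.2.ne hp.2.ne) h1
  rwa [ENNReal.toReal_mul, toReal_enorm] at h3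

variable [CompleteSpace V] [TopologicalSpace.SeparableSpace V]
  [CompleteSpace H] [TopologicalSpace.SeparableSpace H]

theorem IsDifferentiableForm.memLp_productRule (h : IsDifferentiableForm T i M M' K) {χ : ℝ → V}
    (hχ : ContDiff ℝ 1 χ) :
    MemLp (fun s => (M' s).flip (χ s) + (M s (i (deriv χ s))).comp i) 2 (timeMeasure T) := by
  have h1 : MemLp χ 2 (timeMeasure T) := memLp_of_continuous_timeMeasure hχ.continuous
  have h2 : MemLp (fun t => i (deriv χ t)) 2 (timeMeasure T) :=
    memLp_of_continuous_timeMeasure (i.continuous.comp (hχ.continuous_deriv le_rfl))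
  have a : MemLp (fun s => (M' s).flip (χ s)) 2 (timeMeasure T) :=
    memLp_form (B := fun t => (M' t).flip) (fun x y => h.measurable_deriv y x)
      (fun t => (M' t).opNorm_flip.trans_le (h.norm_deriv_le t)) h1
  have b : MemLp (fun s => (M s (i (deriv χ s))).comp i) 2 (timeMeasure T) :=
    memLp_form_comp h.measurable h.norm_le h2 i
  exact memLp_add_apply a b

theorem memLp_testFunctional (h : IsParabolic T i M M' A K c α β) {χ : ℝ → V}
    (hχ : ContDiff ℝ 1 χ) : MemLp (testFunctional i M M' A χ) 2 (timeMeasure T) := by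
  have h1 : MemLp χ 2 (timeMeasure T) := memLp_of_continuous_timeMeasure hχ.continuous
  have h2 : MemLp (fun t => i (deriv χ t)) 2 (timeMeasure T) :=
    memLp_of_continuous_timeMeasure (i.continuous.comp (hχ.continuous_deriv le_rfl))
  refine ((memLp_form (B := fun t => (A t).flip) (fun x y => h.measurable_op y x)
    (fun t => (A t).opNorm_flip.trans_le (h.norm_op_le t)) h1).sub
    (memLp_form (B := fun t => (M' t).flip) (fun x y => h.measurable_deriv y x)
    (fun t => (M' t).opNorm_flip.trans_le (h.norm_deriv_le t)) h1)).sub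
    (memLp_form_comp (B := fun t => (M t).flip) (fun x y => h.measurable y x)
    (fun t => (M t).opNorm_flip.trans_le (h.norm_le t)) h2 i)

/-- Product rule for `t ↦ M(t)χ(t)` with a `C¹` function `χ`. -/
theorem IsDifferentiableForm.exists_primitive_of_contDiff (h : IsDifferentiableForm T i M M' K)
    (hT : 0 < T) {χ : ℝ → V} (hχ : ContDiff ℝ 1 χ) :
    ∃ d, ∀ᵐ t ∂timeMeasure T, (M t (i (χ t))).comp i =
      d + ∫ s in (0 : ℝ)..t, ((M' s).flip (χ s) + (M s (i (deriv χ s))).comp i) := by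
  have h1 : MemLp χ 2 (timeMeasure T) := memLp_of_continuous_timeMeasure hχ.continuous
  have h2 : MemLp (fun t => i (deriv χ t)) 2 (timeMeasure T) :=
    memLp_of_continuous_timeMeasure (i.continuous.comp (hχ.continuous_deriv le_rfl))
  have hm := memLp_form_comp h.measurable h.norm_le (i.comp_memLp' h1) i
  have hF := h.memLp_productRule hχ
  refine exists_primitive_of_apply hT (hm.integrable (by norm_num)) (hF.integrable (by norm_num))
    fun w => ?_
  obtain ⟨cw, hcw⟩ := h.primitive w
  refine ⟨cw (χ 0), ?_⟩
  filter_upwards [hcw, h.symm, ae_restrict_mem measurableSet_Icc] with t h3 h4 ht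
  have h5 := bilin_primitive_eq hT.le (h.integrable_deriv_apply w) hχ
    (ContinuousLinearMap.id ℝ (StrongDual ℝ V)) cw ht
  simp only [ContinuousLinearMap.id_apply] at h5
  rw [← h3] at h5
  simp only [ContinuousLinearMap.comp_apply] at h5 ⊢
  rw [h4, h5]
  congr 1
  refine intervalIntegral_congr_timeMeasure ?_ ht
  filter_upwards [hcw, h.symm] with s h6 h7
  rw [← h6]
  simp only [ContinuousLinearMap.comp_apply, add_apply, ContinuousLinearMap.flip_apply]
  rw [h7]

/-- The weighted energy balance for a `C¹` function that vanishes at the final time. -/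
theorem IsParabolic.exists_weighted_energy (h : IsParabolic T i M M' A K c α β) (hT : 0 < T)
    {χ : ℝ → V} (hχ : ContDiff ℝ 1 χ) (hχT : χ T = 0) (γ : ℝ) :
    ∃ e, c * ‖i (χ 0)‖ ^ 2 ≤ e ∧ e + ∫ t, Real.exp (2 * γ * t) * (M' t (χ t) (χ t) +
      2 * M t (i (χ t)) (i (deriv χ t)) + 2 * γ * M t (i (χ t)) (i (χ t))) ∂timeMeasure T = 0 := by
  have h0 : (0 : ℝ) ∈ Icc 0 T := ⟨le_rfl, hT.le⟩
  have h1T : T ∈ Icc 0 T := ⟨hT.le, le_rfl⟩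
  have h1 : MemLp χ 2 (timeMeasure T) := memLp_of_continuous_timeMeasure hχ.continuous
  have h2 : MemLp (fun t => i (deriv χ t)) 2 (timeMeasure T) :=
    memLp_of_continuous_timeMeasure (i.continuous.comp (hχ.continuous_deriv le_rfl))
  have hF := h.toIsDifferentiableForm.memLp_productRule hχ
  have hM' := memLp_form h.measurable_deriv h.norm_deriv_le h1
  obtain ⟨e, he⟩ := h.energy_identity hT h1 hF (h.exists_primitive_of_contDiff hT hχ)
  set G : ℝ → ℝ := fun s => 2 * ((M' s).flip (χ s) + (M s (i (deriv χ s))).comp i) (χ s) -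
    M' s (χ s) (χ s) with hG
  have hGi : Integrable G (timeMeasure T) :=
    ((integrable_dual_apply hF h1).const_mul 2).sub (integrable_dual_apply hM' h1)
  set E : ℝ → ℝ := fun t => e + ∫ s in (0 : ℝ)..t, G s with hE
  have hEc : ContinuousOn E (Icc 0 T) := continuousOn_primitive_timeMeasure hT.le hGi e
  have hEM : ∀ᵐ t ∂timeMeasure T, M t (i (χ t)) (i (χ t)) = E t := he
  have hET : E T = 0 := by
    have := neBot_nhds_inf_ae_timeMeasure hT h1T
    refine tendsto_nhds_unique (tendsto_of_continuousOn_timeMeasure hEc h1T) ?_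
    have hz : Tendsto (fun t => M t (i (χ t)) (i (χ t))) (𝓝 T ⊓ ae (timeMeasure T)) (𝓝 0) := by
      refine squeeze_zero_norm (fun t => abs_form_le (h.norm_le t) _ _) ?_
      have hc : Continuous fun t => K * ‖i (χ t)‖ * ‖i (χ t)‖ := by
        have := hχ.continuous
        fun_prop
      have := (hc.tendsto T).mono_left (inf_le_left : 𝓝 T ⊓ ae (timeMeasure T) ≤ 𝓝 T)
      simpa [hχT] using this
    exact hz.congr' (eventually_nhds_inf_ae hEM)
  refine ⟨e, ?_, ?_⟩
  · have := neBot_nhds_inf_ae_timeMeasure hT h0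
    have h3 := tendsto_of_continuousOn_timeMeasure hEc h0
    simp only [hE, intervalIntegral.integral_same, add_zero] at h3
    have hc : Continuous fun t => c * ‖i (χ t)‖ ^ 2 := by
      have := hχ.continuous
      fun_prop
    refine le_of_tendsto_of_tendsto
      ((hc.tendsto 0).mono_left (inf_le_left : 𝓝 0 ⊓ ae (timeMeasure T) ≤ 𝓝 0)) h3 ?_
    filter_upwards [eventually_nhds_inf_ae hEM, eventually_nhds_inf_ae h.coercive] with t h4 h5
    exact (h5 _).trans h4.le
  · let ψ : ℝ → ℝ := fun t => Real.exp (2 * γ * t)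
    have hψ : ContDiff ℝ 1 ψ := by fun_prop
    have hψd : ∀ t, deriv ψ t = 2 * γ * ψ t := fun t => by
      have h1 : HasDerivAt ψ (Real.exp (2 * γ * t) * (2 * γ * 1)) t :=
        ((hasDerivAt_id t).const_mul (2 * γ)).exp
      rw [h1.deriv]; simp only [ψ]; ring
    have hp := bilin_primitive_eq hT.le hGi hψ (ContinuousLinearMap.mul ℝ ℝ) e h1T
    rw [← integral_timeMeasure hT.le (fun s => (ContinuousLinearMap.mul ℝ ℝ) (G s) (ψ s) +
      (ContinuousLinearMap.mul ℝ ℝ) (e + ∫ r in (0 : ℝ)..s, G r) (deriv ψ s))] at hp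
    have hψ0 : ψ 0 = 1 := by simp [ψ]
    have hET' : e + ∫ s in (0 : ℝ)..T, G s = 0 := hET
    rw [hET', hψ0] at hp
    simp only [map_zero, zero_apply, ContinuousLinearMap.mul_apply', mul_one] at hp
    rw [hp]
    congr 1
    refine integral_congr_ae ?_
    filter_upwards [hEM, h.symm] with t h3 h4
    change _ = G t * ψ t + E t * deriv ψ t
    rw [hψd, ← h3]
    simp only [hG, add_apply, ContinuousLinearMap.flip_apply, ContinuousLinearMap.comp_apply]
    rw [h4 (i (deriv χ t))]
    simp only [ψ]
    ring

/-- Coercivity of the weak form: testing with `χ` and inserting `v = exp (2γt) χ` controls both the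
`L²(0,T;V)` norm of `χ` and its initial value. -/
theorem IsParabolic.exists_testFunctional_ge (h : IsParabolic T i M M' A K c α β) (hT : 0 < T) :
    ∃ γ m : ℝ, 0 ≤ γ ∧ 0 < m ∧ ∀ χ : ℝ → V, ContDiff ℝ 1 χ → χ T = 0 →
      m * (∫ t, ‖χ t‖ ^ 2 ∂timeMeasure T + ‖i (χ 0)‖ ^ 2) ≤
        ∫ t, testFunctional i M M' A χ t (Real.exp (2 * γ * t) • χ t) ∂timeMeasure T := by
  have hα := h.pos_α
  have hβ := h.nonneg_β
  have hc := h.pos_c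
  -- `β` stems from the Gårding inequality, the other term from Young's inequality for `M'(χ,χ) / 2`
  set γ : ℝ := (β + K ^ 2 / (8 * α)) / c with hγ
  have hγ0 : 0 ≤ γ := by positivity
  refine ⟨γ, min (α / 2) (c / 2), hγ0, by positivity, fun χ hχ hχT => ?_⟩
  obtain ⟨e, he1, he2⟩ := h.exists_weighted_energy hT hχ hχT γ
  have h1 : MemLp χ 2 (timeMeasure T) := memLp_of_continuous_timeMeasure hχ.continuous
  have hexp : Continuous fun t : ℝ => Real.exp (2 * γ * t) := by fun_prop
  have hmul : ∀ {g : ℝ → ℝ}, Integrable g (timeMeasure T) →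
      Integrable (fun t => Real.exp (2 * γ * t) * g t) (timeMeasure T) := fun hg =>
    integrable_bilin_timeMeasure hg hexp (ContinuousLinearMap.mul ℝ ℝ).flip
  have h2 : MemLp (fun t => i (deriv χ t)) 2 (timeMeasure T) :=
    memLp_of_continuous_timeMeasure (i.continuous.comp (hχ.continuous_deriv le_rfl))
  have hi1 : MemLp (fun t => i (χ t)) 2 (timeMeasure T) := i.comp_memLp' h1
  have hM := memLp_form h.measurable h.norm_le hi1
  have hM' := memLp_form h.measurable_deriv h.norm_deriv_le h1
  have hA := memLp_form h.measurable_op h.norm_op_le h1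
  have j1 : Integrable (fun t => M' t (χ t) (χ t)) (timeMeasure T) := integrable_dual_apply hM' h1
  have j2 : Integrable (fun t => M t (i (χ t)) (i (deriv χ t))) (timeMeasure T) :=
    integrable_dual_apply hM h2
  have j3 : Integrable (fun t => M t (i (χ t)) (i (χ t))) (timeMeasure T) :=
    integrable_dual_apply hM hi1
  have j4 : Integrable (fun t => A t (χ t) (χ t)) (timeMeasure T) := integrable_dual_apply hA h1
  have hkey : ∫ t, testFunctional i M M' A χ t (Real.exp (2 * γ * t) • χ t) ∂timeMeasure T =
      e / 2 + ∫ t, Real.exp (2 * γ * t) * (γ * M t (i (χ t)) (i (χ t)) -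
        1 / 2 * M' t (χ t) (χ t) + A t (χ t) (χ t)) ∂timeMeasure T := by
    have e1 : e = - ∫ t, Real.exp (2 * γ * t) * (M' t (χ t) (χ t) +
      2 * M t (i (χ t)) (i (deriv χ t)) + 2 * γ * M t (i (χ t)) (i (χ t))) ∂timeMeasure T := by
      linarith
    rw [e1, ← integral_neg, ← integral_div, ← integral_add]
    · refine integral_congr_ae (Eventually.of_forall fun t => ?_)
      simp only [map_smul, testFunctional_apply, smul_eq_mul]
      ring
    · exact ((hmul ((j1.add (j2.const_mul 2)).add (j3.const_mul (2 * γ)))).neg).div_const 2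
    · exact hmul (((j3.const_mul γ).sub (j1.const_mul (1 / 2))).add j4)
  have hlow : ∫ t, α / 2 * ‖χ t‖ ^ 2 ∂timeMeasure T ≤
      ∫ t, Real.exp (2 * γ * t) * (γ * M t (i (χ t)) (i (χ t)) -
        1 / 2 * M' t (χ t) (χ t) + A t (χ t) (χ t)) ∂timeMeasure T := by
    refine integral_mono_ae ((h1.integrable_norm_pow (p := 2) (by norm_num)).const_mul _)
      (hmul (((j3.const_mul γ).sub (j1.const_mul (1 / 2))).add j4)) ?_
    filter_upwards [h.coercive, h.abs_deriv_le, h.garding, ae_restrict_mem measurableSet_Icc]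
      with t h2 h3 h4 ht
    have g1 := h4 (χ t)
    have g2 := (abs_le.1 (h3 (χ t) (χ t))).2
    have g4 : (β + K ^ 2 / (8 * α)) * ‖i (χ t)‖ ^ 2 ≤ γ * M t (i (χ t)) (i (χ t)) := by
      rw [hγ, div_mul_eq_mul_div, le_div_iff₀ hc]
      have := mul_le_mul_of_nonneg_left (h2 (i (χ t)))
        (show 0 ≤ β + K ^ 2 / (8 * α) by positivity)
      linarith
    have g6 : 1 / 2 * (K * ‖i (χ t)‖ * ‖χ t‖) ≤
        α / 2 * ‖χ t‖ ^ 2 + K ^ 2 / (8 * α) * ‖i (χ t)‖ ^ 2 := by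
      have : 0 ≤ (2 * α * ‖χ t‖ - K * ‖i (χ t)‖) ^ 2 / (8 * α) := by positivity
      have e1 : (2 * α * ‖χ t‖ - K * ‖i (χ t)‖) ^ 2 / (8 * α) =
          α / 2 * ‖χ t‖ ^ 2 + K ^ 2 / (8 * α) * ‖i (χ t)‖ ^ 2 -
            1 / 2 * (K * ‖i (χ t)‖ * ‖χ t‖) := by
        field_simp; ring
      linarith
    have g7 : α / 2 * ‖χ t‖ ^ 2 ≤ γ * M t (i (χ t)) (i (χ t)) -
        1 / 2 * M' t (χ t) (χ t) + A t (χ t) (χ t) := by linarith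
    have g8 : 1 ≤ Real.exp (2 * γ * t) :=
      Real.one_le_exp (mul_nonneg (mul_nonneg zero_le_two hγ0) ht.1)
    have g9 : 0 ≤ α / 2 * ‖χ t‖ ^ 2 := by positivity
    exact g7.trans (le_mul_of_one_le_left (g9.trans g7) g8)
  rw [integral_const_mul] at hlow
  have hI : 0 ≤ ∫ t, ‖χ t‖ ^ 2 ∂timeMeasure T := integral_nonneg fun t => by positivity
  have m1 := mul_le_mul_of_nonneg_right (min_le_left (α / 2) (c / 2)) hI
  have m2 := mul_le_mul_of_nonneg_right (min_le_right (α / 2) (c / 2)) (sq_nonneg ‖i (χ 0)‖)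
  rw [hkey]
  linarith

theorem toReal_eLpNorm_sq {E : Type*} [NormedAddCommGroup E] {p : ℝ → E}
    (hp : MemLp p 2 (timeMeasure T)) :
    (eLpNorm p 2 (timeMeasure T)).toReal ^ 2 = ∫ t, ‖p t‖ ^ 2 ∂timeMeasure T := by
  have h := hp.eLpNorm_eq_integral_rpow_norm (by norm_num) (by norm_num)
  have hI : 0 ≤ ∫ t, ‖p t‖ ^ 2 ∂timeMeasure T := integral_nonneg fun t => by positivity
  simp only [ENNReal.toReal_ofNat, Real.rpow_ofNat] at h
  rw [h, ENNReal.toReal_ofReal (by positivity), ← Real.rpow_natCast, ← Real.rpow_mul hI]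
  norm_num

/-- The weak formulation of the initial value problem `(M v)' + A v - M' v = f`,
`M(0)v(0) = M(0)u₀`, with all test functions that vanish at the final time, is solvable. -/
theorem IsParabolic.exists_weak_solution (h : IsParabolic T i M M' A K c α β) (hT : 0 < T)
    {f : ℝ → StrongDual ℝ V} (hf : MemLp f 2 (timeMeasure T)) (g : StrongDual ℝ H) :
    ∃ v : ℝ → V, MemLp v 2 (timeMeasure T) ∧ ∀ χ : ℝ → V, ContDiff ℝ 1 χ → χ T = 0 →
      ∫ t, testFunctional i M M' A χ t (v t) ∂timeMeasure T =
        ∫ t, f t (χ t) ∂timeMeasure T + g (i (χ 0)) := by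
  obtain ⟨γ, m, hγ, hm, hlow⟩ := h.exists_testFunctional_ge hT
  let Φ := finalTestSpace T V
  have hk : ∀ χ : Φ, MemLp (fun t => (InnerProductSpace.toDual ℝ V).symm
      (testFunctional i M M' A χ.1 t)) 2 (timeMeasure T) := fun χ =>
    (memLp_testFunctional h χ.2.1).of_le_mul (c := 1)
      ((InnerProductSpace.toDual ℝ V).symm.continuous.comp_aestronglyMeasurable
        (memLp_testFunctional h χ.2.1).1)
      (Eventually.of_forall fun t => by rw [LinearIsometryEquiv.norm_map, one_mul])
  have hχL : ∀ χ : Φ, MemLp χ.1 2 (timeMeasure T) := fun χ =>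
    memLp_of_continuous_timeMeasure χ.2.1.continuous
  have hd : ∀ (χ : Φ) t, DifferentiableAt ℝ χ.1 t := fun χ t =>
    χ.2.1.differentiable one_ne_zero t
  let S : Φ →ₗ[ℝ] Lp V 2 (timeMeasure T) :=
    { toFun := fun χ => (hk χ).toLp _
      map_add' := fun χ χ' => by
        rw [← MemLp.toLp_add]
        refine MemLp.toLp_congr _ _ (Eventually.of_forall fun t => ?_)
        simp only [Pi.add_apply]
        rw [← map_add]
        congr 1
        ext v
        simp only [add_apply, testFunctional_apply, Submodule.coe_add, Pi.add_apply,
          deriv_add (hd χ t) (hd χ' t), map_add]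
        ring
      map_smul' := fun r χ => by
        rw [RingHom.id_apply, ← MemLp.toLp_const_smul]
        refine MemLp.toLp_congr _ _ (Eventually.of_forall fun t => ?_)
        simp only [Pi.smul_apply]
        rw [← map_smul]
        congr 1
        ext v
        simp only [smul_apply, testFunctional_apply, Submodule.coe_smul, Pi.smul_apply,
          deriv_const_smul r (hd χ t), map_smul, smul_eq_mul]
        ring }
  have hS : ∀ (χ : Φ) (v : Lp V 2 (timeMeasure T)), inner ℝ v (S χ) =
      ∫ t, testFunctional i M M' A χ.1 t (v t) ∂timeMeasure T := by
    intro χ v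
    rw [L2.inner_def]
    refine integral_congr_ae ?_
    filter_upwards [(hk χ).coeFn_toLp] with t ht
    change inner ℝ (v t) (((hk χ).toLp _ : Lp V 2 (timeMeasure T)) t) = _
    rw [ht, real_inner_comm, InnerProductSpace.toDual_symm_apply]
  have hfi : ∀ χ : Φ, Integrable (fun t => f t (χ.1 t)) (timeMeasure T) := fun χ =>
    integrable_dual_apply hf (hχL χ)
  let ℓ : Φ →ₗ[ℝ] ℝ :=
    { toFun := fun χ => ∫ t, f t (χ.1 t) ∂timeMeasure T + g (i (χ.1 0))
      map_add' := fun χ χ' => by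
        simp only [Submodule.coe_add, Pi.add_apply, map_add]
        rw [integral_add (hfi χ) (hfi χ')]
        ring
      map_smul' := fun r χ => by
        simp only [Submodule.coe_smul, Pi.smul_apply, map_smul, smul_eq_mul, RingHom.id_apply]
        rw [integral_const_mul]
        ring }
  -- boundedness of `ℓ` in terms of `S` comes from pairing `S χ` with `exp (2γt) χ`
  obtain ⟨v, hv⟩ := exists_inner_eq_of_abs_le S ℓ
    (C := ((eLpNorm f 2 (timeMeasure T)).toReal + ‖g‖) * (Real.exp (2 * γ * T) / m)) fun χ => by
    -- `a` is the `L²(0,T;V)` norm of `χ` and `b` the norm of its initial value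
    set a := (eLpNorm χ.1 2 (timeMeasure T)).toReal with ha
    set b := ‖i (χ.1 0)‖ with hb
    have ha0 : 0 ≤ a := ENNReal.toReal_nonneg
    have hb0 : 0 ≤ b := norm_nonneg _
    set s := Real.exp (2 * γ * T) / m * ‖S χ‖ with hs
    have hs0 : 0 ≤ s := by positivity
    have hexpc : Continuous fun t : ℝ => Real.exp (2 * γ * t) • χ.1 t := by
      have := χ.2.1.continuous
      fun_prop
    have hz : MemLp (fun t : ℝ => Real.exp (2 * γ * t) • χ.1 t) 2 (timeMeasure T) :=
      memLp_of_continuous_timeMeasure hexpc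
    have hzn : ‖hz.toLp _‖ ≤ Real.exp (2 * γ * T) * a := by
      have h1 : eLpNorm (fun t : ℝ => Real.exp (2 * γ * t) • χ.1 t) 2 (timeMeasure T) ≤
          ENNReal.ofReal (Real.exp (2 * γ * T)) * eLpNorm χ.1 2 (timeMeasure T) := by
        refine eLpNorm_le_mul_eLpNorm_of_ae_le_mul ?_ 2
        filter_upwards [ae_restrict_mem measurableSet_Icc] with t ht
        rw [norm_smul, Real.norm_eq_abs, abs_of_pos (Real.exp_pos _)]
        gcongr
        exact ht.2
      rw [Lp.norm_toLp]
      refine (ENNReal.toReal_mono (ENNReal.mul_ne_top ENNReal.ofReal_ne_top (hχL χ).2.ne) h1).trans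
        (le_of_eq ?_)
      rw [ENNReal.toReal_mul, ENNReal.toReal_ofReal (Real.exp_pos _).le]
    have hge : m * (a ^ 2 + b ^ 2) ≤ Real.exp (2 * γ * T) * a * ‖S χ‖ := by
      have h1 := hlow χ.1 χ.2.1 χ.2.2
      rw [← toReal_eLpNorm_sq (hχL χ)] at h1
      refine h1.trans ?_
      have h2 := (real_inner_le_norm (hz.toLp _) (S χ)).trans
        (mul_le_mul_of_nonneg_right hzn (norm_nonneg _))
      rw [hS] at h2
      refine le_trans (le_of_eq (integral_congr_ae ?_)) h2
      filter_upwards [hz.coeFn_toLp] with t ht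
      rw [ht]
    have hab : a ^ 2 + b ^ 2 ≤ s * a := by
      rw [hs, div_mul_eq_mul_div, div_mul_eq_mul_div, le_div_iff₀ hm]
      linarith
    have has : a ≤ s := by
      by_contra hlt
      push Not at hlt
      nlinarith [sq_nonneg b]
    have hbs : b ≤ s := by
      by_contra hlt
      push Not at hlt
      nlinarith [sq_nonneg a]
    have h3 := abs_integral_dual_le hf (hχL χ)
    have h4 : |g (i (χ.1 0))| ≤ ‖g‖ * b := g.le_opNorm _
    calc |ℓ χ| ≤ (eLpNorm f 2 (timeMeasure T)).toReal * a + ‖g‖ * b :=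
          (abs_add_le _ _).trans (add_le_add h3 h4)
      _ ≤ (eLpNorm f 2 (timeMeasure T)).toReal * s + ‖g‖ * s := by gcongr
      _ = _ := by rw [hs]; ring
  refine ⟨v, Lp.memLp v, fun χ h1 h2 => ?_⟩
  rw [← hS ⟨χ, h1, h2⟩ v, hv]
  rfl

/-- Existence: there is `v` such that `M v` is the primitive of `f - A v + M' v` with initial value
`g`. -/
theorem IsParabolic.exists_solution (h : IsParabolic T i M M' A K c α β) (hT : 0 < T)
    {f : ℝ → StrongDual ℝ V} (hf : MemLp f 2 (timeMeasure T)) (g : StrongDual ℝ H) :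
    ∃ v : ℝ → V, MemLp v 2 (timeMeasure T) ∧ ∀ᵐ t ∂timeMeasure T,
      (M t (i (v t))).comp i =
        g.comp i + ∫ s in (0 : ℝ)..t, (f s - A s (v s) + M' s (v s)) := by
  obtain ⟨v, hv, hw⟩ := h.exists_weak_solution hT hf g
  refine ⟨v, hv, ?_⟩
  have h1T : T ∈ Icc 0 T := ⟨hT.le, le_rfl⟩
  set F : ℝ → StrongDual ℝ V := fun s => f s - A s (v s) + M' s (v s) with hFdef
  have hF : MemLp F 2 (timeMeasure T) := (hf.sub (memLp_form h.measurable_op h.norm_op_le hv)).add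
    (memLp_form h.measurable_deriv h.norm_deriv_le hv)
  set m : ℝ → StrongDual ℝ V := fun t => (M t (i (v t))).comp i with hmdef
  have hm : MemLp m 2 (timeMeasure T) :=
    memLp_form_comp h.measurable h.norm_le (i.comp_memLp' hv) i
  have hFi : Integrable F (timeMeasure T) := hF.integrable (by norm_num)
  have hmi : Integrable m (timeMeasure T) := hm.integrable (by norm_num)
  have hid : ∀ χ : ℝ → V, ContDiff ℝ 1 χ → χ T = 0 →
      ∫ t, F t (χ t) ∂timeMeasure T + ∫ t, m t (deriv χ t) ∂timeMeasure T = - g (i (χ 0)) := by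
    intro χ h1 h2
    have hχ : MemLp χ 2 (timeMeasure T) := memLp_of_continuous_timeMeasure h1.continuous
    have hχ' : MemLp (deriv χ) 2 (timeMeasure T) :=
      memLp_of_continuous_timeMeasure (h1.continuous_deriv le_rfl)
    have h3 := hw χ h1 h2
    have h4 : ∫ t, testFunctional i M M' A χ t (v t) ∂timeMeasure T =
        ∫ t, f t (χ t) ∂timeMeasure T - (∫ t, F t (χ t) ∂timeMeasure T +
          ∫ t, m t (deriv χ t) ∂timeMeasure T) := by
      have hs : Integrable (fun t => F t (χ t) + m t (deriv χ t)) (timeMeasure T) :=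
        (integrable_dual_apply hF hχ).add (integrable_dual_apply hm hχ')
      rw [← integral_add (integrable_dual_apply hF hχ) (integrable_dual_apply hm hχ'),
        ← integral_sub (integrable_dual_apply hf hχ) hs]
      refine integral_congr_ae (Eventually.of_forall fun t => ?_)
      simp only [testFunctional_apply, hFdef, hmdef, add_apply, sub_apply,
        ContinuousLinearMap.comp_apply]
      ring
    linarith
  have hwd : HasWeakDeriv T m F := by
    refine ⟨hmi, hFi, fun ζ hζ => ?_⟩
    ext w
    have hζ' := hζ.contDiff_one.continuous_deriv le_rfl
    have h1 := hid (fun t => ζ t • w) (hζ.smul_const w).contDiff_one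
      ((hζ.smul_const w).eq_zero (by simp))
    have h2 : deriv (fun t => ζ t • w) = fun t => deriv ζ t • w := funext fun t =>
      deriv_smul_const (hζ.contDiff_one.differentiable one_ne_zero t) w
    rw [h2, (hζ.smul_const w).eq_zero (by simp), map_zero, map_zero, neg_zero] at h1
    rw [neg_apply, ContinuousLinearMap.integral_apply (integrable_smul_timeMeasure hζ' hmi),
      ContinuousLinearMap.integral_apply (integrable_smul_timeMeasure hζ.1.continuous hFi)]
    simp only [map_smul, smul_apply] at h1 ⊢
    linarith
  obtain ⟨d, hd⟩ := hwd.exists_primitive hT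
  suffices hdg : d = g.comp i by rw [← hdg]; exact hd
  -- the initial value is read off from the test function `(T - t) w`
  ext w
  have hχ : ContDiff ℝ 1 (fun t : ℝ => (T - t) • w) := by fun_prop
  have h1 := hid _ hχ (by simp)
  have h2 := bilin_primitive_eq hT.le hFi hχ (ContinuousLinearMap.id ℝ (StrongDual ℝ V)) d h1T
  rw [← integral_timeMeasure hT.le (fun s => (ContinuousLinearMap.id ℝ (StrongDual ℝ V)) (F s)
    ((T - s) • w) + (ContinuousLinearMap.id ℝ (StrongDual ℝ V)) (d + ∫ r in (0 : ℝ)..s, F r)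
    (deriv (fun t : ℝ => (T - t) • w) s))] at h2
  have h3 : ∫ s, ((ContinuousLinearMap.id ℝ (StrongDual ℝ V)) (F s)
      ((T - s) • w) + (ContinuousLinearMap.id ℝ (StrongDual ℝ V)) (d + ∫ r in (0 : ℝ)..s, F r)
      (deriv (fun t : ℝ => (T - t) • w) s)) ∂timeMeasure T =
      ∫ t, F t ((T - t) • w) ∂timeMeasure T +
        ∫ t, m t (deriv (fun t : ℝ => (T - t) • w) t) ∂timeMeasure T := by
    rw [← integral_add (integrable_dual_apply hF (memLp_of_continuous_timeMeasure hχ.continuous))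
      (integrable_dual_apply hm (memLp_of_continuous_timeMeasure (hχ.continuous_deriv le_rfl)))]
    refine integral_congr_ae (hd.mono fun t ht => ?_)
    simp only [ContinuousLinearMap.id_apply]
    rw [ht]
  rw [h3, h1] at h2
  simp only [sub_self, zero_smul, map_zero, sub_zero, ContinuousLinearMap.id_apply, map_smul,
    smul_eq_mul] at h2
  rw [ContinuousLinearMap.comp_apply]
  have h4 : T * (d w - g (i w)) = 0 := by linarith
  exact sub_eq_zero.1 ((mul_eq_zero.1 h4).resolve_left hT.ne')

end Existence

namespace EvolvingPair

/-! ### The inner products of the evolving spaces, pulled back to time zero -/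

section InnerProduct

universe u v

variable {T : ℝ} {H : ℝ → Type u} {V : ℝ → Type v}
  [∀ t, NormedAddCommGroup (H t)] [∀ t, InnerProductSpace ℝ (H t)]
  [∀ t, NormedAddCommGroup (V t)] [∀ t, InnerProductSpace ℝ (V t)]
  {S : EvolvingPair T H V}

theorem bHat_eq_polarization (t : ℝ) (x y : H 0) :
    S.bHat t x y = (‖S.φH t (x + y)‖ ^ 2 - ‖S.φH t (x - y)‖ ^ 2) / 4 := by
  rw [bHat, map_add, map_sub, norm_add_sq_real, norm_sub_sq_real]
  ring

theorem DifferentiableNorm.differentiableOn_bHat (hn : S.DifferentiableNorm) (x y : H 0) :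
    DifferentiableOn ℝ (fun s => S.bHat s x y) (Icc 0 T) := by
  simp only [bHat_eq_polarization]
  exact ((hn.differentiable _).sub (hn.differentiable _)).div_const 4

theorem DifferentiableNorm.hasDerivWithinAt_bHat (hn : S.DifferentiableNorm) (x y : H 0) {t : ℝ}
    (ht : t ∈ Icc 0 T) :
    HasDerivWithinAt (fun s => S.bHat s x y) (S.lambdaHat t x y) (Icc 0 T) t :=
  (hn.differentiableOn_bHat x y t ht).hasDerivWithinAt

theorem lambdaHat_eq (hT : 0 < T) {t : ℝ}
    (ht : t ∈ Icc 0 T) {x y : H 0} {d : ℝ}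
    (hd : HasDerivWithinAt (fun s => S.bHat s x y) d (Icc 0 T) t) : S.lambdaHat t x y = d :=
  hd.derivWithin (uniqueDiffOn_Icc hT t ht)

theorem DifferentiableNorm.lambdaHat_add_left (hn : S.DifferentiableNorm) (hT : 0 < T) {t : ℝ}
    (ht : t ∈ Icc 0 T) (x x' y : H 0) :
    S.lambdaHat t (x + x') y = S.lambdaHat t x y + S.lambdaHat t x' y := by
  refine lambdaHat_eq hT ht
    (((hn.hasDerivWithinAt_bHat x y ht).add (hn.hasDerivWithinAt_bHat x' y ht)).congr_of_mem
      (fun s _ => ?_) ht)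
  simp only [bHat, Pi.add_apply, map_add, inner_add_left]

theorem DifferentiableNorm.lambdaHat_smul_left (hn : S.DifferentiableNorm) (hT : 0 < T) {t : ℝ}
    (ht : t ∈ Icc 0 T) (c : ℝ) (x y : H 0) :
    S.lambdaHat t (c • x) y = c * S.lambdaHat t x y := by
  refine lambdaHat_eq hT ht
    (((hn.hasDerivWithinAt_bHat x y ht).const_mul c).congr_of_mem (fun s _ => ?_) ht)
  simp only [bHat, map_smul, real_inner_smul_left]

theorem lambdaHat_comm (t : ℝ) (x y : H 0) : S.lambdaHat t x y = S.lambdaHat t y x := by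
  simp only [lambdaHat, bHat, real_inner_comm]

theorem DifferentiableNorm.exists_abs_lambdaHat_le (hn : S.DifferentiableNorm) (hT : 0 < T) :
    ∃ C, 0 ≤ C ∧ ∀ t ∈ Icc 0 T, ∀ x y : H 0, |S.lambdaHat t x y| ≤ C * ‖x‖ * ‖y‖ := by
  obtain ⟨C, hC⟩ := hn.bounded
  refine ⟨max C 0 / 4, by positivity, fun t ht x y => ?_⟩
  have h1 : S.lambdaHat t x y = (S.theta t (x + y) - S.theta t (x - y)) / 4 := by
    refine lambdaHat_eq hT ht ?_
    simp only [bHat_eq_polarization]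
    exact ((hn.differentiable _ t ht).hasDerivWithinAt.sub
      (hn.differentiable _ t ht).hasDerivWithinAt).div_const 4
  rw [h1, abs_div, abs_of_pos (by norm_num : (0 : ℝ) < 4), div_mul_eq_mul_div, div_mul_eq_mul_div]
  refine div_le_div_of_nonneg_right ((hC t ht x y).trans ?_) (by norm_num)
  gcongr
  exact le_max_left _ _

theorem aemeasurable_lambdaHat (x y : H 0) :
    AEMeasurable (fun t => S.lambdaHat t x y) (timeMeasure T) := by
  refine (measurable_deriv (fun s => S.bHat s x y)).aemeasurable.congr ?_
  have h2 : timeMeasure T = volume.restrict (Ioo 0 T) :=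
    (Measure.restrict_congr_set Ioo_ae_eq_Icc).symm
  rw [h2]
  filter_upwards [ae_restrict_mem measurableSet_Ioo] with t ht
  exact (derivWithin_of_mem_nhds (Icc_mem_nhds ht.1 ht.2)).symm

/-- The forms `λ̂(t)` are almost always given by uniformly bounded continuous bilinear forms. -/
theorem DifferentiableNorm.exists_lambdaForm (hn : S.DifferentiableNorm) (hT : 0 < T) :
    ∃ (K : ℝ) (l : ℝ → H 0 →L[ℝ] H 0 →L[ℝ] ℝ), 0 ≤ K ∧ (∀ t, ‖l t‖ ≤ K) ∧
      (∀ x y, AEMeasurable (fun t => l t x y) (timeMeasure T)) ∧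
      ∀ᵐ t ∂timeMeasure T, ∀ x y, l t x y = S.lambdaHat t x y := by
  obtain ⟨K, hK, hb⟩ := hn.exists_abs_lambdaHat_le hT
  obtain ⟨l, h1, h2⟩ := exists_form_of_ae (a := S.lambdaHat) (μ := timeMeasure T) hK (by
    filter_upwards [ae_restrict_mem measurableSet_Icc] with t ht
    refine ⟨hn.lambdaHat_add_left hT ht, hn.lambdaHat_smul_left hT ht, fun x y y' => ?_,
      fun c x y => ?_, hb t ht⟩
    · rw [lambdaHat_comm, hn.lambdaHat_add_left hT ht, lambdaHat_comm t y, lambdaHat_comm t y']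
    · rw [lambdaHat_comm, hn.lambdaHat_smul_left hT ht, lambdaHat_comm t y])
  exact ⟨K, l, hK, h1, fun x y => (aemeasurable_lambdaHat x y).congr
    (h2.mono fun t ht => (ht x y).symm), h2⟩

/-- The bounded derivative `λ̂` integrates to `b̂`. -/
theorem DifferentiableNorm.bHat_eq_primitive (hn : S.DifferentiableNorm) (hT : 0 < T) (x y : H 0)
    {t : ℝ} (ht : t ∈ Icc 0 T) :
    S.bHat t x y = S.bHat 0 x y + ∫ s in (0 : ℝ)..t, S.lambdaHat s x y := by
  obtain ⟨K, hK, hb⟩ := hn.exists_abs_lambdaHat_le hT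
  have hi : Integrable (fun s => S.lambdaHat s x y) (timeMeasure T) :=
    Integrable.of_bound (aemeasurable_lambdaHat x y).aestronglyMeasurable (K * ‖x‖ * ‖y‖)
      ((ae_restrict_mem measurableSet_Icc).mono fun s hs => hb s hs x y)
  have hsub : Icc 0 t ⊆ Icc 0 T := Icc_subset_Icc_right ht.2
  rw [intervalIntegral.integral_eq_sub_of_hasDerivAt_of_le ht.1
    ((hn.differentiableOn_bHat x y).continuousOn.mono hsub)
    (fun s hs => (hn.hasDerivWithinAt_bHat x y (hsub (Ioo_subset_Icc_self hs))).hasDerivAt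
      (Icc_mem_nhds hs.1 (hs.2.trans_le ht.2)))
    (intervalIntegrable_of_timeMeasure hi ⟨le_rfl, hT.le⟩ ht)]
  ring

/-- A common bound for the operators `φₜ` and their inverses on both scales of spaces. -/
theorem exists_bound (T : ℝ) (S : EvolvingPair T H V) : ∃ C : ℝ, 1 ≤ C ∧ ∀ t ∈ Icc 0 T,
    (∀ x, ‖S.φH t x‖ ≤ C * ‖x‖) ∧ (∀ x, ‖(S.φH t).symm x‖ ≤ C * ‖x‖) ∧
    (∀ x, ‖S.φV t x‖ ≤ C * ‖x‖) ∧ ∀ x, ‖(S.φV t).symm x‖ ≤ C * ‖x‖ := by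
  obtain ⟨C, hC⟩ := S.compatibleH.bounded
  obtain ⟨D, hD⟩ := S.compatibleV.bounded
  refine ⟨max 1 (max C D), le_max_left _ _, fun t ht => ⟨fun x => ?_, fun x => ?_, fun x => ?_,
    fun x => ?_⟩⟩
  · exact ((hC t ht).1 x).trans (by gcongr; simp)
  · exact ((hC t ht).2 x).trans (by gcongr; simp)
  · exact ((hD t ht).1 x).trans (by gcongr; simp)
  · exact ((hD t ht).2 x).trans (by gcongr; simp)

/-- The forms `b̂(t)` are almost always given by uniformly bounded continuous bilinear forms. -/
theorem DifferentiableNorm.exists_bForm (hn : S.DifferentiableNorm) :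
    ∃ (K : ℝ) (b : ℝ → H 0 →L[ℝ] H 0 →L[ℝ] ℝ), (∀ t, ‖b t‖ ≤ K) ∧
      (∀ x y, AEMeasurable (fun t => b t x y) (timeMeasure T)) ∧
      ∀ᵐ t ∂timeMeasure T, ∀ x y, b t x y = S.bHat t x y := by
  obtain ⟨C, hC1, hC⟩ := S.exists_bound T
  obtain ⟨b, hb, hbe⟩ := exists_form_of_ae (a := S.bHat) (μ := timeMeasure T) (K := C * C)
    (by positivity) (by
    filter_upwards [ae_restrict_mem measurableSet_Icc] with t ht
    refine ⟨fun x x' y => ?_, fun c x y => ?_, fun x y y' => ?_, fun c x y => ?_, fun x y => ?_⟩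
    · simp only [bHat, map_add, inner_add_left]
    · simp only [bHat, map_smul, real_inner_smul_left]
    · simp only [bHat, map_add, inner_add_right]
    · simp only [bHat, map_smul, real_inner_smul_right]
    · refine (abs_real_inner_le_norm _ _).trans ?_
      have := mul_le_mul ((hC t ht).1 x) ((hC t ht).1 y) (norm_nonneg _) (by positivity)
      linarith)
  exact ⟨C * C, b, hb, fun x y => ((integrable_of_continuousOn_timeMeasure
    (hn.differentiableOn_bHat x y).continuousOn).aestronglyMeasurable.aemeasurable).congr
      (hbe.mono fun t ht => (ht x y).symm), hbe⟩

theorem memL2_const_pullback {X : ℝ → Type u} [∀ t, NormedAddCommGroup (X t)]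
    [∀ t, InnerProductSpace ℝ (X t)] (φ : ∀ t, X 0 ≃L[ℝ] X t) (x : X 0) :
    MemL2 T φ (fun t => φ t x) := by
  simp only [MemL2, ContinuousLinearEquiv.symm_apply_apply]
  exact memLp_const x

/-- Functions with constant pullback have zero material derivative. -/
theorem DifferentiableNorm.isMaterialDeriv_const (hn : S.DifferentiableNorm) (hT : 0 < T)
    [CompleteSpace (H 0)] [TopologicalSpace.SeparableSpace (H 0)] (x : V 0) :
    S.IsMaterialDeriv (fun t => S.φV t x) (fun _ => 0) := by
  refine ⟨memL2_const_pullback _ x, ?_, fun ψ hψ => ?_⟩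
  · simp only [MemL2Dual, ContinuousLinearMap.zero_comp]
    exact memLp_const (0 : StrongDual ℝ (V 0))
  obtain ⟨K, l, hK, hl, hlm, hle⟩ := hn.exists_lambdaForm hT
  obtain ⟨Kb, b, hb, hbm, hbe⟩ := hn.exists_bForm
  set h := S.ι 0 x with hh
  have hli : Integrable (fun t => l t h) (timeMeasure T) :=
    (memLp_form hlm hl (memLp_const h)).integrable (by norm_num)
  obtain ⟨c, hc⟩ := exists_primitive_of_apply (m := fun t => b t h) (F := fun t => l t h) hT
    ((memLp_form hbm hb (memLp_const h)).integrable (by norm_num)) hli (fun w => by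
      refine ⟨S.bHat 0 h w, ?_⟩
      filter_upwards [hbe, ae_restrict_mem measurableSet_Icc] with t h1 ht
      rw [h1, hn.bHat_eq_primitive hT h w ht]
      congr 1
      exact intervalIntegral_congr_timeMeasure (hle.mono fun s hs => (hs h w).symm) ht)
  have hχ : ContDiff ℝ 1 (fun t => S.ι 0 (ψ t)) := (S.ι 0).contDiff.comp hψ.contDiff_one
  have hχ' : deriv (fun t => S.ι 0 (ψ t)) = fun t => S.ι 0 (deriv ψ t) := funext fun t =>
    ((S.ι 0).hasFDerivAt.comp_hasDerivAt t
      (hψ.contDiff_one.differentiable one_ne_zero t).hasDerivAt).deriv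
  have h1 := bilin_primitive_eq hT.le hli hχ (ContinuousLinearMap.id ℝ (StrongDual ℝ (H 0))) c
    (t := T) ⟨hT.le, le_rfl⟩
  rw [← integral_timeMeasure hT.le (fun s => (ContinuousLinearMap.id ℝ (StrongDual ℝ (H 0)))
    (l s h) (S.ι 0 (ψ s)) + (ContinuousLinearMap.id ℝ (StrongDual ℝ (H 0)))
    (c + ∫ r in (0 : ℝ)..s, l r h) (deriv (fun t => S.ι 0 (ψ t)) s)), hχ',
    hψ.eq_zero (by simp), hψ.eq_zero (by simp)] at h1
  simp only [map_zero, zero_add, ContinuousLinearMap.id_apply] at h1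
  have hψL : MemLp (fun t => S.ι 0 (ψ t)) 2 (timeMeasure T) :=
    memLp_of_continuous_timeMeasure hχ.continuous
  have hψL' : MemLp (fun t => S.ι 0 (deriv ψ t)) 2 (timeMeasure T) :=
    memLp_of_continuous_timeMeasure
      ((S.ι 0).continuous.comp (hψ.contDiff_one.continuous_deriv le_rfl))
  have e1 : ∫ t, inner ℝ (S.ι t (S.φV t x)) (S.ι t (S.φV t (deriv ψ t))) ∂timeMeasure T =
      ∫ t, b t h (S.ι 0 (deriv ψ t)) ∂timeMeasure T := by
    refine integral_congr_ae ?_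
    filter_upwards [hbe, ae_restrict_mem measurableSet_Icc] with t h2 ht
    rw [h2, S.restrict t ht, S.restrict t ht, bHat]
  have e2 : ∫ t, S.lambda t (S.ι t (S.φV t x)) (S.ι t (S.φV t (ψ t))) ∂timeMeasure T =
      ∫ t, l t h (S.ι 0 (ψ t)) ∂timeMeasure T := by
    refine integral_congr_ae ?_
    filter_upwards [hle, ae_restrict_mem measurableSet_Icc] with t h2 ht
    rw [h2, S.restrict t ht, S.restrict t ht, lambda, ContinuousLinearEquiv.symm_apply_apply,
      ContinuousLinearEquiv.symm_apply_apply]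
  have e3 : ∫ t, (l t h (S.ι 0 (ψ t)) + b t h (S.ι 0 (deriv ψ t))) ∂timeMeasure T = 0 := by
    refine (integral_congr_ae (hc.mono fun t ht => ?_)).trans h1.symm
    simp only [ht]
  rw [integral_add (integrable_dual_apply (memLp_form hlm hl (memLp_const h)) hψL)
    (integrable_dual_apply (memLp_form hbm hb (memLp_const h)) hψL')] at e3
  rw [e1, e2]
  simp only [zero_apply, integral_zero]
  linarith

end InnerProduct

/-! ### The parabolic problem on the fixed spaces -/

section Pullback

universe u v

variable {T : ℝ} {H : ℝ → Type u} {V : ℝ → Type v}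
  [∀ t, NormedAddCommGroup (H t)] [∀ t, InnerProductSpace ℝ (H t)]
  [∀ t, NormedAddCommGroup (V t)] [∀ t, InnerProductSpace ℝ (V t)]
  {S : EvolvingPair T H V}
  {L : ∀ t, StrongDual ℝ (V t) →ₗ[ℝ] StrongDual ℝ (V t)}
  {LH : ∀ t, H t →ₗ[ℝ] H t} {LV : ∀ t, V t →ₗ[ℝ] V t}
  {Ldot A : ∀ t, V t →ₗ[ℝ] StrongDual ℝ (V t)}

/-- The pullback `(L(t) φₜ x, φₜ y)_{H(t)}` of the operators `L(t)` on `H(t)`. -/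
theorem LAssumptions.exists_massForm (hL : S.LAssumptions L LH LV Ldot)
    (hn : S.DifferentiableNorm) [CompleteSpace (H 0)] [TopologicalSpace.SeparableSpace (H 0)] :
    ∃ (K c : ℝ) (M : ℝ → H 0 →L[ℝ] H 0 →L[ℝ] ℝ), 0 < c ∧ (∀ t, ‖M t‖ ≤ K) ∧
      (∀ x y, AEMeasurable (fun t => M t x y) (timeMeasure T)) ∧
      (∀ᵐ t ∂timeMeasure T, ∀ x y, M t x y = M t y x) ∧
      (∀ᵐ t ∂timeMeasure T, ∀ x, c * ‖x‖ ^ 2 ≤ M t x x) ∧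
      ∀ᵐ t ∂timeMeasure T, ∀ x y, M t x y = inner ℝ (LH t (S.φH t x)) (S.φH t y) := by
  obtain ⟨C, hC1, hC⟩ := S.exists_bound T
  obtain ⟨C₃, hC₃, h3⟩ := hL.L3
  obtain ⟨C₄, hC₄, h4⟩ := hL.L4
  obtain ⟨Kb, b, hb, hbm, hbe⟩ := hn.exists_bForm
  obtain ⟨M, hM, hMe⟩ := exists_form_of_ae
    (a := fun t (x y : H 0) => inner ℝ (LH t (S.φH t x)) (S.φH t y))
    (μ := timeMeasure T) (K := C₃ * C * C) (by positivity) (by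
    filter_upwards [ae_restrict_mem measurableSet_Icc, h3] with t ht h3
    refine ⟨fun x x' y => ?_, fun c x y => ?_, fun x y y' => ?_, fun c x y => ?_, fun x y => ?_⟩
    · simp only [map_add, inner_add_left]
    · simp only [map_smul, real_inner_smul_left]
    · simp only [map_add, inner_add_right]
    · simp only [map_smul, real_inner_smul_right]
    · refine (abs_real_inner_le_norm _ _).trans ?_
      have h5 : ‖LH t (S.φH t x)‖ ≤ C₃ * (C * ‖x‖) :=
        (h3 _).trans (mul_le_mul_of_nonneg_left ((hC t ht).1 x) hC₃.le)
      have := mul_le_mul h5 ((hC t ht).1 y) (norm_nonneg _) (by positivity)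
      linarith)
  refine ⟨C₃ * C * C, C₄ / C ^ 2, M, by positivity, hM, fun x y => ?_, ?_, ?_, hMe⟩
  · have hp : MemLp (fun t => (S.φH t).symm (LH t (S.φH t x))) 2 (timeMeasure T) :=
      hL.memL2H _ (memL2_const_pullback S.φH x)
    refine (aemeasurable_form_apply hbm hp.1
      (aestronglyMeasurable_const (b := y))).congr ?_
    filter_upwards [hbe, hMe] with t h5 h6
    rw [h5, h6, bHat, ContinuousLinearEquiv.apply_symm_apply]
  · filter_upwards [hMe, hL.symmetric] with t h5 h6 x y
    rw [h5, h5, h6, real_inner_comm]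
  · filter_upwards [hMe, h4, ae_restrict_mem measurableSet_Icc] with t h5 h6 ht x
    rw [h5]
    refine le_trans ?_ (h6 _)
    have h7 : ‖x‖ ≤ C * ‖S.φH t x‖ := by simpa using (hC t ht).2.1 (S.φH t x)
    rw [div_mul_eq_mul_div, div_le_iff₀ (by positivity), mul_assoc]
    refine mul_le_mul_of_nonneg_left ?_ hC₄.le
    have := pow_le_pow_left₀ (norm_nonneg x) h7 2
    linarith [mul_pow C ‖S.φH t x‖ 2]

/-- The pullback of `L̇(t)`, with the additional term that the time derivative of the inner products
contributes to the derivative of `(L(t) φₜ x, φₜ y)_{H(t)}`. -/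
theorem LAssumptions.exists_massForm_deriv (hL : S.LAssumptions L LH LV Ldot) (hT : 0 < T)
    (hn : S.DifferentiableNorm) [CompleteSpace (H 0)] [TopologicalSpace.SeparableSpace (H 0)] :
    ∃ (K : ℝ) (M' : ℝ → V 0 →L[ℝ] V 0 →L[ℝ] ℝ), 0 ≤ K ∧ (∀ t, ‖M' t‖ ≤ K) ∧
      (∀ x y, AEMeasurable (fun t => M' t x y) (timeMeasure T)) ∧
      (∀ᵐ t ∂timeMeasure T, ∀ x y, |M' t x y| ≤ K * ‖S.ι 0 x‖ * ‖y‖) ∧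
      ∀ᵐ t ∂timeMeasure T, ∀ x y, M' t x y = Ldot t (S.φV t x) (S.φV t y) +
        S.lambdaHat t ((S.φH t).symm (LH t (S.φH t (S.ι 0 x)))) (S.ι 0 y) := by
  obtain ⟨C, hC1, hC⟩ := S.exists_bound T
  obtain ⟨C₃, hC₃, h3⟩ := hL.L3
  obtain ⟨C₅, hC₅, h5⟩ := hL.L8
  obtain ⟨Kl, l, hKl, hl, hlm, hle⟩ := hn.exists_lambdaForm hT
  set K₁ : ℝ := C₅ * C * C + Kl * C * C₃ * C * ‖S.ι 0‖ with hK₁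
  have hK₁0 : 0 ≤ K₁ := by positivity
  have hbd : ∀ᵐ t ∂timeMeasure T, ∀ x y : V 0, |Ldot t (S.φV t x) (S.φV t y) +
        S.lambdaHat t ((S.φH t).symm (LH t (S.φH t (S.ι 0 x)))) (S.ι 0 y)| ≤
        K₁ * ‖S.ι 0 x‖ * ‖y‖ := by
    filter_upwards [ae_restrict_mem measurableSet_Icc, h3, h5, hle] with t ht h3 h5 hle x y
    rw [← hle]
    refine (abs_add_le _ _).trans ?_
    have e1 : |Ldot t (S.φV t x) (S.φV t y)| ≤ C₅ * (C * ‖S.ι 0 x‖) * (C * ‖y‖) := by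
      refine ((Ldot t (S.φV t x)).le_opNorm _).trans ?_
      refine mul_le_mul ((h5 _).trans ?_) ((hC t ht).2.2.1 y) (norm_nonneg _) (by positivity)
      rw [S.restrict t ht]
      exact mul_le_mul_of_nonneg_left ((hC t ht).1 _) hC₅.le
    have e2 : ‖(S.φH t).symm (LH t (S.φH t (S.ι 0 x)))‖ ≤ C * (C₃ * (C * ‖S.ι 0 x‖)) :=
      ((hC t ht).2.1 _).trans (mul_le_mul_of_nonneg_left ((h3 _).trans
        (mul_le_mul_of_nonneg_left ((hC t ht).1 _) hC₃.le)) (by positivity))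
    have e3 := (abs_form_le (hl t) ((S.φH t).symm (LH t (S.φH t (S.ι 0 x)))) (S.ι 0 y)).trans
      (mul_le_mul (mul_le_mul_of_nonneg_left e2 hKl) ((S.ι 0).le_opNorm y) (norm_nonneg _)
        (by positivity))
    refine (add_le_add e1 e3).trans (le_of_eq ?_)
    rw [hK₁]; ring
  obtain ⟨M', hM', hMe⟩ := exists_form_of_ae (a := fun t (x y : V 0) =>
      Ldot t (S.φV t x) (S.φV t y) +
        S.lambdaHat t ((S.φH t).symm (LH t (S.φH t (S.ι 0 x)))) (S.ι 0 y))
    (μ := timeMeasure T) (K := K₁ * ‖S.ι 0‖) (by positivity) (by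
    filter_upwards [hbd, hle] with t hbd hle
    refine ⟨fun x x' y => ?_, fun c x y => ?_, fun x y y' => ?_, fun c x y => ?_, fun x y => ?_⟩
    · simp only [← hle, map_add, add_apply]; ring
    · simp only [← hle, map_smul, smul_apply, smul_eq_mul]; ring
    · simp only [← hle, map_add]; ring
    · simp only [← hle, map_smul, smul_eq_mul]; ring
    · refine (hbd x y).trans ?_
      have := mul_le_mul_of_nonneg_right
        (mul_le_mul_of_nonneg_left ((S.ι 0).le_opNorm x) hK₁0) (norm_nonneg y)
      linarith)
  have hK0 : 0 ≤ K₁ * ‖S.ι 0‖ := by positivity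
  refine ⟨K₁ + K₁ * ‖S.ι 0‖, M', by positivity, fun t => (hM' t).trans (by linarith),
    fun x y => ?_, ?_, hMe⟩
  · have hp : MemLp (fun t => (S.φH t).symm (LH t (S.φH t (S.ι 0 x)))) 2 (timeMeasure T) :=
      hL.memL2H _ (memL2_const_pullback S.φH (S.ι 0 x))
    have hq : MemLp (fun t => (Ldot t (S.φV t x)).comp (S.φV t : V 0 →L[ℝ] V t)) 2
        (timeMeasure T) := hL.Ldot_mem _ (memL2_const_pullback S.φV x)
    refine ((aestronglyMeasurable_dual_apply hq.1
      (aestronglyMeasurable_const (b := y))).aemeasurable.add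
      (aemeasurable_form_apply hlm hp.1 (aestronglyMeasurable_const (b := S.ι 0 y)))).congr ?_
    filter_upwards [hMe, hle] with t h6 h7
    rw [h6, ← h7]
    rfl
  · filter_upwards [hMe, hbd] with t h6 h7 x y
    rw [h6]
    refine (h7 x y).trans ?_
    gcongr
    linarith

/-- The pullback of `A(t) + Λ(t)`. -/
theorem AAssumptions.exists_form (hA : S.AAssumptions A) (hT : 0 < T) (hn : S.DifferentiableNorm) :
    ∃ (K α β : ℝ) (B : ℝ → V 0 →L[ℝ] V 0 →L[ℝ] ℝ), 0 < α ∧ 0 ≤ β ∧ (∀ t, ‖B t‖ ≤ K) ∧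
      (∀ x y, AEMeasurable (fun t => B t x y) (timeMeasure T)) ∧
      (∀ᵐ t ∂timeMeasure T, ∀ x, α * ‖x‖ ^ 2 - β * ‖S.ι 0 x‖ ^ 2 ≤ B t x x) ∧
      ∀ᵐ t ∂timeMeasure T, ∀ x y, B t x y = A t (S.φV t x) (S.φV t y) +
        S.lambdaHat t (S.ι 0 x) (S.ι 0 y) := by
  obtain ⟨C, hC1, hC⟩ := S.exists_bound T
  obtain ⟨C₁, C₂, hC₁, hC₂, h1⟩ := hA.A1
  obtain ⟨C₃, hC₃, h2⟩ := hA.A2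
  obtain ⟨Kl, l, hKl, hl, hlm, hle⟩ := hn.exists_lambdaForm hT
  obtain ⟨B, hB, hBe⟩ := exists_form_of_ae (a := fun t (x y : V 0) =>
      A t (S.φV t x) (S.φV t y) + S.lambdaHat t (S.ι 0 x) (S.ι 0 y))
    (μ := timeMeasure T) (K := C₃ * C * C + Kl * ‖S.ι 0‖ * ‖S.ι 0‖) (by positivity) (by
    filter_upwards [ae_restrict_mem measurableSet_Icc, hle, h2] with t ht hle h2
    refine ⟨fun x x' y => ?_, fun c x y => ?_, fun x y y' => ?_, fun c x y => ?_, fun x y => ?_⟩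
    · simp only [← hle, map_add, add_apply]; ring
    · simp only [← hle, map_smul, smul_apply, smul_eq_mul]; ring
    · simp only [← hle, map_add]; ring
    · simp only [← hle, map_smul, smul_eq_mul]; ring
    · rw [← hle]
      have e1 : |A t (S.φV t x) (S.φV t y)| ≤ C₃ * (C * ‖x‖) * (C * ‖y‖) :=
        (h2 _ _).trans (mul_le_mul (mul_le_mul_of_nonneg_left ((hC t ht).2.2.1 x) hC₃.le)
          ((hC t ht).2.2.1 y) (norm_nonneg _) (by positivity))
      have e2 := (abs_form_le (hl t) (S.ι 0 x) (S.ι 0 y)).trans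
        (mul_le_mul (mul_le_mul_of_nonneg_left ((S.ι 0).le_opNorm x) hKl) ((S.ι 0).le_opNorm y)
          (norm_nonneg _) (by positivity))
      refine (abs_add_le _ _).trans ((add_le_add e1 e2).trans (le_of_eq ?_))
      ring)
  refine ⟨_, C₁ / C ^ 2, C₂ * C ^ 2 + Kl, B, by positivity, by positivity, hB, fun x y => ?_, ?_,
    hBe⟩
  · refine ((hA.measurable _ _ (memL2_const_pullback S.φV x) (memL2_const_pullback S.φV y)).add
      (hlm (S.ι 0 x) (S.ι 0 y))).congr ?_
    filter_upwards [hBe, hle] with t h6 h7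
    rw [h6, ← h7]
    rfl
  · filter_upwards [hBe, hle, h1, ae_restrict_mem measurableSet_Icc] with t h5 h6 h7 ht x
    rw [h5, ← h6]
    have h8 : ‖x‖ ≤ C * ‖S.φV t x‖ := by simpa using (hC t ht).2.2.2 (S.φV t x)
    have e1 : C₁ / C ^ 2 * ‖x‖ ^ 2 ≤ C₁ * ‖S.φV t x‖ ^ 2 := by
      rw [div_mul_eq_mul_div, div_le_iff₀ (by positivity), mul_assoc]
      refine mul_le_mul_of_nonneg_left ?_ hC₁.le
      have := pow_le_pow_left₀ (norm_nonneg x) h8 2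
      linarith [mul_pow C ‖S.φV t x‖ 2]
    have e2 : C₂ * ‖S.ι t (S.φV t x)‖ ^ 2 ≤ C₂ * C ^ 2 * ‖S.ι 0 x‖ ^ 2 := by
      rw [S.restrict t ht, mul_assoc]
      refine mul_le_mul_of_nonneg_left ?_ hC₂.le
      have := pow_le_pow_left₀ (norm_nonneg _) ((hC t ht).1 (S.ι 0 x)) 2
      rwa [mul_pow] at this
    have e3 := (abs_le.1 (abs_form_le (hl t) (S.ι 0 x) (S.ι 0 x))).1
    have e4 := h7 (S.φV t x)
    linarith [mul_assoc Kl ‖S.ι 0 x‖ ‖S.ι 0 x‖, sq ‖S.ι 0 x‖]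

/-- The forms `M(t)` on `H(0)` and `M'(t)` on `V(0)`, bounded by `K`, are the pullbacks of the
operators `L(t)` and of their derivatives. -/
structure IsMassForm (S : EvolvingPair T H V) (LH : ∀ t, H t →ₗ[ℝ] H t)
    (Ldot : ∀ t, V t →ₗ[ℝ] StrongDual ℝ (V t)) (M : ℝ → H 0 →L[ℝ] H 0 →L[ℝ] ℝ)
    (M' : ℝ → V 0 →L[ℝ] V 0 →L[ℝ] ℝ) (K : ℝ) : Prop where
  norm_le : ∀ t, ‖M t‖ ≤ K
  measurable : ∀ x y, AEMeasurable (fun t => M t x y) (timeMeasure T)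
  eq : ∀ᵐ t ∂timeMeasure T, ∀ x y, M t x y = inner ℝ (LH t (S.φH t x)) (S.φH t y)
  norm_deriv_le : ∀ t, ‖M' t‖ ≤ K
  measurable_deriv : ∀ x y, AEMeasurable (fun t => M' t x y) (timeMeasure T)
  deriv_eq : ∀ᵐ t ∂timeMeasure T, ∀ x y, M' t x y = Ldot t (S.φV t x) (S.φV t y) +
    S.lambdaHat t ((S.φH t).symm (LH t (S.φH t (S.ι 0 x)))) (S.ι 0 y)

/-- If `u` has the material derivative `g`, then `(L u)' = L̇ u + L g` becomes, for the pullback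
`v` of `u`, the weak derivative of `M v` in the dual of `V(0)`. -/
theorem LAssumptions.hasWeakDeriv (hL : S.LAssumptions L LH LV Ldot) (hT : 0 < T)
    (hn : S.DifferentiableNorm)
    [CompleteSpace (H 0)] [TopologicalSpace.SeparableSpace (H 0)]
    [CompleteSpace (V 0)] [TopologicalSpace.SeparableSpace (V 0)]
    {K : ℝ} {M : ℝ → H 0 →L[ℝ] H 0 →L[ℝ] ℝ} {M' : ℝ → V 0 →L[ℝ] V 0 →L[ℝ] ℝ}
    (hM : S.IsMassForm LH Ldot M M' K)
    {u : ∀ t, V t} {g : ∀ t, StrongDual ℝ (V t)} (hu : S.IsMaterialDeriv u g) :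
    HasWeakDeriv T (fun t => (M t (S.ι 0 (S.pullback u t))).comp (S.ι 0))
      (fun t => M' t (S.pullback u t) + (L t (g t)).comp (S.φV t : V 0 →L[ℝ] V t)) := by
  obtain ⟨Kl, l, hKl, hl, hlm, hle⟩ := hn.exists_lambdaForm hT
  have hv : MemLp (S.pullback u) 2 (timeMeasure T) := hu.1
  have hm : MemLp (fun t => (M t (S.ι 0 (S.pullback u t))).comp (S.ι 0)) 2 (timeMeasure T) :=
    memLp_form_comp hM.measurable hM.norm_le ((S.ι 0).comp_memLp' hv) (S.ι 0)
  have h1 := memLp_form hM.measurable_deriv hM.norm_deriv_le hv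
  have h2 : MemLp (fun t => (L t (g t)).comp (S.φV t : V 0 →L[ℝ] V t)) 2 (timeMeasure T) :=
    hL.L1_mem g hu.2.1
  have hF := memLp_add_apply h1 h2
  refine ⟨hm.integrable (by norm_num), hF.integrable (by norm_num), fun ζ hζ => ?_⟩
  ext w
  have hζ' := hζ.contDiff_one.continuous_deriv le_rfl
  have h7 := hL.L7 u g hu
  have h3 := h7.2.2 _ (hζ.smul_const w)
  have h4 : deriv (fun t => ζ t • w) = fun t => deriv ζ t • w := funext fun t =>
    deriv_smul_const (hζ.contDiff_one.differentiable one_ne_zero t) w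
  rw [h4] at h3
  have hLd : MemLp (fun t => (Ldot t (u t)).comp (S.φV t : V 0 →L[ℝ] V t)) 2 (timeMeasure T) :=
    hL.Ldot_mem u hu.1
  have hζw : MemLp (fun t => ζ t • w) 2 (timeMeasure T) :=
    memLp_of_continuous_timeMeasure (hζ.smul_const w).1.continuous
  have hp : MemLp (fun t => (S.φH t).symm (LH t (S.φH t (S.ι 0 (S.pullback u t))))) 2
      (timeMeasure T) := hL.memL2H (fun t => S.φH t (S.ι 0 (S.pullback u t))) (by
    simp only [MemL2, ContinuousLinearEquiv.symm_apply_apply]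
    exact (S.ι 0).comp_memLp' hv)
  have j1 : Integrable (fun t => Ldot t (u t) (S.φV t (ζ t • w)) +
      L t (g t) (S.φV t (ζ t • w))) (timeMeasure T) :=
    (integrable_dual_apply hLd hζw).add (integrable_dual_apply h2 hζw)
  have j2 : Integrable (fun t => l t ((S.φH t).symm (LH t (S.φH t (S.ι 0 (S.pullback u t)))))
      (S.ι 0 (ζ t • w))) (timeMeasure T) :=
    integrable_dual_apply (memLp_form hlm hl hp) ((S.ι 0).comp_memLp' hζw)
  have e1 : ∫ t, inner ℝ (S.ι t (LV t (u t))) (S.ι t (S.φV t (deriv ζ t • w))) ∂timeMeasure T =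
      ∫ t, deriv ζ t * M t (S.ι 0 (S.pullback u t)) (S.ι 0 w) ∂timeMeasure T := by
    refine integral_congr_ae ?_
    filter_upwards [hM.eq, hL.restrictV, ae_restrict_mem measurableSet_Icc] with t k1 k2 ht
    rw [k1, ← k2, S.restrict t ht, ← S.restrict t ht (S.pullback u t), pullback,
      ContinuousLinearEquiv.apply_symm_apply, map_smul, map_smul, real_inner_smul_right]
  have e2 : ∫ t, S.lambda t (S.ι t (LV t (u t))) (S.ι t (S.φV t (ζ t • w))) ∂timeMeasure T =
      ∫ t, l t ((S.φH t).symm (LH t (S.φH t (S.ι 0 (S.pullback u t)))))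
        (S.ι 0 (ζ t • w)) ∂timeMeasure T := by
    refine integral_congr_ae ?_
    filter_upwards [hle, hL.restrictV, ae_restrict_mem measurableSet_Icc] with t k1 k2 ht
    rw [k1, ← k2, S.restrict t ht, ← S.restrict t ht (S.pullback u t), pullback,
      ContinuousLinearEquiv.apply_symm_apply, lambda, ContinuousLinearEquiv.symm_apply_apply]
  have e3 : ∫ t, ζ t * (M' t (S.pullback u t) w + L t (g t) (S.φV t w)) ∂timeMeasure T =
      ∫ t, (Ldot t (u t) (S.φV t (ζ t • w)) + L t (g t) (S.φV t (ζ t • w))) ∂timeMeasure T +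
      ∫ t, l t ((S.φH t).symm (LH t (S.φH t (S.ι 0 (S.pullback u t)))))
        (S.ι 0 (ζ t • w)) ∂timeMeasure T := by
    rw [← integral_add j1 j2]
    refine integral_congr_ae ?_
    filter_upwards [hM.deriv_eq, hle] with t k1 k2
    rw [k1]
    simp only [← k2, map_smul, smul_eq_mul, pullback, ContinuousLinearEquiv.apply_symm_apply]
    ring
  rw [neg_apply,
    ContinuousLinearMap.integral_apply
      (integrable_smul_timeMeasure hζ' (hm.integrable (by norm_num))),
    ContinuousLinearMap.integral_apply
      (integrable_smul_timeMeasure hζ.1.continuous (hF.integrable (by norm_num)))]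
  simp only [smul_apply, add_apply, smul_eq_mul, ContinuousLinearMap.comp_apply,
    ContinuousLinearEquiv.coe_coe] at h3 ⊢
  rw [e3]
  rw [e1, e2] at h3
  linarith

end Pullback

/-! ### Solutions of the evolving problem and their pullbacks -/

section PulledBackSolution

universe u v

variable {T : ℝ} {H : ℝ → Type u} {V : ℝ → Type v}
  [∀ t, NormedAddCommGroup (H t)] [∀ t, InnerProductSpace ℝ (H t)]
  [∀ t, NormedAddCommGroup (V t)] [∀ t, InnerProductSpace ℝ (V t)]
  {S : EvolvingPair T H V}
  {L : ∀ t, StrongDual ℝ (V t) →ₗ[ℝ] StrongDual ℝ (V t)}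
  {LH : ∀ t, H t →ₗ[ℝ] H t} {LV : ∀ t, V t →ₗ[ℝ] V t}
  {Ldot A : ∀ t, V t →ₗ[ℝ] StrongDual ℝ (V t)}
  {M : ℝ → H 0 →L[ℝ] H 0 →L[ℝ] ℝ} {M' B : ℝ → V 0 →L[ℝ] V 0 →L[ℝ] ℝ} {K c α β : ℝ}

/-- The norm of `f(t)` in `V*(t)` is a measurable function of time, being the supremum of the
quotients `|f(t)(φₜ w)| / ‖φₜ w‖` over a countable dense set of `w`. -/
theorem aemeasurable_norm_of_memL2Dual [TopologicalSpace.SeparableSpace (V 0)]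
    {f : ∀ t, StrongDual ℝ (V t)} (hf : MemL2Dual T S.φV f) :
    AEMeasurable (fun t => ‖f t‖) (timeMeasure T) := by
  let w := TopologicalSpace.denseSeq (V 0)
  have h1 : ∀ n, AEMeasurable (fun t => ENNReal.ofReal (|f t (S.φV t (w n))| / ‖S.φV t (w n)‖))
      (timeMeasure T) := fun n => by
    have k1 : AEMeasurable (fun t => f t (S.φV t (w n))) (timeMeasure T) :=
      (aestronglyMeasurable_dual_apply hf.1 (aestronglyMeasurable_const (b := w n))).aemeasurable
    have k2 : AEMeasurable (fun t => ‖S.φV t (w n)‖) (timeMeasure T) :=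
      (S.compatibleV.continuous_norm (w n)).aemeasurable measurableSet_Icc
    exact (k1.abs.div k2).ennreal_ofReal
  refine (AEMeasurable.iSup h1).ennreal_toReal.congr (Eventually.of_forall fun t => ?_)
  have hle : ∀ n, |f t (S.φV t (w n))| / ‖S.φV t (w n)‖ ≤ ‖f t‖ := fun n =>
    div_le_of_le_mul₀ (norm_nonneg _) (norm_nonneg _) ((f t).le_opNorm _)
  have hsup : ⨆ n, ENNReal.ofReal (|f t (S.φV t (w n))| / ‖S.φV t (w n)‖) ≤
      ENNReal.ofReal ‖f t‖ := iSup_le fun n => ENNReal.ofReal_le_ofReal (hle n)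
  refine le_antisymm ?_ ?_
  · simpa using ENNReal.toReal_mono ENNReal.ofReal_ne_top hsup
  set R := (⨆ n, ENNReal.ofReal (|f t (S.φV t (w n))| / ‖S.φV t (w n)‖)).toReal with hR
  have hn : ∀ n, |f t (S.φV t (w n))| ≤ R * ‖S.φV t (w n)‖ := fun n => by
    rcases eq_or_ne (S.φV t (w n)) 0 with h0 | h0
    · simp [h0]
    rw [← div_le_iff₀ (norm_pos_iff.2 h0)]
    refine (ENNReal.ofReal_le_iff_le_toReal (ne_top_of_le_ne_top ENNReal.ofReal_ne_top hsup)).1 ?_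
    exact le_iSup (fun n => ENNReal.ofReal (|f t (S.φV t (w n))| / ‖S.φV t (w n)‖)) n
  have hall : ∀ x, |f t (S.φV t x)| ≤ R * ‖S.φV t x‖ := fun x => by
    have hcl : IsClosed {x | |f t (S.φV t x)| ≤ R * ‖S.φV t x‖} :=
      isClosed_le (by fun_prop) (by fun_prop)
    have hd := hcl.closure_subset_iff (s := range w).2 (by rintro _ ⟨n, rfl⟩; exact hn n)
    rw [(TopologicalSpace.denseRange_denseSeq (V 0)).closure_range] at hd
    exact hd (mem_univ x)
  refine (f t).opNorm_le_bound ENNReal.toReal_nonneg fun x => ?_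
  simpa using hall ((S.φV t).symm x)

theorem norm_comp_φV_le {C : ℝ} (hC0 : 0 ≤ C) {t : ℝ} (hC : ∀ x, ‖S.φV t x‖ ≤ C * ‖x‖)
    (f : StrongDual ℝ (V t)) : ‖f.comp (S.φV t : V 0 →L[ℝ] V t)‖ ≤ C * ‖f‖ :=
  ContinuousLinearMap.opNorm_le_bound _ (by positivity) fun x =>
    (f.le_opNorm _).trans ((mul_le_mul_of_nonneg_left (hC x) (norm_nonneg _)).trans_eq (by ring))

theorem norm_le_comp_φV {C : ℝ} (hC0 : 0 ≤ C) {t : ℝ} (hC : ∀ x, ‖(S.φV t).symm x‖ ≤ C * ‖x‖)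
    (f : StrongDual ℝ (V t)) : ‖f‖ ≤ C * ‖f.comp (S.φV t : V 0 →L[ℝ] V t)‖ :=
  ContinuousLinearMap.opNorm_le_bound _ (by positivity) fun x => by
    have h1 : f x = f.comp (S.φV t : V 0 →L[ℝ] V t) ((S.φV t).symm x) := by simp
    rw [h1]
    exact (ContinuousLinearMap.le_opNorm _ _).trans
      ((mul_le_mul_of_nonneg_left (hC x) (norm_nonneg _)).trans_eq (by ring))

theorem integrable_norm_sq_of_memL2Dual [TopologicalSpace.SeparableSpace (V 0)]
    {f : ∀ t, StrongDual ℝ (V t)} (hf : MemL2Dual T S.φV f) :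
    Integrable (fun t => ‖f t‖ ^ 2) (timeMeasure T) := by
  obtain ⟨C, hC1, hC⟩ := S.exists_bound T
  refine Integrable.mono' ((hf.integrable_norm_pow (p := 2) (by norm_num)).const_mul (C ^ 2))
    ((aemeasurable_norm_of_memL2Dual hf).pow_const 2).aestronglyMeasurable ?_
  filter_upwards [ae_restrict_mem measurableSet_Icc] with t ht
  rw [Real.norm_of_nonneg (by positivity), ← mul_pow]
  exact pow_le_pow_left₀ (norm_nonneg _) (norm_le_comp_φV (by positivity) (hC t ht).2.2.2 _) 2

/-- Under the evolving space equivalence, the elements of `W(V,V*)` have a representative with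
continuous pullback. -/
theorem SpaceEquivalence.exists_continuousOn_pullback (he : S.SpaceEquivalence) (hT : 0 < T)
    [CompleteSpace (H 0)] [TopologicalSpace.SeparableSpace (H 0)]
    [CompleteSpace (V 0)] [TopologicalSpace.SeparableSpace (V 0)]
    {u : ∀ t, V t} (hu : MemL2 T S.φV u) (hW : S.MemW u) :
    ∃ y : ℝ → H 0, ContinuousOn y (Icc 0 T) ∧
      ∀ᵐ t ∂timeMeasure T, S.ι 0 (S.pullback u t) = y t := by
  obtain ⟨w, hv, hw, hw'⟩ := (he.mem_iff u hu).1 hW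
  have hm : MemLp (fun t => (innerForm (H 0) (S.ι 0 (S.pullback u t))).comp (S.ι 0)) 2
      (timeMeasure T) :=
    memLp_form_comp (B := fun _ => innerForm (H 0)) (fun _ _ => aemeasurable_const)
      (fun _ => norm_innerForm_le (H 0)) ((S.ι 0).comp_memLp' hv) (S.ι 0)
  have hmi := hm.integrable (by norm_num)
  have hwi := hw.integrable (by norm_num)
  have hwd : HasWeakDeriv T (fun t => (innerForm (H 0) (S.ι 0 (S.pullback u t))).comp (S.ι 0))
      w := by
    refine ⟨hmi, hwi, fun ζ hζ => ?_⟩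
    ext x
    rw [neg_apply, ContinuousLinearMap.integral_apply
      (integrable_smul_timeMeasure (hζ.contDiff_one.continuous_deriv le_rfl) hmi),
      ContinuousLinearMap.integral_apply (integrable_smul_timeMeasure hζ.1.continuous hwi)]
    exact hw' ζ hζ x
  exact exists_continuousOn_representative hT S.ι_dense hv hw (hwd.exists_primitive hT)

theorem symm_ι_eq {t : ℝ} (ht : t ∈ Icc 0 T) (u : ∀ t, V t) :
    (S.φH t).symm (S.ι t (u t)) = S.ι 0 (S.pullback u t) := by
  rw [ContinuousLinearEquiv.symm_apply_eq, ← S.restrict t ht, pullback,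
    ContinuousLinearEquiv.apply_symm_apply]

theorem HasInitialValue.tendsto {u : ∀ t, V t} {u₀ : H 0} (h : S.HasInitialValue u u₀)
    (hT : 0 < T) :
    Tendsto (fun t => S.ι 0 (S.pullback u t)) (𝓝 0 ⊓ ae (timeMeasure T)) (𝓝 u₀) := by
  obtain ⟨y, hy, hyu, hy0⟩ := h
  rw [← hy0]
  refine (tendsto_of_continuousOn_timeMeasure hy ⟨le_rfl, hT.le⟩).congr'
    (eventually_nhds_inf_ae ?_)
  filter_upwards [hyu, ae_restrict_mem measurableSet_Icc] with t h1 ht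
  rw [← h1, symm_ι_eq ht]

variable [CompleteSpace (H 0)] [TopologicalSpace.SeparableSpace (H 0)]
  [CompleteSpace (V 0)] [TopologicalSpace.SeparableSpace (V 0)]

/-- Conversely, if `(M v)' = G + M' v` in the dual of `V(0)`, then `L u` has a material
derivative, where `v` is the pullback of `u`. -/
theorem LAssumptions.isMaterialDeriv_of_primitive (hL : S.LAssumptions L LH LV Ldot) (hT : 0 < T)
    (hn : S.DifferentiableNorm) (hM : S.IsMassForm LH Ldot M M' K)
    {u : ∀ t, V t} (hu : MemL2 T S.φV u) {G : ℝ → StrongDual ℝ (V 0)}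
    (hG : MemLp G 2 (timeMeasure T)) {d : StrongDual ℝ (V 0)}
    (hd : ∀ᵐ t ∂timeMeasure T, (M t (S.ι 0 (S.pullback u t))).comp (S.ι 0) =
      d + ∫ s in (0 : ℝ)..t, (G s + M' s (S.pullback u s))) :
    S.IsMaterialDeriv (fun t => LV t (u t)) (fun t =>
      (G t).comp ((S.φV t).symm : V t →L[ℝ] V 0) + Ldot t (u t)) := by
  obtain ⟨Kl, l, hKl, hl, hlm, hle⟩ := hn.exists_lambdaForm hT
  have hv : MemLp (S.pullback u) 2 (timeMeasure T) := hu
  have hLd : MemLp (fun t => (Ldot t (u t)).comp (S.φV t : V 0 →L[ℝ] V t)) 2 (timeMeasure T) :=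
    hL.Ldot_mem u hu
  refine ⟨hL.L5 u hu, ?_, fun ψ hψ => ?_⟩
  · refine (memLp_congr_ae (Eventually.of_forall fun t => ?_)).1 (memLp_add_apply hG hLd)
    ext x
    simp
  have hF := memLp_add_apply hG (memLp_form hM.measurable_deriv hM.norm_deriv_le hv)
  have hm : MemLp (fun t => (M t (S.ι 0 (S.pullback u t))).comp (S.ι 0)) 2 (timeMeasure T) :=
    memLp_form_comp hM.measurable hM.norm_le ((S.ι 0).comp_memLp' hv) (S.ι 0)
  have hψL : MemLp ψ 2 (timeMeasure T) := memLp_of_continuous_timeMeasure hψ.1.continuous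
  have hψL' : MemLp (deriv ψ) 2 (timeMeasure T) :=
    memLp_of_continuous_timeMeasure (hψ.contDiff_one.continuous_deriv le_rfl)
  have hp : MemLp (fun t => (S.φH t).symm (LH t (S.φH t (S.ι 0 (S.pullback u t))))) 2
      (timeMeasure T) := hL.memL2H (fun t => S.φH t (S.ι 0 (S.pullback u t))) (by
    simp only [MemL2, ContinuousLinearEquiv.symm_apply_apply]
    exact (S.ι 0).comp_memLp' hv)
  have h1 := bilin_primitive_eq hT.le (hF.integrable (by norm_num)) hψ.contDiff_one
    (ContinuousLinearMap.id ℝ (StrongDual ℝ (V 0))) d (t := T) ⟨hT.le, le_rfl⟩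
  rw [← integral_timeMeasure hT.le (fun s => (ContinuousLinearMap.id ℝ (StrongDual ℝ (V 0)))
    (G s + M' s (S.pullback u s)) (ψ s) + (ContinuousLinearMap.id ℝ (StrongDual ℝ (V 0)))
    (d + ∫ r in (0 : ℝ)..s, (G r + M' r (S.pullback u r))) (deriv ψ s)),
    hψ.eq_zero (by simp), hψ.eq_zero (by simp)] at h1
  simp only [map_zero, zero_add, ContinuousLinearMap.id_apply] at h1
  have e0 : ∫ t, (G t + M' t (S.pullback u t)) (ψ t) ∂timeMeasure T +
      ∫ t, M t (S.ι 0 (S.pullback u t)) (S.ι 0 (deriv ψ t)) ∂timeMeasure T = 0 := by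
    have hmψ : Integrable (fun t => M t (S.ι 0 (S.pullback u t)) (S.ι 0 (deriv ψ t)))
        (timeMeasure T) := by
      have := integrable_dual_apply hm hψL'
      exact this
    rw [← integral_add (integrable_dual_apply hF hψL) hmψ]
    refine (integral_congr_ae (hd.mono fun t ht => ?_)).trans h1.symm
    rw [← ht]
    rfl
  have j1 : Integrable (fun t => G t (ψ t) + Ldot t (u t) (S.φV t (ψ t))) (timeMeasure T) :=
    (integrable_dual_apply hG hψL).add (integrable_dual_apply hLd hψL)
  have j2 : Integrable (fun t => l t ((S.φH t).symm (LH t (S.φH t (S.ι 0 (S.pullback u t)))))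
      (S.ι 0 (ψ t))) (timeMeasure T) :=
    integrable_dual_apply (memLp_form hlm hl hp) ((S.ι 0).comp_memLp' hψL)
  have e1 : ∫ t, inner ℝ (S.ι t (LV t (u t))) (S.ι t (S.φV t (deriv ψ t))) ∂timeMeasure T =
      ∫ t, M t (S.ι 0 (S.pullback u t)) (S.ι 0 (deriv ψ t)) ∂timeMeasure T := by
    refine integral_congr_ae ?_
    filter_upwards [hM.eq, hL.restrictV, ae_restrict_mem measurableSet_Icc] with t k1 k2 ht
    rw [k1, ← k2, S.restrict t ht, ← S.restrict t ht (S.pullback u t), pullback,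
      ContinuousLinearEquiv.apply_symm_apply]
  have e2 : ∫ t, S.lambda t (S.ι t (LV t (u t))) (S.ι t (S.φV t (ψ t))) ∂timeMeasure T =
      ∫ t, l t ((S.φH t).symm (LH t (S.φH t (S.ι 0 (S.pullback u t)))))
        (S.ι 0 (ψ t)) ∂timeMeasure T := by
    refine integral_congr_ae ?_
    filter_upwards [hle, hL.restrictV, ae_restrict_mem measurableSet_Icc] with t k1 k2 ht
    rw [k1, ← k2, S.restrict t ht, ← S.restrict t ht (S.pullback u t), pullback,
      ContinuousLinearEquiv.apply_symm_apply, lambda, ContinuousLinearEquiv.symm_apply_apply]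
  have e3 : ∫ t, (G t + M' t (S.pullback u t)) (ψ t) ∂timeMeasure T =
      ∫ t, (G t (ψ t) + Ldot t (u t) (S.φV t (ψ t))) ∂timeMeasure T +
      ∫ t, l t ((S.φH t).symm (LH t (S.φH t (S.ι 0 (S.pullback u t)))))
        (S.ι 0 (ψ t)) ∂timeMeasure T := by
    rw [← integral_add j1 j2]
    refine integral_congr_ae ?_
    filter_upwards [hM.deriv_eq, hle] with t k1 k2
    rw [add_apply, k1]
    simp only [← k2, pullback, ContinuousLinearEquiv.apply_symm_apply]
    ring
  simp only [add_apply, ContinuousLinearMap.comp_apply, ContinuousLinearEquiv.coe_coe,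
    ContinuousLinearEquiv.symm_apply_apply]
  rw [e1, e2]
  linarith

/-- The pullbacks of the operators form a parabolic problem on the fixed spaces. The derivative of
`M(t)x` is found by applying the product rule (L7) to the function with constant pullback `x`. -/
theorem exists_isParabolic (hT : 0 < T) (hn : S.DifferentiableNorm)
    (hL : S.LAssumptions L LH LV Ldot) (hA : S.AAssumptions A) :
    ∃ (M : ℝ → H 0 →L[ℝ] H 0 →L[ℝ] ℝ) (M' B : ℝ → V 0 →L[ℝ] V 0 →L[ℝ] ℝ) (K c α β : ℝ),
      IsParabolic T (S.ι 0) M M' B K c α β ∧ S.IsMassForm LH Ldot M M' K ∧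
      ∀ᵐ t ∂timeMeasure T, ∀ x y, B t x y = A t (S.φV t x) (S.φV t y) +
        S.lambdaHat t (S.ι 0 x) (S.ι 0 y) := by
  obtain ⟨K₁, c, M, hc, hM, hMm, hMs, hMc, hMe⟩ := hL.exists_massForm hn
  obtain ⟨K₂, M', hK₂, hM', hMm', hMb', hMe'⟩ := hL.exists_massForm_deriv hT hn
  obtain ⟨K₃, α, β, B, hα, hβ, hB, hBm, hBg, hBe⟩ := hA.exists_form hT hn
  set K := max K₁ (max K₂ K₃) with hK
  have h1 : K₁ ≤ K := le_max_left _ _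
  have h2 : K₂ ≤ K := (le_max_left _ _).trans (le_max_right _ _)
  have h3 : K₃ ≤ K := (le_max_right _ _).trans (le_max_right _ _)
  have hMF : S.IsMassForm LH Ldot M M' K := ⟨fun t => (hM t).trans h1, hMm, hMe,
    fun t => (hM' t).trans h2, hMm', hMe'⟩
  refine ⟨M, M', B, K, c, α, β, ⟨⟨hMm, hMF.norm_le, hMs, hMm', hMF.norm_deriv_le, fun x => ?_⟩,
    hc, hα, hβ, hMc, ?_, hBm, fun t => (hB t).trans h3, hBg⟩, hMF, hBe⟩
  · have h := (hL.hasWeakDeriv hT hn hMF (hn.isMaterialDeriv_const hT x)).exists_primitive hT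
    simpa [pullback] using h
  · filter_upwards [hMb'] with t ht x y
    refine (ht x y).trans ?_
    gcongr

/-- A solution of the evolving problem solves the parabolic problem on the fixed spaces. -/
theorem IsSolution.pullback_eq (hT : 0 < T) (hn : S.DifferentiableNorm)
    (hL : S.LAssumptions L LH LV Ldot) (hM : S.IsMassForm LH Ldot M M' K)
    (hB : ∀ᵐ t ∂timeMeasure T, ∀ x y, B t x y = A t (S.φV t x) (S.φV t y) +
      S.lambdaHat t (S.ι 0 x) (S.ι 0 y))
    {f : ∀ t, StrongDual ℝ (V t)} {u₀ : H 0} {u : ∀ t, V t} {g : ∀ t, StrongDual ℝ (V t)}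
    (h : S.IsSolution L A f u₀ u g) :
    (∀ᵐ t ∂timeMeasure T, (L t (g t)).comp (S.φV t : V 0 →L[ℝ] V t) =
      (f t).comp (S.φV t : V 0 →L[ℝ] V t) - B t (S.pullback u t)) ∧
    ∃ d, ∀ᵐ t ∂timeMeasure T, (M t (S.ι 0 (S.pullback u t))).comp (S.ι 0) =
      d + ∫ s in (0 : ℝ)..t, ((f s).comp (S.φV s : V 0 →L[ℝ] V s) - B s (S.pullback u s) +
        M' s (S.pullback u s)) := by
  have h1 : ∀ᵐ t ∂timeMeasure T, (L t (g t)).comp (S.φV t : V 0 →L[ℝ] V t) =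
      (f t).comp (S.φV t : V 0 →L[ℝ] V t) - B t (S.pullback u t) := by
    filter_upwards [h.equation, hB, ae_restrict_mem measurableSet_Icc] with t h1 h2 ht
    ext x
    have h3 := h1 (S.φV t x)
    simp only [lambda] at h3
    rw [symm_ι_eq ht, S.restrict t ht, ContinuousLinearEquiv.symm_apply_apply] at h3
    rw [sub_apply, h2]
    simp only [ContinuousLinearMap.comp_apply, ContinuousLinearEquiv.coe_coe, pullback,
      ContinuousLinearEquiv.apply_symm_apply] at h3 ⊢
    linarith
  refine ⟨h1, ?_⟩
  obtain ⟨d, hd⟩ := (hL.hasWeakDeriv hT hn hM h.deriv).exists_primitive hT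
  refine ⟨d, ?_⟩
  filter_upwards [hd, ae_restrict_mem measurableSet_Icc] with t h2 ht
  rw [h2]
  congr 1
  refine intervalIntegral_congr_timeMeasure ?_ ht
  filter_upwards [h1] with s h3
  rw [h3, add_comm]

end PulledBackSolution

/-! ### Existence, uniqueness and the a priori estimate -/

section WellPosed

universe u v

variable {T : ℝ} {H : ℝ → Type u} {V : ℝ → Type v}
  [∀ t, NormedAddCommGroup (H t)] [∀ t, InnerProductSpace ℝ (H t)]
  [∀ t, NormedAddCommGroup (V t)] [∀ t, InnerProductSpace ℝ (V t)]
  [CompleteSpace (H 0)] [TopologicalSpace.SeparableSpace (H 0)]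
  [CompleteSpace (V 0)] [TopologicalSpace.SeparableSpace (V 0)]
  {S : EvolvingPair T H V}
  {L : ∀ t, StrongDual ℝ (V t) →ₗ[ℝ] StrongDual ℝ (V t)}
  {LH : ∀ t, H t →ₗ[ℝ] H t} {LV : ∀ t, V t →ₗ[ℝ] V t}
  {Ldot A : ∀ t, V t →ₗ[ℝ] StrongDual ℝ (V t)}
  {M : ℝ → H 0 →L[ℝ] H 0 →L[ℝ] ℝ} {M' B : ℝ → V 0 →L[ℝ] V 0 →L[ℝ] ℝ} {K c α β : ℝ}

/-- Existence: the solution `v` of the parabolic problem on the fixed spaces, with the functional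
`M(0)u₀` as initial datum, is the pullback of a solution. -/
theorem exists_isSolution (hT : 0 < T) (hn : S.DifferentiableNorm) (he : S.SpaceEquivalence)
    (hL : S.LAssumptions L LH LV Ldot) (hP : IsParabolic T (S.ι 0) M M' B K c α β)
    (hM : S.IsMassForm LH Ldot M M' K)
    (hB : ∀ᵐ t ∂timeMeasure T, ∀ x y, B t x y = A t (S.φV t x) (S.φV t y) +
      S.lambdaHat t (S.ι 0 x) (S.ι 0 y))
    {f : ∀ t, StrongDual ℝ (V t)} (hf : MemL2Dual T S.φV f) (u₀ : H 0) :
    ∃ u g, S.IsSolution L A f u₀ u g := by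
  obtain ⟨M₀, hM₀⟩ := hP.exists_limit hT S.ι_dense
  obtain ⟨v, hv, hd⟩ := hP.exists_solution hT hf (M₀ u₀)
  set u : ∀ t, V t := fun t => S.φV t (v t) with hu
  have hpu : S.pullback u = v := funext fun t => (S.φV t).symm_apply_apply (v t)
  have huL : MemL2 T S.φV u := by rw [← hpu] at hv; exact hv
  have hBv := memLp_form hP.measurable_op hP.norm_op_le hv
  have hG : MemLp (fun t => (f t).comp (S.φV t : V 0 →L[ℝ] V t) - B t (v t)) 2 (timeMeasure T) :=
    MemLp.sub hf hBv
  have hF := memLp_add_apply hG (memLp_form hP.measurable_deriv hP.norm_deriv_le hv)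
  have hW : S.MemW u := (hL.L6 u huL).2
    ⟨_, hL.isMaterialDeriv_of_primitive hT hn hM huL hG (by rw [hpu]; exact hd)⟩
  obtain ⟨g, hg⟩ := hW
  have hw1 := hL.hasWeakDeriv hT hn hM hg
  rw [hpu] at hw1
  -- `(M v)' = M' v + φₜ* (L g)` and `(M v)' = f̂ - B v + M' v`
  have hLg := hw1.ae_eq (hasWeakDeriv_of_primitive hT.le (hF.integrable (by norm_num)) hd)
  obtain ⟨y, hy, hyu⟩ := he.exists_continuousOn_pullback hT huL ⟨g, hg⟩
  refine ⟨u, g, hg, ?_, y, hy, ?_, ?_⟩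
  · filter_upwards [hLg, hB, ae_restrict_mem measurableSet_Icc] with t h1 h2 ht w
    have h3 := congrArg (fun F => F ((S.φV t).symm w)) h1
    simp only [add_apply, sub_apply, ContinuousLinearMap.comp_apply, h2,
      ContinuousLinearEquiv.coe_coe, ContinuousLinearEquiv.apply_symm_apply] at h3
    have h4 : (S.φH t).symm (S.ι t w) = S.ι 0 ((S.φV t).symm w) := by
      rw [ContinuousLinearEquiv.symm_apply_eq, ← S.restrict t ht,
        ContinuousLinearEquiv.apply_symm_apply]
    rw [lambda, symm_ι_eq ht, hpu, h4]
    linarith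
  · filter_upwards [hyu, ae_restrict_mem measurableSet_Icc] with t h1 ht
    rw [symm_ι_eq ht, h1]
  · have h0 : Tendsto (fun t => S.ι 0 (v t)) (𝓝 0 ⊓ ae (timeMeasure T)) (𝓝 (y 0)) := by
      rw [← hpu]
      exact (tendsto_of_continuousOn_timeMeasure hy ⟨le_rfl, hT.le⟩).congr'
        (eventually_nhds_inf_ae (hyu.mono fun t ht => ht.symm))
    have h1 := primitive_initial_eq hP.toIsDifferentiableForm hT hM₀
      (hF.integrable (by norm_num)) hd h0
    refine sub_eq_zero.1 (eq_zero_of_limit_form (M₀ := M₀) S.ι_dense hP.pos_c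
      (limit_form_coercive hT hM₀ hP.coercive) fun w => ?_)
    rw [map_sub, sub_apply, ← h1 w, ContinuousLinearMap.comp_apply, sub_self]

theorem IsSolution.ae_unique (hT : 0 < T) (hn : S.DifferentiableNorm)
    (hL : S.LAssumptions L LH LV Ldot) (hP : IsParabolic T (S.ι 0) M M' B K c α β)
    (hM : S.IsMassForm LH Ldot M M' K)
    (hB : ∀ᵐ t ∂timeMeasure T, ∀ x y, B t x y = A t (S.φV t x) (S.φV t y) +
      S.lambdaHat t (S.ι 0 x) (S.ι 0 y))
    {f : ∀ t, StrongDual ℝ (V t)} (hf : MemL2Dual T S.φV f) {u₀ : H 0}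
    {u u' : ∀ t, V t} {g g' : ∀ t, StrongDual ℝ (V t)}
    (h : S.IsSolution L A f u₀ u g) (h' : S.IsSolution L A f u₀ u' g') :
    ∀ᵐ t ∂timeMeasure T, u' t = u t := by
  obtain ⟨C, hC, hest⟩ := hP.exists_energy_estimate hT
  obtain ⟨-, d, hd⟩ := h.pullback_eq hT hn hL hM hB
  obtain ⟨-, d', hd'⟩ := h'.pullback_eq hT hn hL hM hB
  have hv : MemLp (S.pullback u) 2 (timeMeasure T) := h.deriv.1
  have hv' : MemLp (S.pullback u') 2 (timeMeasure T) := h'.deriv.1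
  have hFi : ∀ {v : ℝ → V 0}, MemLp v 2 (timeMeasure T) →
      Integrable (fun s => (f s).comp (S.φV s : V 0 →L[ℝ] V s) - B s (v s) + M' s (v s))
        (timeMeasure T) := fun hv => by
    have k1 : MemLp (fun t => (f t).comp (S.φV t : V 0 →L[ℝ] V t) - B t _) 2 (timeMeasure T) :=
      MemLp.sub hf (memLp_form hP.measurable_op hP.norm_op_le hv)
    exact (memLp_add_apply k1 (memLp_form hP.measurable_deriv hP.norm_deriv_le hv)).integrable
      (by norm_num)
  have hw : MemLp (fun t => S.pullback u' t - S.pullback u t) 2 (timeMeasure T) := hv'.sub hv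
  have key := hest (fun _ => 0) (fun t => S.pullback u' t - S.pullback u t) (d' - d) 0
    (memLp_const 0) hw (by
      filter_upwards [hd, hd', ae_restrict_mem measurableSet_Icc] with t h1 h2 ht
      rw [map_sub, map_sub, ContinuousLinearMap.sub_comp, h1, h2, add_sub_add_comm,
        ← intervalIntegral.integral_sub
          (intervalIntegrable_of_timeMeasure (hFi hv') ⟨le_rfl, hT.le⟩ ht)
          (intervalIntegrable_of_timeMeasure (hFi hv) ⟨le_rfl, hT.le⟩ ht)]
      congr 1
      refine intervalIntegral.integral_congr fun s _ => ?_
      simp only [map_sub]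
      abel) (by
      have := (h'.initial.tendsto hT).sub (h.initial.tendsto hT)
      simpa using this)
  simp only [norm_zero, ne_eq, OfNat.ofNat_ne_zero, not_false_eq_true, zero_pow, integral_zero,
    add_zero, mul_zero] at key
  have h0 : 0 ≤ᵐ[timeMeasure T] fun t => ‖S.pullback u' t - S.pullback u t‖ ^ 2 :=
    Eventually.of_forall fun t => by positivity
  have h1 := (integral_eq_zero_iff_of_nonneg_ae h0
    (hw.integrable_norm_pow (p := 2) (by norm_num))).1 (le_antisymm key (integral_nonneg_of_ae h0))
  filter_upwards [h1] with t ht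
  have h2 : S.pullback u' t - S.pullback u t = 0 := by simpa using ht
  exact (S.φV t).symm.injective (sub_eq_zero.1 h2)

theorem IsSolution.exists_estimate (hT : 0 < T) (hn : S.DifferentiableNorm)
    (hL : S.LAssumptions L LH LV Ldot) (hP : IsParabolic T (S.ι 0) M M' B K c α β)
    (hM : S.IsMassForm LH Ldot M M' K)
    (hB : ∀ᵐ t ∂timeMeasure T, ∀ x y, B t x y = A t (S.φV t x) (S.φV t y) +
      S.lambdaHat t (S.ι 0 x) (S.ι 0 y)) :
    ∃ C : ℝ, 0 < C ∧ ∀ (f : ∀ t, StrongDual ℝ (V t)) (u₀ : H 0) (u : ∀ t, V t)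
      (g : ∀ t, StrongDual ℝ (V t)), MemL2Dual T S.φV f → S.IsSolution L A f u₀ u g →
      wNorm T u g ≤ C * (‖u₀‖ + l2Norm T f) := by
  obtain ⟨C, hC1, hC⟩ := S.exists_bound T
  obtain ⟨C₁, C₂, hC₁, -, hL1⟩ := hL.L1_bound
  obtain ⟨Ce, hCe, hest⟩ := hP.exists_energy_estimate hT
  set D : ℝ := C ^ 2 * (Ce * C ^ 2) + 2 * C ^ 2 * (C ^ 2 + K ^ 2 * (Ce * C ^ 2)) / C₁ ^ 2 with hD
  have hD0 : 0 < D := by positivity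
  refine ⟨Real.sqrt D, Real.sqrt_pos.2 hD0, fun f u₀ u g hf h => ?_⟩
  obtain ⟨hLg, d, hd⟩ := h.pullback_eq hT hn hL hM hB
  have hv : MemLp (S.pullback u) 2 (timeMeasure T) := h.deriv.1
  have hvi : Integrable (fun t => ‖S.pullback u t‖ ^ 2) (timeMeasure T) :=
    hv.integrable_norm_pow (p := 2) (by norm_num)
  have hfi : Integrable (fun t => ‖(f t).comp (S.φV t : V 0 →L[ℝ] V t)‖ ^ 2) (timeMeasure T) :=
    MemLp.integrable_norm_pow (p := 2) hf (by norm_num)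
  set X := ∫ t, ‖S.pullback u t‖ ^ 2 ∂timeMeasure T with hX
  set Y := ∫ t, ‖(f t).comp (S.φV t : V 0 →L[ℝ] V t)‖ ^ 2 ∂timeMeasure T with hY
  set F := ∫ t, ‖f t‖ ^ 2 ∂timeMeasure T with hF
  set W := ∫ t, ‖g t‖ ^ 2 ∂timeMeasure T with hW
  have hF0 : 0 ≤ F := integral_nonneg fun t => by positivity
  have hW0 : 0 ≤ W := integral_nonneg fun t => by positivity
  have hCsq : (1 : ℝ) ≤ C ^ 2 := one_le_pow₀ hC1
  have e1 : X ≤ Ce * (‖u₀‖ ^ 2 + Y) := hest _ _ d u₀ hf hv hd (h.initial.tendsto hT)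
  have e2 : Y ≤ C ^ 2 * F := by
    rw [hY, hF, ← integral_const_mul]
    refine integral_mono_ae hfi ((integrable_norm_sq_of_memL2Dual hf).const_mul _) ?_
    filter_upwards [ae_restrict_mem measurableSet_Icc] with t ht
    rw [← mul_pow]
    exact pow_le_pow_left₀ (norm_nonneg _) (norm_comp_φV_le (by positivity) (hC t ht).2.2.1 _) 2
  have e3 : ∫ t, ‖u t‖ ^ 2 ∂timeMeasure T ≤ C ^ 2 * X := by
    rw [hX, ← integral_const_mul]
    refine integral_mono_of_nonneg (Eventually.of_forall fun t => by positivity)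
      (hvi.const_mul _) ?_
    filter_upwards [ae_restrict_mem measurableSet_Icc] with t ht
    rw [← mul_pow]
    refine pow_le_pow_left₀ (norm_nonneg _) ?_ 2
    simpa [pullback] using (hC t ht).2.2.1 (S.pullback u t)
  have e4 : ∫ t, ‖L t (g t)‖ ^ 2 ∂timeMeasure T ≤ 2 * C ^ 2 * (Y + K ^ 2 * X) := by
    have : 2 * C ^ 2 * (Y + K ^ 2 * X) = ∫ t, 2 * C ^ 2 *
        (‖(f t).comp (S.φV t : V 0 →L[ℝ] V t)‖ ^ 2 + K ^ 2 * ‖S.pullback u t‖ ^ 2)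
        ∂timeMeasure T := by
      rw [integral_const_mul, integral_add hfi (hvi.const_mul _), integral_const_mul]
    rw [this]
    refine integral_mono_of_nonneg (Eventually.of_forall fun t => by positivity)
      ((hfi.add (hvi.const_mul _)).const_mul _) ?_
    filter_upwards [ae_restrict_mem measurableSet_Icc, hLg] with t ht h1
    have h2 := norm_le_comp_φV (S := S) (by positivity) (hC t ht).2.2.2 (L t (g t))
    rw [h1] at h2
    have h3 : ‖(f t).comp (S.φV t : V 0 →L[ℝ] V t) - B t (S.pullback u t)‖ ≤
        ‖(f t).comp (S.φV t : V 0 →L[ℝ] V t)‖ + K * ‖S.pullback u t‖ :=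
      (norm_sub_le _ _).trans (add_le_add_right ((B t).le_of_opNorm_le (hP.norm_op_le t) _) _)
    have h4 := h2.trans (mul_le_mul_of_nonneg_left h3 (by positivity))
    refine (pow_le_pow_left₀ (norm_nonneg _) h4 2).trans ?_
    rw [mul_pow, mul_comm 2 (C ^ 2), mul_assoc]
    refine mul_le_mul_of_nonneg_left ?_ (by positivity)
    refine (add_sq_le).trans (le_of_eq ?_)
    ring
  have e5 : C₁ ^ 2 * W ≤ ∫ t, ‖L t (g t)‖ ^ 2 ∂timeMeasure T := by
    have h1 := pow_le_pow_left₀ (mul_nonneg hC₁.le (Real.sqrt_nonneg _))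
      (hL1 g h.deriv.2.1).1 2
    simp only [l2Norm] at h1
    rwa [mul_pow, Real.sq_sqrt hW0,
      Real.sq_sqrt (integral_nonneg fun t => by positivity)] at h1
  set N := ‖u₀‖ ^ 2 with hN
  have hN0 : 0 ≤ N := sq_nonneg _
  have e6 : Y ≤ C ^ 2 * (N + F) := e2.trans (by gcongr; linarith)
  have e7 : X ≤ Ce * C ^ 2 * (N + F) := by
    refine e1.trans ?_
    rw [mul_assoc]
    refine mul_le_mul_of_nonneg_left ?_ hCe.le
    have := le_mul_of_one_le_left hN0 hCsq
    linarith
  have e8 : W ≤ 2 * C ^ 2 * (C ^ 2 + K ^ 2 * (Ce * C ^ 2)) / C₁ ^ 2 * (N + F) := by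
    rw [div_mul_eq_mul_div, le_div_iff₀ (by positivity), mul_comm]
    refine (e5.trans e4).trans ?_
    rw [mul_assoc (2 * C ^ 2)]
    refine mul_le_mul_of_nonneg_left ?_ (by positivity)
    have := mul_le_mul_of_nonneg_left e7 (sq_nonneg K)
    linarith
  have e9 : ∫ t, ‖u t‖ ^ 2 ∂timeMeasure T + W ≤ D * (N + F) := by
    have := mul_le_mul_of_nonneg_left e7 (sq_nonneg C)
    rw [hD, add_mul]
    linarith
  have e10 : N + F ≤ (‖u₀‖ + l2Norm T f) ^ 2 := by
    have h1 : l2Norm T f ^ 2 = F := Real.sq_sqrt hF0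
    have h2 : 0 ≤ ‖u₀‖ * l2Norm T f := mul_nonneg (norm_nonneg _) (Real.sqrt_nonneg _)
    rw [add_sq, h1, hN]
    linarith
  have h0 : 0 ≤ ‖u₀‖ + l2Norm T f := add_nonneg (norm_nonneg _) (Real.sqrt_nonneg _)
  rw [wNorm, ← Real.sqrt_sq h0, ← Real.sqrt_mul hD0.le]
  exact Real.sqrt_le_sqrt (e9.trans (mul_le_mul_of_nonneg_left e10 hD0.le))

end WellPosed

end EvolvingPair

end EvolvingSpace

theorem theorem3p3 {T : ℝ} (hT : 0 < T) {H : ℝ → Type*} {V : ℝ → Type*}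
    [∀ t, NormedAddCommGroup (H t)] [∀ t, InnerProductSpace ℝ (H t)]
    [∀ t, CompleteSpace (H t)] [∀ t, TopologicalSpace.SeparableSpace (H t)]
    [∀ t, NormedAddCommGroup (V t)] [∀ t, InnerProductSpace ℝ (V t)]
    [∀ t, CompleteSpace (V t)] [∀ t, TopologicalSpace.SeparableSpace (V t)]
    (S : EvolvingSpace.EvolvingPair T H V)
    (hnorm : S.DifferentiableNorm) (hequiv : S.SpaceEquivalence)
    (L : ∀ t, StrongDual ℝ (V t) →ₗ[ℝ] StrongDual ℝ (V t))
    (LH : ∀ t, H t →ₗ[ℝ] H t) (LV : ∀ t, V t →ₗ[ℝ] V t)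
    (Ldot : ∀ t, V t →ₗ[ℝ] StrongDual ℝ (V t))
    (hL : S.LAssumptions L LH LV Ldot)
    (A : ∀ t, V t →ₗ[ℝ] StrongDual ℝ (V t)) (hA : S.AAssumptions A) :
    ∃ C : ℝ, 0 < C ∧
      ∀ f : ∀ t, StrongDual ℝ (V t), EvolvingSpace.MemL2Dual T S.φV f → ∀ u₀ : H 0,
        ∃ (u : ∀ t, V t) (g : ∀ t, StrongDual ℝ (V t)),
          S.IsSolution L A f u₀ u g ∧
          (∀ (u' : ∀ t, V t) (g' : ∀ t, StrongDual ℝ (V t)), S.IsSolution L A f u₀ u' g' →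
            ∀ᵐ t ∂EvolvingSpace.timeMeasure T, u' t = u t) ∧
          EvolvingSpace.wNorm T u g ≤ C * (‖u₀‖ + EvolvingSpace.l2Norm T f) := by
  obtain ⟨M, M', B, K, c, α, β, hP, hM, hB⟩ :=
    EvolvingSpace.EvolvingPair.exists_isParabolic hT hnorm hL hA
  obtain ⟨C, hC, hest⟩ :=
    EvolvingSpace.EvolvingPair.IsSolution.exists_estimate hT hnorm hL hP hM hB
  refine ⟨C, hC, fun f hf u₀ => ?_⟩
  obtain ⟨u, g, hu⟩ :=
    EvolvingSpace.EvolvingPair.exists_isSolution hT hnorm hequiv hL hP hM hB hf u₀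
  exact ⟨u, g, hu, fun u' g' hu' => hu.ae_unique hT hnorm hL hP hM hB hf hu',
    hest f u₀ u g hf hu⟩
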